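/- **Setting.** Let $D>0$. For $\varepsilon>0$ put $$\delta^{(\varepsilon)}(u)=\frac{1}{\varepsilon\sqrt{2\pi}}e^{-u^2/(2\varepsilon^2)},\qquad \operatorname{sgn}^{(\varepsilon)}(u)=\frac{2}{\varepsilon\sqrt{2\pi}}\int_0^u e^{-v^2/(2\varepsilon^2)}\,dv,$$ and, for $\rho:\mathbb R^2\to\mathbb R$, let $\vec F^{(\varepsilon)}[\rho]=(F^{(\varepsilon)}_x[\rho],F^{(\varepsilon)}_y[\rho])$ with $$F^{(\varepsilon)}_x[\rho](x,y)=-\iint \operatorname{sgn}^{(\varepsilon)}(x-x')\,\delta^{(\varepsilon)}(y-y')\,\rho(x',y')\,dx'\,dy',$$ $$F^{(\varepsilon)}_y[\rho](x,y)=-\iint \operatorname{sgn}^{(\varepsilon)}(y-y')\,\delta^{(\varepsilon)}(x-x')\,\rho(x',y')\,dx'\,dy'.$$ A solution of the regularized problem with initial datum $\rho_0$ is a function $\rho$ on $[0,\infty)\times\mathbb R^2$ such that, for every $T>0$, $\rho\in C([0,T];L^2(\mathbb R^2))\cap L^2(0,T;H^1(\mathbb R^2))\cap L^\infty(0,T;L^1(\mathbb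 R^2))$, with $\rho(0)=\rho_0$, and $$\partial_t\rho=\nabla\cdot\big(D\nabla\rho-\vec F^{(\varepsilon)}[\rho]\,\rho\big)$$ in the weak sense: for all $\varphi\in C_c^\infty(\mathbb R^2)$ and $t\ge 0$, $$\iint\rho(t)\varphi-\iint\rho_0\varphi=-\int_0^t\iint\big(D\nabla\rho-\vec F^{(\varepsilon)}[\rho]\rho\big)\cdot\nabla\varphi\,dx\,dy\,ds.$$ For $p\ge1$ let $C_p$ be the best constant in the Gagliardo–Nirenberg–Sobolev inequality $$\iint\xi^{p+1}\,dx\,dy\le C_p\iint\xi\,dx\,dy\;\iint|\nabla(\xi^{p/2})|^2\,dx\,dy$$ for non-negative $\xi\in L^1(\mathbb R^2)$ with $\xi^{p/2}\in H^1(\mathbb R^2)$. **Proposition.** Let $(\rho^{(\varepsilon)}_0)_{\varepsilon>0}$ be non-negative functions, bounded in $L^1(\mathbb R^2)\cap L^\infty(\mathbb R^2)$ uniformly in $\varepsilon$, with $\iint\rho_0^{(\varepsilon)}\,dx\,dy\le M_0$ for all $\varepsilon>0$, and for each $\varepsilon>0$ let $\rho^{(\varepsilon)}$ be a solution of the regularized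 problem with initial datum $\rho_0^{(\varepsilon)}$. Then: i) For all $\varepsilon>0$ and $t\ge0$, $\rho^{(\varepsilon)}(t)\in L^1(\mathbb R^2)$ and $\iint\rho^{(\varepsilon)}(t)\,dx\,dy=\iint\rho^{(\varepsilon)}_0\,dx\,dy$. ii) If $1\le p<\infty$ and $D>pC_pM_0$, then $\rho^{(\varepsilon)}$ is bounded in $L^\infty(0,\infty;L^p(\mathbb R^2))$ uniformly in $\varepsilon$, and $\|\rho^{(\varepsilon)}(t)\|_{L^p}\le\|\rho^{(\varepsilon)}_0\|_{L^p}$ for all $\varepsilon>0$ and $t\ge0$. iii) If $D>2C_2M_0$, then $\rho^{(\varepsilon)}$ is bounded in $L^\infty(0,\infty;L^2(\mathbb R^2))\cap L^\infty((0,\infty)\times\mathbb R^2)$ uniformly in $\varepsilon$. iv) If $(x^2+y^2)\rho^{(\varepsilon)}_0$ is bounded in $L^1(\mathbb R^2)$ uniformly in $\varepsilon$, then for every $0<T<\infty$, $(x^2+y^2)\rho^{(\varepsilon)}$ is bounded in $L^\infty(0,T;L^1(\mathbb R^2))$ uniformly in $\varepsilon$. -/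

import Mathlib

open MeasureTheory Set
open scoped NNReal ENNReal ContDiff

noncomputable section

/-- The Gaussian approximation `δ^(ε)` of the Dirac mass on the line. -/
def deltaReg (ε u : ℝ) : ℝ :=
  1 / (ε * Real.sqrt (2 * Real.pi)) * Real.exp (-u ^ 2 / (2 * ε ^ 2))

/-- The smoothed sign function `sgn^(ε)`. -/
def sgnReg (ε u : ℝ) : ℝ :=
  2 * (1 / (ε * Real.sqrt (2 * Real.pi))) * ∫ v in (0 : ℝ)..u, Real.exp (-v ^ 2 / (2 * ε ^ 2))

/-- First component of the regularized force `F^(ε)[g]`. -/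
def regForceX (ε : ℝ) (g : ℝ × ℝ → ℝ) (z : ℝ × ℝ) : ℝ :=
  -∫ w : ℝ × ℝ, sgnReg ε (z.1 - w.1) * deltaReg ε (z.2 - w.2) * g w

/-- Second component of the regularized force `F^(ε)[g]`. -/
def regForceY (ε : ℝ) (g : ℝ × ℝ → ℝ) (z : ℝ × ℝ) : ℝ :=
  -∫ w : ℝ × ℝ, sgnReg ε (z.2 - w.2) * deltaReg ε (z.1 - w.1) * g w

/-- Test functions on the plane: smooth (`C^∞`) with compact support. -/
def IsTestFunction (φ : ℝ × ℝ → ℝ) : Prop :=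
  ContDiff ℝ ∞ φ ∧ HasCompactSupport φ

/-- `∂_x φ`. -/
def partialX (φ : ℝ × ℝ → ℝ) (z : ℝ × ℝ) : ℝ := fderiv ℝ φ z (1, 0)

/-- `∂_y φ`. -/
def partialY (φ : ℝ × ℝ → ℝ) (z : ℝ × ℝ) : ℝ := fderiv ℝ φ z (0, 1)

/-- `(g₁, g₂)` is the weak (distributional) gradient of `u` on the plane. -/
structure HasWeakGradient (u g₁ g₂ : ℝ × ℝ → ℝ) : Prop where
  locInt : LocallyIntegrable u
  locInt₁ : LocallyIntegrable g₁
  locInt₂ : LocallyIntegrable g₂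
  weakX : ∀ φ, IsTestFunction φ → ∫ z, u z * partialX φ z = -∫ z, g₁ z * φ z
  weakY : ∀ φ, IsTestFunction φ → ∫ z, u z * partialY φ z = -∫ z, g₂ z * φ z

/-- `C` is an admissible constant in the Gagliardo-Nirenberg-Sobolev inequality
`∬ ξ^(p+1) ≤ C (∬ ξ) (∬ |∇ (ξ^(p/2))|²)`, for all non-negative integrable `ξ` on the plane
with `ξ^(p/2)` in `H¹`. The left-hand side is a Lebesgue integral with values in `[0, ∞]`. -/
def IsGNSConstant (p C : ℝ) : Prop :=
  0 ≤ C ∧ ∀ ξ g₁ g₂ : ℝ × ℝ → ℝ, (∀ z, 0 ≤ ξ z) → Integrable ξ →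
    MemLp (fun z => ξ z ^ (p / 2)) 2 → HasWeakGradient (fun z => ξ z ^ (p / 2)) g₁ g₂ →
    MemLp g₁ 2 → MemLp g₂ 2 →
    ∫⁻ z, ENNReal.ofReal (ξ z ^ (p + 1)) ≤
      ENNReal.ofReal (C * (∫ z, ξ z) * ∫ z, (g₁ z ^ 2 + g₂ z ^ 2))

/-- The best constant `C_p` in the Gagliardo-Nirenberg-Sobolev inequality. -/
def gnsConst (p : ℝ) : ℝ := sInf {C : ℝ | IsGNSConstant p C}

/-- The space `L²(ℝ²)`. -/
abbrev L2Plane : Type := Lp ℝ 2 (volume : Measure (ℝ × ℝ))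

/-- `ρ` is a (global, weak) solution of the regularized equation
`∂_t ρ = ∇ · (D ∇ρ - F^(ε)[ρ] ρ)` with initial datum `ρ₀`: for every `T > 0` it lies in
`C([0,T]; L²) ∩ L²(0,T; H¹)`, and in `L^∞(0,T; L¹)` so that the force is defined; it starts
from `ρ₀`, and the equation holds when tested against every `φ ∈ C_c^∞(ℝ²)` and integrated
over `[0,t]`. The pair `(G₁, G₂)` is the spatial gradient of `ρ`. -/
structure IsRegularizedSolution (D ε : ℝ) (ρ₀ : ℝ × ℝ → ℝ) (ρ : ℝ → L2Plane) : Prop where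
  continuousOn : ContinuousOn ρ (Ici 0)
  initial : (ρ 0 : ℝ × ℝ → ℝ) =ᵐ[volume] ρ₀
  bounded_L1 : ∀ T > 0, ∃ B : ℝ≥0,
    ∀ᵐ t ∂(volume.restrict (Ioc (0 : ℝ) T)), eLpNorm (ρ t : ℝ × ℝ → ℝ) 1 volume ≤ B
  weak_eq : ∃ G₁ G₂ : ℝ → L2Plane,
    (∀ T > 0, MemLp G₁ 2 (volume.restrict (Ioc (0 : ℝ) T)) ∧
      MemLp G₂ 2 (volume.restrict (Ioc (0 : ℝ) T))) ∧
    (∀ᵐ t ∂(volume.restrict (Ioi (0 : ℝ))), HasWeakGradient (ρ t) (G₁ t) (G₂ t)) ∧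
    ∀ φ : ℝ × ℝ → ℝ, IsTestFunction φ → ∀ t : ℝ, 0 ≤ t →
      (∫ z, ρ t z * φ z) - ∫ z, ρ₀ z * φ z =
        -∫ s in (0 : ℝ)..t, ∫ z,
          ((D * G₁ s z - regForceX ε (ρ s) z * ρ s z) * partialX φ z +
            (D * G₂ s z - regForceY ε (ρ s) z * ρ s z) * partialY φ z)

end

/-!
The proof is the energy method applied to convex functionals of the solution. For an entropy `H`
with second derivative `h`, testing the equation with `H'(ρ)` gives formally
`d/dt ∫ H(ρ) = -D ∫ h(ρ) |∇ρ|² + 4 ∬ Ψ(ρ(z)) ρ(w) δ(z - w) dz dw`, where `Ψ(s) = s H'(s) - H(s)` and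
`δ` is the Gaussian `kernelDelta ε`: the drift term is `∫ ∇Ψ(ρ) · F`, and the divergence of the force
is `-4 δ * ρ` (`integral_mul_regForce`). This is `energy_inequality`, for `h` continuous,
non-negative and compactly supported; the weaker direction `≤` suffices. Its two chain rules
need an argument. In space, `H'(ρ)` is handled by approximating `H¹` functions by test functions
(`HasWeakGradient.comp`). In time the equation is only known in integrated form, and convexity of
`H` bounds `H(ρ(t)) - H(ρ(t - h))` by `H'(ρ(t)) (ρ(t) - ρ(t - h))`, after which one averages over `h`
and lets `h → 0` (`increment_le_integral_inner`).

*Bounds depending on `ε`.* Whenever `Ψ ≤ c H`, the boundedness of `δ` and Grönwall's lemma propagate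
bounds on `∫ H(ρ)` (`integral_entropy_le_exp`). Entropies living on the negative axis give
`IsRegularizedSolution.ae_nonneg`; entropies behaving like `s ^ n` for large `n` give an `L^∞` bound
locally in time (`IsRegularizedSolution.exists_ae_le`). These bounds justify all later manipulations.

*Mass.* The force is bounded, so test functions of linear growth are admissible in the weak
formulation (`IsRegularizedSolution.tendsto_integral_mul_cutoff`); the function `1` gives
`IsRegularizedSolution.integral_eq`.

*`L^p` norms.* For `H(s) = s ^ p` the drift term is at most `4 (p - 1) ∫ ρ ^ (p + 1)`, by Young's
inequality and `∫ δ = 1` (`interaction_le`). The Gagliardo-Nirenberg-Sobolev inequality bounds it by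
`4 (p - 1) C_p M ∫ |∇ ρ ^ (p / 2)|²`, where `M` is the mass, while the dissipation equals
`4 (p - 1) / p D ∫ |∇ ρ ^ (p / 2)|²`; hence the norm decreases if `p C_p M ≤ D`
(`energyRate_lpDensity_le`, `IsRegularizedSolution.integral_rpow_le`). Powers are regularized near
`0` at a scale `η → 0`. That the inequality holds with some finite constant, and therefore with the
infimum `gnsConst p`, follows from the Sobolev inequality `W^{1,1} ⊂ L²` on the plane
(`exists_isGNSConstant`, `isGNSConstant_gnsConst`).

*Uniform boundedness.* With `n + 1 = 2 ^ k`, the cases `p = 1` and `p = 2` of the same inequality,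
applied to powers of `ρ`, show that `∫ ρ ^ (2 n + 2)` cannot increase while it is large compared with
the square of the bound on `∫ ρ ^ (n + 1)` (`energyRate_evenDensity_nonpos`). Iterating over `k`
from the `L²` bound (`IsRegularizedSolution.integral_two_pow_le`) and letting `k → ∞` in Chebyshev's
inequality gives an `L^∞` bound uniform in time and in `ε` (`IsRegularizedSolution.ae_le`).

*Second moments.* The squares `x ^ 2` and `y ^ 2` are replaced by convex functions of linear growth
increasing to them as `R → ∞` (`softSq R`). The kernel of the force is odd and attractive, so
symmetrizing the drift term shows that it has the favourable sign (`integral_mul_kernelConv_nonneg`),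
and diffusion contributes at most `4 D M` per unit of time; Fatou's lemma concludes
(`IsRegularizedSolution.lintegral_sq_mul_le`).
-/

open Filter Topology BoundedContinuousFunction

/-! ### Test functions and cutoffs -/

theorem IsTestFunction.continuous {φ : ℝ × ℝ → ℝ} (h : IsTestFunction φ) : Continuous φ :=
  h.1.continuous

theorem ContDiff.partialX {φ : ℝ × ℝ → ℝ} (h : ContDiff ℝ ∞ φ) : ContDiff ℝ ∞ (partialX φ) := by
  unfold _root_.partialX
  exact (h.fderiv_right (m := ∞) (by simp)).clm_apply contDiff_const

theorem ContDiff.partialY {φ : ℝ × ℝ → ℝ} (h : ContDiff ℝ ∞ φ) : ContDiff ℝ ∞ (partialY φ) := by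
  unfold _root_.partialY
  exact (h.fderiv_right (m := ∞) (by simp)).clm_apply contDiff_const

theorem IsTestFunction.partialX {φ : ℝ × ℝ → ℝ} (h : IsTestFunction φ) :
    IsTestFunction (partialX φ) :=
  ⟨h.1.partialX, h.2.fderiv_apply (𝕜 := ℝ) (1, 0)⟩

theorem IsTestFunction.partialY {φ : ℝ × ℝ → ℝ} (h : IsTestFunction φ) :
    IsTestFunction (partialY φ) :=
  ⟨h.1.partialY, h.2.fderiv_apply (𝕜 := ℝ) (0, 1)⟩

theorem IsTestFunction.memLp {φ : ℝ × ℝ → ℝ} (h : IsTestFunction φ) (p : ℝ≥0∞) : MemLp φ p :=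
  h.continuous.memLp_of_hasCompactSupport h.2

theorem IsTestFunction.integrable {φ : ℝ × ℝ → ℝ} (h : IsTestFunction φ) : Integrable φ :=
  h.continuous.integrable_of_hasCompactSupport h.2

theorem IsTestFunction.mul_contDiff {φ f : ℝ × ℝ → ℝ} (h : IsTestFunction φ)
    (hf : ContDiff ℝ ∞ f) : IsTestFunction (fun z => f z * φ z) :=
  ⟨hf.mul h.1, h.2.mul_left⟩

theorem partialX_mul {f g : ℝ × ℝ → ℝ} {z : ℝ × ℝ} (hf : DifferentiableAt ℝ f z)
    (hg : DifferentiableAt ℝ g z) :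
    partialX (fun z => f z * g z) z = f z * partialX g z + partialX f z * g z := by
  simp only [partialX, fderiv_fun_mul hf hg, _root_.add_apply, FunLike.coe_smul, Pi.smul_apply,
    smul_eq_mul]
  ring

theorem partialY_mul {f g : ℝ × ℝ → ℝ} {z : ℝ × ℝ} (hf : DifferentiableAt ℝ f z)
    (hg : DifferentiableAt ℝ g z) :
    partialY (fun z => f z * g z) z = f z * partialY g z + partialY f z * g z := by
  simp only [partialY, fderiv_fun_mul hf hg, _root_.add_apply, FunLike.coe_smul, Pi.smul_apply,
    smul_eq_mul]
  ring

theorem partialX_comp {Φ : ℝ → ℝ} {ψ : ℝ} {f : ℝ × ℝ → ℝ} {z : ℝ × ℝ}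
    (hΦ : HasDerivAt Φ ψ (f z)) (hf : DifferentiableAt ℝ f z) :
    partialX (fun z => Φ (f z)) z = ψ * partialX f z := by
  have := (hΦ.comp_hasFDerivAt z hf.hasFDerivAt).fderiv
  simp only [Function.comp_def] at this
  simp [partialX, this]

theorem partialY_comp {Φ : ℝ → ℝ} {ψ : ℝ} {f : ℝ × ℝ → ℝ} {z : ℝ × ℝ}
    (hΦ : HasDerivAt Φ ψ (f z)) (hf : DifferentiableAt ℝ f z) :
    partialY (fun z => Φ (f z)) z = ψ * partialY f z := by
  have := (hΦ.comp_hasFDerivAt z hf.hasFDerivAt).fderiv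
  simp only [Function.comp_def] at this
  simp [partialY, this]

/-- A smooth bump function on the plane, equal to `1` on the unit ball and vanishing off the ball
of radius `2`. -/
noncomputable def planeBump : ContDiffBump (0 : ℝ × ℝ) := ⟨1, 2, one_pos, one_lt_two⟩

/-- The smooth cutoffs `χ (z / (n + 1))`, where `χ` is a fixed bump function. -/
noncomputable def cutoff (n : ℕ) (z : ℝ × ℝ) : ℝ := planeBump (((n : ℝ) + 1)⁻¹ • z)

theorem cutoff_isTest (n : ℕ) : IsTestFunction (cutoff n) := by
  refine ⟨planeBump.contDiff.comp (contDiff_const_smul _), ?_⟩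
  exact planeBump.hasCompactSupport.comp_smul (by positivity)

theorem cutoff_nonneg (n : ℕ) (z : ℝ × ℝ) : 0 ≤ cutoff n z := planeBump.nonneg

theorem cutoff_le_one (n : ℕ) (z : ℝ × ℝ) : cutoff n z ≤ 1 := planeBump.le_one

theorem abs_cutoff_le_one (n : ℕ) (z : ℝ × ℝ) : |cutoff n z| ≤ 1 := by
  rw [abs_of_nonneg (cutoff_nonneg n z)]; exact cutoff_le_one n z

theorem cutoff_eventually_one (z : ℝ × ℝ) : ∀ᶠ n : ℕ in atTop, cutoff n =ᶠ[𝓝 z] fun _ => 1 := by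
  obtain ⟨N, hN⟩ := exists_nat_gt ‖z‖
  filter_upwards [eventually_ge_atTop N] with n hn
  have h1 : ‖z‖ < (n : ℝ) + 1 := by
    have : (N : ℝ) ≤ n := by exact_mod_cast hn
    linarith
  filter_upwards [(isOpen_lt continuous_norm continuous_const).mem_nhds h1] with w hw
  refine planeBump.one_of_mem_closedBall ?_
  simp only [mem_closedBall_zero_iff, norm_smul, norm_inv]
  have h0 : (0 : ℝ) < (n : ℝ) + 1 := by positivity
  rw [Real.norm_of_nonneg h0.le]
  change _ ≤ (1 : ℝ)
  rw [inv_mul_le_iff₀ h0]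
  simpa using le_of_lt hw

theorem partialX_cutoff (n : ℕ) :
    partialX (cutoff n) = fun z => ((n : ℝ) + 1)⁻¹ * partialX planeBump (((n : ℝ) + 1)⁻¹ • z) := by
  funext z
  have := fderiv_comp_smul (𝕜 := ℝ) (f := (planeBump : ℝ × ℝ → ℝ)) (((n : ℝ) + 1)⁻¹) (x := z)
  simp only [partialX]
  change fderiv ℝ (fun z => planeBump (((n : ℝ) + 1)⁻¹ • z)) z (1, 0) = _
  rw [this]; simp

theorem partialY_cutoff (n : ℕ) :
    partialY (cutoff n) = fun z => ((n : ℝ) + 1)⁻¹ * partialY planeBump (((n : ℝ) + 1)⁻¹ • z) := by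
  funext z
  have := fderiv_comp_smul (𝕜 := ℝ) (f := (planeBump : ℝ × ℝ → ℝ)) (((n : ℝ) + 1)⁻¹) (x := z)
  simp only [partialY]
  change fderiv ℝ (fun z => planeBump (((n : ℝ) + 1)⁻¹ • z)) z (0, 1) = _
  rw [this]; simp

theorem partialX_const_mul_comp_smul {f : ℝ × ℝ → ℝ} (hf : Differentiable ℝ f) (c : ℝ) :
    partialX (fun z => c * f (c • z)) = fun z => c ^ 2 * partialX f (c • z) := by
  funext z
  have h1 : DifferentiableAt ℝ (fun z : ℝ × ℝ => f (c • z)) z := by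
    have : Differentiable ℝ (fun z : ℝ × ℝ => f (c • z)) := hf.comp (differentiable_id.const_smul c)
    exact this z
  have := fderiv_comp_smul (𝕜 := ℝ) (f := f) c (x := z)
  simp only [partialX]
  rw [fderiv_const_mul h1, FunLike.coe_smul, Pi.smul_apply, this]
  simp; ring

theorem partialY_const_mul_comp_smul {f : ℝ × ℝ → ℝ} (hf : Differentiable ℝ f) (c : ℝ) :
    partialY (fun z => c * f (c • z)) = fun z => c ^ 2 * partialY f (c • z) := by
  funext z
  have h1 : DifferentiableAt ℝ (fun z : ℝ × ℝ => f (c • z)) z := by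
    have : Differentiable ℝ (fun z : ℝ × ℝ => f (c • z)) := hf.comp (differentiable_id.const_smul c)
    exact this z
  have := fderiv_comp_smul (𝕜 := ℝ) (f := f) c (x := z)
  simp only [partialY]
  rw [fderiv_const_mul h1, FunLike.coe_smul, Pi.smul_apply, this]
  simp; ring

theorem planeBump_isTest : IsTestFunction planeBump :=
  ⟨planeBump.contDiff, planeBump.hasCompactSupport⟩

/-- Weighted bounds on the derivatives of the cutoffs: the first derivatives are `O(1/n)`, and first
and second derivatives remain bounded after multiplication by `1 + ‖z‖`. -/
theorem exists_cutoff_bound : ∃ C, 0 ≤ C ∧ ∀ n z,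
    |partialX (cutoff n) z| ≤ C / ((n : ℝ) + 1) ∧ |partialY (cutoff n) z| ≤ C / ((n : ℝ) + 1) ∧
    |partialX (cutoff n) z| * (1 + ‖z‖) ≤ C ∧ |partialY (cutoff n) z| * (1 + ‖z‖) ≤ C ∧
    |partialX (partialX (cutoff n)) z| * (1 + ‖z‖) ≤ C ∧
    |partialY (partialY (cutoff n)) z| * (1 + ‖z‖) ≤ C := by
  have key : ∀ φ, IsTestFunction φ → ∃ C, 0 ≤ C ∧ ∀ z, |φ z| * (1 + ‖z‖) ≤ C := by
    intro φ hφ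
    have hc : Continuous (fun z => φ z * (1 + ‖z‖)) := hφ.continuous.mul (by fun_prop)
    obtain ⟨C, hC⟩ := hc.bounded_above_of_compact_support hφ.2.mul_right
    refine ⟨C, (norm_nonneg _).trans (hC 0), fun z => ?_⟩
    have := hC z
    rwa [norm_mul, Real.norm_eq_abs, Real.norm_of_nonneg (by positivity : 0 ≤ 1 + ‖z‖)] at this
  obtain ⟨C1, h1, H1⟩ := key _ planeBump_isTest.partialX
  obtain ⟨C2, h2, H2⟩ := key _ planeBump_isTest.partialY
  obtain ⟨C3, h3, H3⟩ := key _ planeBump_isTest.partialX.partialX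
  obtain ⟨C4, h4, H4⟩ := key _ planeBump_isTest.partialY.partialY
  refine ⟨C1 + C2 + C3 + C4, by positivity, fun n z => ?_⟩
  set c : ℝ := ((n : ℝ) + 1)⁻¹ with hc
  have hn : (1 : ℝ) ≤ (n : ℝ) + 1 := by
    have : (0 : ℝ) ≤ n := by positivity
    linarith
  have c0 : 0 < c := by positivity
  have c1 : c ≤ 1 := inv_le_one_of_one_le₀ hn
  have gen0 : ∀ (φ : ℝ × ℝ → ℝ) (C : ℝ), (∀ z, |φ z| * (1 + ‖z‖) ≤ C) → |c * φ (c • z)| ≤ C * c := by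
    intro φ C H
    have := H (c • z)
    rw [abs_mul, abs_of_pos c0]
    nlinarith [abs_nonneg (φ (c • z)), norm_nonneg (c • z),
      mul_nonneg (abs_nonneg (φ (c • z))) (norm_nonneg (c • z))]
  have gen1 : ∀ (φ : ℝ × ℝ → ℝ) (C : ℝ), (∀ z, |φ z| * (1 + ‖z‖) ≤ C) → |c * φ (c • z)| * (1 + ‖z‖) ≤ C := by
    intro φ C H
    refine le_trans ?_ (H (c • z))
    rw [abs_mul, abs_of_pos c0, norm_smul, Real.norm_of_nonneg c0.le]
    nlinarith [abs_nonneg (φ (c • z)), norm_nonneg z]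
  have gen2 : ∀ (φ : ℝ × ℝ → ℝ) (C : ℝ), (∀ z, |φ z| * (1 + ‖z‖) ≤ C) → |c ^ 2 * φ (c • z)| * (1 + ‖z‖) ≤ C := by
    intro φ C H
    refine le_trans ?_ (gen1 φ C H)
    rw [abs_mul, abs_mul, abs_of_pos c0, abs_of_pos (pow_pos c0 2)]
    gcongr
    nlinarith
  have eX : partialX (cutoff n) = fun z => c * partialX planeBump (c • z) := partialX_cutoff n
  have eY : partialY (cutoff n) = fun z => c * partialY planeBump (c • z) := partialY_cutoff n
  have eXX : partialX (partialX (cutoff n)) =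
      fun z => c ^ 2 * partialX (partialX planeBump) (c • z) := by
    rw [eX, partialX_const_mul_comp_smul]
    exact planeBump_isTest.partialX.1.differentiable (by simp)
  have eYY : partialY (partialY (cutoff n)) =
      fun z => c ^ 2 * partialY (partialY planeBump) (c • z) := by
    rw [eY, partialY_const_mul_comp_smul]
    exact planeBump_isTest.partialY.1.differentiable (by simp)
  rw [eXX, eYY, eX, eY]
  have d : (C1 + C2 + C3 + C4) / ((n : ℝ) + 1) = (C1 + C2 + C3 + C4) * c := by
    rw [hc, div_eq_mul_inv]
  rw [d]
  refine ⟨(gen0 _ _ H1).trans ?_, (gen0 _ _ H2).trans ?_, (gen1 _ _ H1).trans ?_,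
    (gen1 _ _ H2).trans ?_, (gen2 _ _ H3).trans ?_, (gen2 _ _ H4).trans ?_⟩ <;>
  first | (gcongr; linarith) | linarith

theorem Filter.EventuallyEq.partialX_eq {f g : ℝ × ℝ → ℝ} {z : ℝ × ℝ} (h : f =ᶠ[𝓝 z] g) :
    partialX f =ᶠ[𝓝 z] partialX g := by
  filter_upwards [h.fderiv (𝕜 := ℝ)] with w hw
  simp [partialX, hw]

theorem Filter.EventuallyEq.partialY_eq {f g : ℝ × ℝ → ℝ} {z : ℝ × ℝ} (h : f =ᶠ[𝓝 z] g) :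
    partialY f =ᶠ[𝓝 z] partialY g := by
  filter_upwards [h.fderiv (𝕜 := ℝ)] with w hw
  simp [partialY, hw]

theorem cutoff_tendsto (z : ℝ × ℝ) : Tendsto (fun n => cutoff n z) atTop (𝓝 1) :=
  tendsto_const_nhds.congr' <| (cutoff_eventually_one z).mono fun _ h => h.self_of_nhds.symm

/-! ### Square-integrable functions on the plane -/

theorem l2_inner_eq (u v : L2Plane) : inner ℝ u v = ∫ z, u z * v z := by
  rw [L2.inner_def]
  simp [mul_comm]

theorem l2_inner_toLp (u : L2Plane) {f : ℝ × ℝ → ℝ} (hf : MemLp f 2) :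
    inner ℝ u (hf.toLp f) = ∫ z, u z * f z := by
  rw [l2_inner_eq]
  refine integral_congr_ae ?_
  filter_upwards [hf.coeFn_toLp] with z hz
  rw [hz]

theorem l2_norm_sq_eq (u : L2Plane) : ‖u‖ ^ 2 = ∫ z, u z ^ 2 := by
  rw [← real_inner_self_eq_norm_sq, l2_inner_eq]
  simp [sq]

theorem l2_integrable_mul (u v : L2Plane) : Integrable (fun z => u z * v z) :=
  (Lp.memLp u).integrable_mul (Lp.memLp v)

theorem toLp_norm_sq_eq {f : ℝ × ℝ → ℝ} (hf : MemLp f 2) : ‖hf.toLp f‖ ^ 2 = ∫ z, f z ^ 2 := by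
  rw [l2_norm_sq_eq]
  refine integral_congr_ae ?_
  filter_upwards [hf.coeFn_toLp] with z hz
  rw [hz]

/-- Translations act continuously on `L²`. -/
theorem tendsto_eLpNorm_translate_sub {G F : Type*} [NormedAddCommGroup G] [MeasurableSpace G]
    [BorelSpace G] [LocallyCompactSpace G] [SecondCountableTopology G] [NormedAddCommGroup F] {μ : Measure G} [μ.IsAddHaarMeasure]
    {f : G → F} (hf : MemLp f 2 μ) :
    Tendsto (fun a => eLpNorm (fun x => f (x - a) - f x) 2 μ) (𝓝 0) (𝓝 0) := by
  have hmp : ∀ a : G, MeasurePreserving (fun x => x - a) μ μ :=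
    fun a => measurePreserving_sub_right μ a
  let g : G → C(G, G) := fun a => ⟨fun x => x - a, by fun_prop⟩
  have hg : Tendsto g (𝓝 0) (𝓝 (g 0)) := by
    have : Continuous g := by
      let k : C(G × G, G) := ⟨fun p => p.2 - p.1, by fun_prop⟩
      exact k.curry.continuous
    exact this.tendsto 0
  have h := Filter.Tendsto.compMeasurePreservingLp (ν := μ) (μ := μ) (p := 2)
    (tendsto_const_nhds (x := hf.toLp f) (f := 𝓝 (0 : G))) hg hmp (hmp 0) (by norm_num)
  rw [Lp.tendsto_Lp_iff_tendsto_eLpNorm'] at h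
  refine h.congr fun a => eLpNorm_congr_ae ?_
  have e1 := Lp.coeFn_compMeasurePreserving (hf.toLp f) (hmp a)
  have e2 := Lp.coeFn_compMeasurePreserving (hf.toLp f) (hmp 0)
  have e3 := (hmp a).quasiMeasurePreserving.ae_eq_comp hf.coeFn_toLp
  have e4 := (hmp 0).quasiMeasurePreserving.ae_eq_comp hf.coeFn_toLp
  filter_upwards [e1, e2, e3, e4] with x h1 h2 h3 h4
  simp only [Pi.sub_apply]
  have h1' : (Lp.compMeasurePreserving (g a) (hmp a) (hf.toLp f)) x = (hf.toLp f) (x - a) := h1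
  have h2' : (Lp.compMeasurePreserving (g 0) (hmp 0) (hf.toLp f)) x = (hf.toLp f) (x - 0) := h2
  have h3' : (hf.toLp f) (x - a) = f (x - a) := h3
  have h4' : (hf.toLp f) (x - 0) = f (x - 0) := h4
  rw [h1', h2', h3', h4', sub_zero]

/-! ### Mollification and density of test functions in `H¹` -/

/-- The convolution of `f` with the kernel `ψ`. -/
noncomputable def kernelConv (ψ f : ℝ × ℝ → ℝ) (z : ℝ × ℝ) : ℝ := ∫ w, f w * ψ (z - w)

theorem kernelConv_eq_convolution (ψ f : ℝ × ℝ → ℝ) :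
    kernelConv ψ f = MeasureTheory.convolution f ψ (ContinuousLinearMap.mul ℝ ℝ) volume := by
  funext z
  simp [kernelConv, convolution_def]

theorem contDiff_kernelConv {ψ f : ℝ × ℝ → ℝ} (hψ : IsTestFunction ψ) (hf : LocallyIntegrable f) :
    ContDiff ℝ ∞ (kernelConv ψ f) := by
  rw [kernelConv_eq_convolution]
  exact hψ.2.contDiff_convolution_right _ hf hψ.1

theorem partialX_kernelConv {ψ f : ℝ × ℝ → ℝ} (hψ : IsTestFunction ψ) (hf : LocallyIntegrable f)
    (z : ℝ × ℝ) : partialX (kernelConv ψ f) z = ∫ w, f w * partialX ψ (z - w) := by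
  have h := hψ.2.hasFDerivAt_convolution_right (ContinuousLinearMap.mul ℝ ℝ) hf
    (hψ.1.of_le (by simp)) z
  rw [partialX, kernelConv_eq_convolution, h.fderiv,
    convolution_precompR_apply _ hf (hψ.2.fderiv ℝ) (hψ.1.continuous_fderiv (by simp))]
  simp [convolution_def, partialX]

theorem partialY_kernelConv {ψ f : ℝ × ℝ → ℝ} (hψ : IsTestFunction ψ) (hf : LocallyIntegrable f)
    (z : ℝ × ℝ) : partialY (kernelConv ψ f) z = ∫ w, f w * partialY ψ (z - w) := by
  have h := hψ.2.hasFDerivAt_convolution_right (ContinuousLinearMap.mul ℝ ℝ) hf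
    (hψ.1.of_le (by simp)) z
  rw [partialY, kernelConv_eq_convolution, h.fderiv,
    convolution_precompR_apply _ hf (hψ.2.fderiv ℝ) (hψ.1.continuous_fderiv (by simp))]
  simp [convolution_def, partialY]

theorem IsTestFunction.comp_sub_left {ψ : ℝ × ℝ → ℝ} (hψ : IsTestFunction ψ) (z : ℝ × ℝ) :
    IsTestFunction (fun w => ψ (z - w)) :=
  ⟨hψ.1.comp (contDiff_const.sub contDiff_id), hψ.2.comp_homeomorph (Homeomorph.subLeft z)⟩

theorem partialX_comp_sub_left {ψ : ℝ × ℝ → ℝ} (hψ : IsTestFunction ψ) (z w : ℝ × ℝ) :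
    partialX (fun w => ψ (z - w)) w = -partialX ψ (z - w) := by
  have h1 : HasFDerivAt ψ (fderiv ℝ ψ (z - w)) (z - w) :=
    (hψ.1.differentiable (by simp) _).hasFDerivAt
  have h2 := h1.comp w ((hasFDerivAt_const z w).sub (hasFDerivAt_id w))
  have h3 := h2.fderiv
  simp only [Function.comp_def] at h3
  rw [partialX]
  erw [h3]
  simp [partialX]

theorem partialY_comp_sub_left {ψ : ℝ × ℝ → ℝ} (hψ : IsTestFunction ψ) (z w : ℝ × ℝ) :
    partialY (fun w => ψ (z - w)) w = -partialY ψ (z - w) := by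
  have h1 : HasFDerivAt ψ (fderiv ℝ ψ (z - w)) (z - w) :=
    (hψ.1.differentiable (by simp) _).hasFDerivAt
  have h2 := h1.comp w ((hasFDerivAt_const z w).sub (hasFDerivAt_id w))
  have h3 := h2.fderiv
  simp only [Function.comp_def] at h3
  rw [partialY]
  erw [h3]
  simp [partialY]

theorem HasWeakGradient.partialX_kernelConv {u g₁ g₂ ψ : ℝ × ℝ → ℝ} (hu : HasWeakGradient u g₁ g₂)
    (hψ : IsTestFunction ψ) : partialX (kernelConv ψ u) = kernelConv ψ g₁ := by
  funext z
  rw [_root_.partialX_kernelConv hψ hu.locInt]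
  have := hu.weakX _ (hψ.comp_sub_left z)
  simp only [partialX_comp_sub_left hψ, mul_neg, integral_neg, neg_inj] at this
  exact this

theorem HasWeakGradient.partialY_kernelConv {u g₁ g₂ ψ : ℝ × ℝ → ℝ} (hu : HasWeakGradient u g₁ g₂)
    (hψ : IsTestFunction ψ) : partialY (kernelConv ψ u) = kernelConv ψ g₂ := by
  funext z
  rw [_root_.partialY_kernelConv hψ hu.locInt]
  have := hu.weakY _ (hψ.comp_sub_left z)
  simp only [partialY_comp_sub_left hψ, mul_neg, integral_neg, neg_inj] at this
  exact this

theorem eLpNorm_two_sq {α : Type*} {m : MeasurableSpace α} {F : Type*} [NormedAddCommGroup F]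
    (f : α → F) (μ : Measure α) : eLpNorm f 2 μ ^ 2 = ∫⁻ z, ‖f z‖ₑ ^ 2 ∂μ := by
  have h := eLpNorm_nnreal_pow_eq_lintegral (f := f) (μ := μ) (p := 2) (by norm_num)
  simpa using! h

/-- The `L²` distance from `f` to its convolution with a probability density is at most the largest
`L²` distance from `f` to its translates by vectors in the support of the density. -/
theorem eLpNorm_kernelConv_sub_le {f ψ : ℝ × ℝ → ℝ} (hf : StronglyMeasurable f)
    (hf' : LocallyIntegrable f) (hψ : IsTestFunction ψ) (hψ0 : ∀ z, 0 ≤ ψ z)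
    (hψ1 : ∫ z, ψ z = 1) {C : ℝ≥0∞}
    (hC : ∀ t, ψ t ≠ 0 → eLpNorm (fun z => f (z - t) - f z) 2 ≤ C) :
    eLpNorm (fun z => kernelConv ψ f z - f z) 2 ≤ C := by
  let ψ' : ℝ × ℝ → ℝ≥0∞ := fun t => ENNReal.ofReal (ψ t)
  have mψ' : Measurable ψ' := hψ.continuous.measurable.ennreal_ofReal
  let ν : Measure (ℝ × ℝ) := volume.withDensity ψ'
  have hI : ∫⁻ t, ψ' t = 1 := by
    rw [← ofReal_integral_eq_lintegral_ofReal hψ.integrable (ae_of_all _ hψ0), hψ1]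
    simp
  have hν : IsProbabilityMeasure ν := by
    refine ⟨?_⟩
    rw [withDensity_apply _ MeasurableSet.univ, Measure.restrict_univ, hI]
  have m2 : Measurable (fun p : (ℝ × ℝ) × (ℝ × ℝ) => f (p.1 - p.2) - f p.1) :=
    (hf.measurable.comp (measurable_fst.sub measurable_snd)).sub (hf.measurable.comp measurable_fst)
  have hpt : ∀ z, kernelConv ψ f z - f z = ∫ t, (f (z - t) - f z) ∂ν := by
    intro z
    have e1 : kernelConv ψ f z = ∫ t, ψ t * f (z - t) := by
      unfold kernelConv
      rw [← integral_sub_left_eq_self (fun w => f w * ψ (z - w)) volume z]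
      simp [mul_comm]
    have e2 : f z = ∫ t, ψ t * f z := by rw [integral_mul_const, hψ1, one_mul]
    have i1 : Integrable (fun t => ψ t * f (z - t)) := by
      have := hψ.2.convolutionExists_left (ContinuousLinearMap.mul ℝ ℝ) hψ.continuous hf' z
      simpa [ConvolutionExistsAt] using this
    rw [integral_withDensity_eq_integral_toReal_smul mψ' (ae_of_all _ fun t => by simp [ψ'])]
    rw [e1]
    conv_lhs => rw [e2]
    rw [← integral_sub i1 (hψ.integrable.mul_const _)]
    refine integral_congr_ae (ae_of_all _ fun t => ?_)
    simp [ψ', ENNReal.toReal_ofReal (hψ0 t)]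
    ring
  have hpt2 : ∀ z, ‖kernelConv ψ f z - f z‖ₑ ^ 2 ≤ ∫⁻ t, ‖f (z - t) - f z‖ₑ ^ 2 ∂ν := by
    intro z
    have mz : AEStronglyMeasurable (fun t => f (z - t) - f z) ν :=
      (m2.comp (measurable_const.prodMk measurable_id)).aestronglyMeasurable
    have h1 : ‖kernelConv ψ f z - f z‖ₑ ≤ eLpNorm (fun t => f (z - t) - f z) 1 ν := by
      rw [hpt z, eLpNorm_one_eq_lintegral_enorm]
      exact enorm_integral_le_lintegral_enorm _
    have h2 : eLpNorm (fun t => f (z - t) - f z) 1 ν ≤ eLpNorm (fun t => f (z - t) - f z) 2 ν :=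
      eLpNorm_le_eLpNorm_of_exponent_le (by norm_num) mz
    rw [← eLpNorm_two_sq]
    exact pow_le_pow_left₀ (by simp) (h1.trans h2) 2
  have m3 : Measurable (fun p : (ℝ × ℝ) × (ℝ × ℝ) => ‖f (p.1 - p.2) - f p.1‖ₑ ^ 2) :=
    m2.enorm.pow_const 2
  have m4 : Measurable (fun t => ∫⁻ z, ‖f (z - t) - f z‖ₑ ^ 2) :=
    (m3.comp measurable_swap).lintegral_prod_right'
  have s1 : ∫⁻ z, ‖kernelConv ψ f z - f z‖ₑ ^ 2 ≤ ∫⁻ z, ∫⁻ t, ‖f (z - t) - f z‖ₑ ^ 2 ∂ν :=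
    lintegral_mono hpt2
  have s2 : ∫⁻ z, ∫⁻ t, ‖f (z - t) - f z‖ₑ ^ 2 ∂ν =
      ∫⁻ t, ∫⁻ z, ‖f (z - t) - f z‖ₑ ^ 2 ∂volume ∂ν :=
    lintegral_lintegral_swap m3.aemeasurable
  have s3 : ∫⁻ t, ∫⁻ z, ‖f (z - t) - f z‖ₑ ^ 2 ∂volume ∂ν =
      ∫⁻ t, ψ' t * ∫⁻ z, ‖f (z - t) - f z‖ₑ ^ 2 :=
    lintegral_withDensity_eq_lintegral_mul _ mψ' m4
  have s4 : ∫⁻ t, ψ' t * ∫⁻ z, ‖f (z - t) - f z‖ₑ ^ 2 ≤ ∫⁻ t, ψ' t * C ^ 2 := by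
    refine lintegral_mono fun t => ?_
    by_cases ht : ψ t = 0
    · simp [ψ', ht]
    · refine mul_le_mul_right ?_ _
      rw [← eLpNorm_two_sq]
      exact pow_le_pow_left₀ (by simp) (hC t ht) 2
  rw [lintegral_mul_const _ mψ', hI, one_mul] at s4
  have h5 : eLpNorm (fun z => kernelConv ψ f z - f z) 2 ^ 2 ≤ C ^ 2 := by
    rw [eLpNorm_two_sq]
    exact s1.trans ((s2.trans s3).le.trans s4)
  exact (ENNReal.pow_le_pow_left_iff (by norm_num)).1 h5

/-- Normalized bump functions supported in the ball of radius `1 / (n + 1)`. -/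
noncomputable def mollifier (n : ℕ) : ℝ × ℝ → ℝ :=
  (⟨((n : ℝ) + 1)⁻¹ / 2, ((n : ℝ) + 1)⁻¹, by positivity, half_lt_self (by positivity)⟩ :
    ContDiffBump (0 : ℝ × ℝ)).normed volume

theorem mollifier_isTest (n : ℕ) : IsTestFunction (mollifier n) :=
  ⟨ContDiffBump.contDiff_normed _, ContDiffBump.hasCompactSupport_normed _⟩

theorem norm_lt_of_mollifier_ne_zero {n : ℕ} {z : ℝ × ℝ} (h : mollifier n z ≠ 0) :
    ‖z‖ < ((n : ℝ) + 1)⁻¹ := by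
  have : z ∈ Function.support (mollifier n) := h
  unfold mollifier at this
  rw [ContDiffBump.support_normed_eq] at this
  simpa using this

theorem l2_locallyIntegrable (u : L2Plane) : LocallyIntegrable u :=
  (Lp.memLp u).locallyIntegrable (by norm_num)

theorem tendsto_kernelConv (u : L2Plane) :
    Tendsto (fun n => eLpNorm (fun z => kernelConv (mollifier n) u z - u z) 2) atTop (𝓝 0) := by
  have h := tendsto_eLpNorm_translate_sub (Lp.memLp u)
  rw [ENNReal.tendsto_atTop_zero]
  intro ε hε
  have h1 := h.eventually (ge_mem_nhds hε)
  obtain ⟨δ, hδ, hb⟩ := Metric.eventually_nhds_iff.1 h1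
  obtain ⟨N, hN⟩ := exists_nat_one_div_lt hδ
  refine ⟨N, fun n hn => ?_⟩
  refine eLpNorm_kernelConv_sub_le (Lp.stronglyMeasurable u) (l2_locallyIntegrable u)
    (mollifier_isTest n) (ContDiffBump.nonneg_normed _) (ContDiffBump.integral_normed _) ?_
  intro t ht
  refine hb ?_
  rw [dist_zero_right]
  refine (norm_lt_of_mollifier_ne_zero ht).trans_le (le_trans ?_ hN.le)
  rw [one_div]
  gcongr

theorem tendsto_eLpNorm_cutoff_mul_sub {f : ℕ → ℝ × ℝ → ℝ} {g : ℝ × ℝ → ℝ}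
    (hf : ∀ n, AEStronglyMeasurable (f n)) (hg : MemLp g 2)
    (h : Tendsto (fun n => eLpNorm (fun z => f n z - g z) 2) atTop (𝓝 0)) :
    Tendsto (fun n => eLpNorm (fun z => cutoff n z * f n z - g z) 2) atTop (𝓝 0) := by
  have hc : ∀ n, AEStronglyMeasurable (cutoff n) volume :=
    fun n => (cutoff_isTest n).continuous.aestronglyMeasurable
  have h2 : Tendsto (fun n => eLpNorm (fun z => (cutoff n z - 1) * g z) 2) atTop (𝓝 0) := by
    have hsq : ∀ n, eLpNorm (fun z => (cutoff n z - 1) * g z) 2 =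
        (∫⁻ z, ‖(cutoff n z - 1) * g z‖ₑ ^ (2 : ℝ)) ^ (1 / (2 : ℝ)) := by
      intro n
      rw [eLpNorm_eq_lintegral_rpow_enorm_toReal (by norm_num) (by norm_num)]
      simp
    simp only [hsq]
    have : Tendsto (fun n => ∫⁻ z, ‖(cutoff n z - 1) * g z‖ₑ ^ (2 : ℝ)) atTop
        (𝓝 (∫⁻ _ : ℝ × ℝ, 0)) := by
      refine tendsto_lintegral_of_dominated_convergence' (fun z => ‖g z‖ₑ ^ (2 : ℝ)) ?_ ?_ ?_ ?_
      · intro n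
        exact (((hc n).sub aestronglyMeasurable_const).mul hg.1).enorm.pow_const _
      · intro n
        refine ae_of_all _ fun z => ?_
        refine ENNReal.rpow_le_rpow ?_ (by norm_num)
        rw [enorm_mul]
        refine mul_le_of_le_one_left' ?_
        rw [← ofReal_norm, ← ENNReal.ofReal_one]
        refine ENNReal.ofReal_le_ofReal ?_
        rw [Real.norm_eq_abs, abs_le]
        constructor <;> linarith [cutoff_nonneg n z, cutoff_le_one n z]
      · have := lintegral_rpow_enorm_lt_top_of_eLpNorm_lt_top (by norm_num) (by norm_num) hg.2
        simpa using this.ne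
      · refine ae_of_all _ fun z => ?_
        have e : (0 : ℝ≥0∞) = ‖((1 : ℝ) - 1) * g z‖ₑ ^ (2 : ℝ) := by simp
        rw [e]
        have hcont : Continuous fun x : ℝ => ‖(x - 1) * g z‖ₑ ^ (2 : ℝ) := by fun_prop
        exact (hcont.tendsto 1).comp (cutoff_tendsto z)
    rw [lintegral_zero] at this
    have := (ENNReal.continuous_rpow_const (y := 1 / (2 : ℝ))).tendsto 0 |>.comp this
    simpa [Function.comp_def] using this
  refine tendsto_of_tendsto_of_tendsto_of_le_of_le tendsto_const_nhds
    (by simpa using h.add h2) (fun _ => zero_le) fun n => ?_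
  have e : (fun z => cutoff n z * f n z - g z) =
      (fun z => cutoff n z * (f n z - g z)) + fun z => (cutoff n z - 1) * g z := by
    funext z; simp; ring
  rw [e]
  refine (eLpNorm_add_le ((hc n).mul ((hf n).sub hg.1))
    (((hc n).sub aestronglyMeasurable_const).mul hg.1) (by norm_num)).trans ?_
  refine add_le_add (eLpNorm_mono fun z => ?_) le_rfl
  change ‖cutoff n z * (f n z - g z)‖ ≤ _
  rw [norm_mul]
  exact mul_le_of_le_one_left (norm_nonneg _) (abs_cutoff_le_one n z)

/-- Test functions are dense in `H¹`. -/
theorem HasWeakGradient.exists_test_seq {u g₁ g₂ : L2Plane} (hu : HasWeakGradient u g₁ g₂) :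
    ∃ φ : ℕ → ℝ × ℝ → ℝ, (∀ n, IsTestFunction (φ n)) ∧
      Tendsto (fun n => eLpNorm (fun z => φ n z - u z) 2) atTop (𝓝 0) ∧
      Tendsto (fun n => eLpNorm (fun z => partialX (φ n) z - g₁ z) 2) atTop (𝓝 0) ∧
      Tendsto (fun n => eLpNorm (fun z => partialY (φ n) z - g₂ z) 2) atTop (𝓝 0) := by
  have cm : ∀ n (v : L2Plane), ContDiff ℝ ∞ (kernelConv (mollifier n) v) :=
    fun n v => contDiff_kernelConv (mollifier_isTest n) (l2_locallyIntegrable v)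
  have am : ∀ n (v : L2Plane), AEStronglyMeasurable (kernelConv (mollifier n) v) volume :=
    fun n v => (cm n v).continuous.aestronglyMeasurable
  have dm : ∀ n (v : L2Plane), Differentiable ℝ (kernelConv (mollifier n) v) :=
    fun n v => (cm n v).differentiable (by simp)
  have dc : ∀ n, Differentiable ℝ (cutoff n) :=
    fun n => (cutoff_isTest n).1.differentiable (by simp)
  obtain ⟨C, hC0, hC⟩ := exists_cutoff_bound
  -- The terms where the derivative hits the cutoff are `O(1/n)` in `L²`.
  have small : ∀ (d : ℕ → ℝ × ℝ → ℝ), (∀ n, Continuous (d n)) →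
      (∀ n z, |d n z| ≤ C / ((n : ℝ) + 1)) →
      Tendsto (fun n => eLpNorm (fun z => d n z * kernelConv (mollifier n) u z) 2) atTop (𝓝 0) := by
    intro d _ hd
    have hb : Tendsto (fun n : ℕ => ENNReal.ofReal (C / ((n : ℝ) + 1)) *
        (eLpNorm (fun z => kernelConv (mollifier n) u z - u z) 2 + eLpNorm u 2)) atTop (𝓝 0) := by
      have t1 : Tendsto (fun n : ℕ => ENNReal.ofReal (C / ((n : ℝ) + 1))) atTop (𝓝 0) := by
        have := tendsto_one_div_add_atTop_nhds_zero_nat (𝕜 := ℝ)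
        have := (this.const_mul C)
        have := (ENNReal.continuous_ofReal.tendsto _).comp this
        simpa [Function.comp_def, div_eq_mul_inv] using this
      have t2 := (tendsto_kernelConv u).add_const (eLpNorm u 2)
      rw [zero_add] at t2
      have := ENNReal.Tendsto.mul t1 (Or.inr (Lp.memLp u).2.ne) t2 (Or.inr (by simp))
      simpa using this
    refine tendsto_of_tendsto_of_tendsto_of_le_of_le tendsto_const_nhds hb
      (fun _ => zero_le) fun n => ?_
    have h1 : eLpNorm (fun z => d n z * kernelConv (mollifier n) u z) 2 ≤
        ENNReal.ofReal (C / ((n : ℝ) + 1)) * eLpNorm (kernelConv (mollifier n) u) 2 := by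
      refine eLpNorm_le_mul_eLpNorm_of_ae_le_mul (ae_of_all _ fun z => ?_) 2
      rw [norm_mul]
      gcongr
      exact hd n z
    refine h1.trans ?_
    gcongr
    have e : kernelConv (mollifier n) u = (fun z => kernelConv (mollifier n) u z - u z) + u := by
      funext z; simp
    conv_lhs => rw [e]
    exact eLpNorm_add_le ((am n u).sub (Lp.aestronglyMeasurable u)) (Lp.aestronglyMeasurable u)
      (by norm_num)
  have grad : ∀ (g : L2Plane) (d : ℕ → ℝ × ℝ → ℝ), (∀ n, Continuous (d n)) →
      (∀ n z, |d n z| ≤ C / ((n : ℝ) + 1)) →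
      Tendsto (fun n => eLpNorm (fun z => (cutoff n z * kernelConv (mollifier n) g z +
        d n z * kernelConv (mollifier n) u z) - g z) 2) atTop (𝓝 0) := by
    intro g d hdc hd
    have t1 := tendsto_eLpNorm_cutoff_mul_sub (fun n => am n g) (Lp.memLp g) (tendsto_kernelConv g)
    refine tendsto_of_tendsto_of_tendsto_of_le_of_le tendsto_const_nhds
      (by simpa using t1.add (small d hdc hd)) (fun _ => zero_le) fun n => ?_
    have e : (fun z => (cutoff n z * kernelConv (mollifier n) g z +
        d n z * kernelConv (mollifier n) u z) - g z) =
        (fun z => cutoff n z * kernelConv (mollifier n) g z - g z) +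
        fun z => d n z * kernelConv (mollifier n) u z := by
      funext z; simp; ring
    rw [e]
    exact eLpNorm_add_le
      (((cutoff_isTest n).continuous.aestronglyMeasurable.mul (am n g)).sub
        (Lp.aestronglyMeasurable g))
      ((hdc n).aestronglyMeasurable.mul (am n u)) (by norm_num)
  refine ⟨fun n z => cutoff n z * kernelConv (mollifier n) u z, fun n => ?_, ?_, ?_, ?_⟩
  · have := (cutoff_isTest n).mul_contDiff (cm n u)
    simpa only [mul_comm] using this
  · exact tendsto_eLpNorm_cutoff_mul_sub (fun n => am n u) (Lp.memLp u) (tendsto_kernelConv u)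
  · refine (grad g₁ _ (fun n => (cutoff_isTest n).partialX.continuous)
      (fun n z => (hC n z).1)).congr fun n => ?_
    congr 1
    funext z
    rw [partialX_mul (dc n z) (dm n u z), hu.partialX_kernelConv (mollifier_isTest n)]
  · refine (grad g₂ _ (fun n => (cutoff_isTest n).partialY.continuous)
      (fun n z => (hC n z).2.1)).congr fun n => ?_
    congr 1
    funext z
    rw [partialY_mul (dc n z) (dm n u z), hu.partialY_kernelConv (mollifier_isTest n)]

/-! ### Composition with bounded functions and the chain rule in `H¹` -/

/-- A test function as an element of `L²`. -/
noncomputable def testL2 {φ : ℝ × ℝ → ℝ} (h : IsTestFunction φ) : L2Plane := (h.memLp 2).toLp φ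

theorem coeFn_testL2 {φ : ℝ × ℝ → ℝ} (h : IsTestFunction φ) : testL2 h =ᵐ[volume] φ :=
  (h.memLp 2).coeFn_toLp

theorem inner_testL2 (u : L2Plane) {φ : ℝ × ℝ → ℝ} (h : IsTestFunction φ) :
    inner ℝ u (testL2 h) = ∫ z, u z * φ z := l2_inner_toLp u _

theorem HasWeakGradient.congr_ae {u v g₁ g₂ k₁ k₂ : ℝ × ℝ → ℝ} (h : HasWeakGradient u g₁ g₂)
    (hu : u =ᵐ[volume] v) (h₁ : g₁ =ᵐ[volume] k₁) (h₂ : g₂ =ᵐ[volume] k₂) :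
    HasWeakGradient v k₁ k₂ where
  locInt := h.locInt.congr hu
  locInt₁ := h.locInt₁.congr h₁
  locInt₂ := h.locInt₂.congr h₂
  weakX φ hφ := by
    have e1 : ∫ z, v z * partialX φ z = ∫ z, u z * partialX φ z :=
      integral_congr_ae (hu.mono fun z hz => by simp [hz])
    have e2 : ∫ z, k₁ z * φ z = ∫ z, g₁ z * φ z :=
      integral_congr_ae (h₁.mono fun z hz => by simp [hz])
    rw [e1, e2, h.weakX φ hφ]
  weakY φ hφ := by
    have e1 : ∫ z, v z * partialY φ z = ∫ z, u z * partialY φ z :=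
      integral_congr_ae (hu.mono fun z hz => by simp [hz])
    have e2 : ∫ z, k₂ z * φ z = ∫ z, g₂ z * φ z :=
      integral_congr_ae (h₂.mono fun z hz => by simp [hz])
    rw [e1, e2, h.weakY φ hφ]

/-- Test functions are dense in `H¹`, with convergence in the space `L²`. -/
theorem HasWeakGradient.exists_testL2_seq {u g₁ g₂ : L2Plane} (hu : HasWeakGradient u g₁ g₂) :
    ∃ (φ : ℕ → ℝ × ℝ → ℝ) (h : ∀ n, IsTestFunction (φ n)),
      Tendsto (fun n => testL2 (h n)) atTop (𝓝 u) ∧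
      Tendsto (fun n => testL2 (h n).partialX) atTop (𝓝 g₁) ∧
      Tendsto (fun n => testL2 (h n).partialY) atTop (𝓝 g₂) := by
  obtain ⟨φ, h, h0, h1, h2⟩ := hu.exists_test_seq
  have key : ∀ (f : ℕ → ℝ × ℝ → ℝ) (hf : ∀ n, IsTestFunction (f n)) (v : L2Plane),
      Tendsto (fun n => eLpNorm (fun z => f n z - v z) 2) atTop (𝓝 0) →
      Tendsto (fun n => testL2 (hf n)) atTop (𝓝 v) := by
    intro f hf v H
    rw [Lp.tendsto_Lp_iff_tendsto_eLpNorm']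
    refine H.congr fun n => eLpNorm_congr_ae ?_
    filter_upwards [coeFn_testL2 (hf n)] with z hz
    simp [hz]
  exact ⟨φ, h, key _ _ _ h0, key _ _ _ h1, key _ _ _ h2⟩

theorem memLp_comp_mul (ψ : ℝ →ᵇ ℝ) (u g : L2Plane) : MemLp (fun z => ψ (u z) * g z) 2 := by
  refine (Lp.memLp g).of_le_mul (c := ‖ψ‖)
    ((ψ.continuous.comp_aestronglyMeasurable (Lp.aestronglyMeasurable u)).mul
      (Lp.aestronglyMeasurable g)) (ae_of_all _ fun z => ?_)
  rw [norm_mul]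
  gcongr
  exact ψ.norm_coe_le_norm _

/-- The element `ψ(u) g` of `L²`, for bounded continuous `ψ`. -/
noncomputable def nemMul (ψ : ℝ →ᵇ ℝ) (u g : L2Plane) : L2Plane := (memLp_comp_mul ψ u g).toLp _

theorem coeFn_nemMul (ψ : ℝ →ᵇ ℝ) (u g : L2Plane) :
    nemMul ψ u g =ᵐ[volume] fun z => ψ (u z) * g z := MemLp.coeFn_toLp _

theorem norm_nemMul_le (ψ : ℝ →ᵇ ℝ) (u g : L2Plane) : ‖nemMul ψ u g‖ ≤ ‖ψ‖ * ‖g‖ := by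
  refine Lp.norm_le_mul_norm_of_ae_le_mul ?_
  filter_upwards [coeFn_nemMul ψ u g] with z hz
  rw [hz, norm_mul]
  gcongr
  exact ψ.norm_coe_le_norm _

theorem nemMul_sub (ψ : ℝ →ᵇ ℝ) (u g g' : L2Plane) :
    nemMul ψ u (g - g') = nemMul ψ u g - nemMul ψ u g' := by
  refine Lp.ext ?_
  filter_upwards [coeFn_nemMul ψ u (g - g'), coeFn_nemMul ψ u g, coeFn_nemMul ψ u g',
    Lp.coeFn_sub g g', Lp.coeFn_sub (nemMul ψ u g) (nemMul ψ u g')] with z h1 h2 h3 h4 h5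
  rw [h1, h5, Pi.sub_apply, h2, h3, h4, Pi.sub_apply]
  ring

/-- Convergence in `L²` implies almost everywhere convergence along a subsequence. -/
theorem exists_subseq_ae_tendsto {u : ℕ → L2Plane} {v : L2Plane} (h : Tendsto u atTop (𝓝 v)) :
    ∃ ns : ℕ → ℕ, StrictMono ns ∧ ∀ᵐ z, Tendsto (fun n => u (ns n) z) atTop (𝓝 (v z)) :=
  (tendstoInMeasure_of_tendsto_Lp h).exists_seq_tendsto_ae

/-- If `uₙ → u` almost everywhere, then `ψ(uₙ) g → ψ(u) g` in `L²`. -/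
theorem tendsto_nemMul_of_ae (ψ : ℝ →ᵇ ℝ) {u : ℕ → L2Plane} {v : L2Plane} (g : L2Plane)
    (h : ∀ᵐ z, Tendsto (fun n => u n z) atTop (𝓝 (v z))) :
    Tendsto (fun n => nemMul ψ (u n) g) atTop (𝓝 (nemMul ψ v g)) := by
  rw [tendsto_iff_norm_sub_tendsto_zero]
  have hsq : ∀ n, ‖nemMul ψ (u n) g - nemMul ψ v g‖ ^ 2 =
      ∫ z, ((ψ (u n z) - ψ (v z)) * g z) ^ 2 := by
    intro n
    rw [l2_norm_sq_eq]
    refine integral_congr_ae ?_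
    filter_upwards [coeFn_nemMul ψ (u n) g, coeFn_nemMul ψ v g,
      Lp.coeFn_sub (nemMul ψ (u n) g) (nemMul ψ v g)] with z h1 h2 h3
    rw [h3, Pi.sub_apply, h1, h2]
    ring
  have hlim : Tendsto (fun n => ∫ z, ((ψ (u n z) - ψ (v z)) * g z) ^ 2) atTop
      (𝓝 (∫ _ : ℝ × ℝ, (0 : ℝ))) := by
    refine tendsto_integral_of_dominated_convergence (fun z => (2 * ‖ψ‖) ^ 2 * (g z) ^ 2) ?_ ?_ ?_ ?_
    · intro n
      exact (((ψ.continuous.comp_aestronglyMeasurable (Lp.aestronglyMeasurable (u n))).sub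
        (ψ.continuous.comp_aestronglyMeasurable (Lp.aestronglyMeasurable v))).mul
        (Lp.aestronglyMeasurable g)).pow 2
    · exact (Lp.memLp g).integrable_sq.const_mul _
    · intro n
      refine ae_of_all _ fun z => ?_
      rw [Real.norm_eq_abs, abs_of_nonneg (sq_nonneg _), mul_pow]
      gcongr ?_ * _
      rw [← sq_abs]
      gcongr
      have h1 := ψ.norm_coe_le_norm (u n z)
      have h2 := ψ.norm_coe_le_norm (v z)
      have h3 := norm_sub_le (ψ (u n z)) (ψ (v z))
      rw [← Real.norm_eq_abs]
      linarith
    · filter_upwards [h] with z hz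
      have h1 : Tendsto (fun n => ψ (u n z)) atTop (𝓝 (ψ (v z))) :=
        (ψ.continuous.tendsto _).comp hz
      have h2 := ((h1.sub_const (ψ (v z))).mul_const (g z)).pow 2
      simpa using h2
  rw [integral_zero] at hlim
  have h4 := (Real.continuous_sqrt.tendsto 0).comp hlim
  rw [Real.sqrt_zero] at h4
  refine h4.congr fun n => ?_
  simp only [Function.comp]
  rw [← hsq n, Real.sqrt_sq (norm_nonneg _)]

theorem continuous_nemMul (ψ : ℝ →ᵇ ℝ) :
    Continuous fun p : L2Plane × L2Plane => nemMul ψ p.1 p.2 := by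
  rw [continuous_iff_seqContinuous]
  intro p q hp
  refine tendsto_of_subseq_tendsto fun ns hns => ?_
  have hq := hp.comp hns
  have h1 : Tendsto (fun n => (p (ns n)).1) atTop (𝓝 q.1) := (continuous_fst.tendsto q).comp hq
  have h2 : Tendsto (fun n => (p (ns n)).2) atTop (𝓝 q.2) := (continuous_snd.tendsto q).comp hq
  obtain ⟨ms, hms, hae⟩ := exists_subseq_ae_tendsto h1
  refine ⟨ms, ?_⟩
  have t1 := tendsto_nemMul_of_ae ψ q.2 hae
  have t2 : Tendsto (fun n => nemMul ψ (p (ns (ms n))).1 ((p (ns (ms n))).2 - q.2)) atTop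
      (𝓝 0) := by
    have h3 := (tendsto_iff_norm_sub_tendsto_zero.1 (h2.comp hms.tendsto_atTop)).const_mul ‖ψ‖
    rw [mul_zero] at h3
    exact squeeze_zero_norm (fun n => norm_nemMul_le _ _ _) h3
  have t3 := t2.add t1
  rw [zero_add] at t3
  refine t3.congr fun n => ?_
  rw [nemMul_sub]
  simp

theorem tendsto_nemMul (ψ : ℝ →ᵇ ℝ) {U G : ℕ → L2Plane} {u g : L2Plane}
    (hU : Tendsto U atTop (𝓝 u)) (hG : Tendsto G atTop (𝓝 g)) :
    Tendsto (fun n => nemMul ψ (U n) (G n)) atTop (𝓝 (nemMul ψ u g)) := by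
  have h1 : Tendsto (fun n => (U n, G n)) atTop (𝓝 (u, g)) := hU.prodMk_nhds hG
  exact Tendsto.comp (continuous_nemMul ψ).continuousAt h1

theorem lipschitzWith_of_hasDerivAt {Φ : ℝ → ℝ} (ψ : ℝ →ᵇ ℝ) (h : ∀ s, HasDerivAt Φ (ψ s) s) :
    LipschitzWith ‖ψ‖₊ Φ := by
  refine lipschitzWith_of_nnnorm_deriv_le (fun s => (h s).differentiableAt) fun s => ?_
  rw [(h s).deriv]
  exact ψ.norm_coe_le_norm s

theorem integral_mul_partialX_eq_neg {f ζ : ℝ × ℝ → ℝ} (hf : ContDiff ℝ 1 f)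
    (hζ : IsTestFunction ζ) : ∫ z, f z * partialX ζ z = -∫ z, partialX f z * ζ z := by
  have c1 : Continuous (fun z => fderiv ℝ f z (1, 0)) :=
    (hf.continuous_fderiv one_ne_zero).clm_apply continuous_const
  refine integral_mul_fderiv_eq_neg_fderiv_mul_of_integrable ?_ ?_ ?_
    (fun z _ => hf.differentiable one_ne_zero z)
    (fun z _ => hζ.1.differentiable (by simp) z)
  · exact (c1.mul hζ.continuous).integrable_of_hasCompactSupport hζ.2.mul_left
  · exact (hf.continuous.mul hζ.partialX.continuous).integrable_of_hasCompactSupport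
      hζ.partialX.2.mul_left
  · exact (hf.continuous.mul hζ.continuous).integrable_of_hasCompactSupport hζ.2.mul_left

theorem integral_mul_partialY_eq_neg {f ζ : ℝ × ℝ → ℝ} (hf : ContDiff ℝ 1 f)
    (hζ : IsTestFunction ζ) : ∫ z, f z * partialY ζ z = -∫ z, partialY f z * ζ z := by
  have c1 : Continuous (fun z => fderiv ℝ f z (0, 1)) :=
    (hf.continuous_fderiv one_ne_zero).clm_apply continuous_const
  refine integral_mul_fderiv_eq_neg_fderiv_mul_of_integrable ?_ ?_ ?_
    (fun z _ => hf.differentiable one_ne_zero z)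
    (fun z _ => hζ.1.differentiable (by simp) z)
  · exact (c1.mul hζ.continuous).integrable_of_hasCompactSupport hζ.2.mul_left
  · exact (hf.continuous.mul hζ.partialY.continuous).integrable_of_hasCompactSupport
      hζ.partialY.2.mul_left
  · exact (hf.continuous.mul hζ.continuous).integrable_of_hasCompactSupport hζ.2.mul_left

theorem contDiff_one_of_hasDerivAt {Φ : ℝ → ℝ} (ψ : ℝ →ᵇ ℝ) (h : ∀ s, HasDerivAt Φ (ψ s) s) :
    ContDiff ℝ 1 Φ := by
  rw [contDiff_one_iff_deriv]
  refine ⟨fun s => (h s).differentiableAt, ?_⟩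
  have : deriv Φ = ψ := funext fun s => (h s).deriv
  rw [this]
  exact ψ.continuous

theorem inner_compLp_partialX {φ ζ : ℝ × ℝ → ℝ} (h : IsTestFunction φ) (hζ : IsTestFunction ζ)
    {Φ : ℝ → ℝ} (ψ : ℝ →ᵇ ℝ) (hΦ : ∀ s, HasDerivAt Φ (ψ s) s) (hΦ0 : Φ 0 = 0) :
    inner ℝ ((lipschitzWith_of_hasDerivAt ψ hΦ).compLp hΦ0 (testL2 h)) (testL2 hζ.partialX) =
      -inner ℝ (nemMul ψ (testL2 h) (testL2 h.partialX)) (testL2 hζ) := by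
  rw [inner_testL2, inner_testL2]
  have cd : ContDiff ℝ 1 (fun z => Φ (φ z)) :=
    (contDiff_one_of_hasDerivAt ψ hΦ).comp (h.1.of_le (by simp))
  have dφ : Differentiable ℝ φ := h.1.differentiable (by simp)
  refine Eq.trans (integral_congr_ae ?_) ((integral_mul_partialX_eq_neg cd hζ).trans
    (congrArg Neg.neg (integral_congr_ae ?_)))
  · filter_upwards [(lipschitzWith_of_hasDerivAt ψ hΦ).coeFn_compLp hΦ0 (testL2 h),
      coeFn_testL2 h] with z h3 h4
    rw [h3, Function.comp_apply, h4]
  · filter_upwards [coeFn_nemMul ψ (testL2 h) (testL2 h.partialX),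
      coeFn_testL2 h, coeFn_testL2 h.partialX] with z h3 h4 h5
    rw [h3, h4, h5, partialX_comp (hΦ _) (dφ z)]

theorem inner_compLp_partialY {φ ζ : ℝ × ℝ → ℝ} (h : IsTestFunction φ) (hζ : IsTestFunction ζ)
    {Φ : ℝ → ℝ} (ψ : ℝ →ᵇ ℝ) (hΦ : ∀ s, HasDerivAt Φ (ψ s) s) (hΦ0 : Φ 0 = 0) :
    inner ℝ ((lipschitzWith_of_hasDerivAt ψ hΦ).compLp hΦ0 (testL2 h)) (testL2 hζ.partialY) =
      -inner ℝ (nemMul ψ (testL2 h) (testL2 h.partialY)) (testL2 hζ) := by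
  rw [inner_testL2, inner_testL2]
  have cd : ContDiff ℝ 1 (fun z => Φ (φ z)) :=
    (contDiff_one_of_hasDerivAt ψ hΦ).comp (h.1.of_le (by simp))
  have dφ : Differentiable ℝ φ := h.1.differentiable (by simp)
  refine Eq.trans (integral_congr_ae ?_) ((integral_mul_partialY_eq_neg cd hζ).trans
    (congrArg Neg.neg (integral_congr_ae ?_)))
  · filter_upwards [(lipschitzWith_of_hasDerivAt ψ hΦ).coeFn_compLp hΦ0 (testL2 h),
      coeFn_testL2 h] with z h3 h4
    rw [h3, Function.comp_apply, h4]
  · filter_upwards [coeFn_nemMul ψ (testL2 h) (testL2 h.partialY),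
      coeFn_testL2 h, coeFn_testL2 h.partialY] with z h3 h4 h5
    rw [h3, h4, h5, partialY_comp (hΦ _) (dφ z)]

theorem inner_eq_neg_inner_of_tendsto {X : Type*} [NormedAddCommGroup X] [InnerProductSpace ℝ X]
    {U A : ℕ → X} {u a p q : X} (hU : Tendsto U atTop (𝓝 u)) (hA : Tendsto A atTop (𝓝 a))
    (h : ∀ n, inner ℝ (U n) p = -inner ℝ (A n) q) : inner ℝ u p = -inner ℝ a q :=
  tendsto_nhds_unique (hU.inner tendsto_const_nhds)
    ((hA.inner tendsto_const_nhds).neg.congr fun n => (h n).symm)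

/-- The chain rule for the weak gradient. -/
theorem HasWeakGradient.comp {u g₁ g₂ : L2Plane} (hu : HasWeakGradient u g₁ g₂) {Φ : ℝ → ℝ}
    (ψ : ℝ →ᵇ ℝ) (hΦ : ∀ s, HasDerivAt Φ (ψ s) s) (hΦ0 : Φ 0 = 0) :
    HasWeakGradient ((lipschitzWith_of_hasDerivAt ψ hΦ).compLp hΦ0 u)
      (nemMul ψ u g₁) (nemMul ψ u g₂) := by
  have hL := lipschitzWith_of_hasDerivAt ψ hΦ
  obtain ⟨φ, h, h0, h1, h2⟩ := hu.exists_testL2_seq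
  have lim0 : Tendsto (fun n => hL.compLp hΦ0 (testL2 (h n))) atTop (𝓝 (hL.compLp hΦ0 u)) :=
    ((hL.continuous_compLp hΦ0).tendsto u).comp h0
  have lim1 : Tendsto (fun n => nemMul ψ (testL2 (h n)) (testL2 (h n).partialX)) atTop
      (𝓝 (nemMul ψ u g₁)) := tendsto_nemMul ψ h0 h1
  have lim2 : Tendsto (fun n => nemMul ψ (testL2 (h n)) (testL2 (h n).partialY)) atTop
      (𝓝 (nemMul ψ u g₂)) := tendsto_nemMul ψ h0 h2
  refine ⟨l2_locallyIntegrable _, l2_locallyIntegrable _, l2_locallyIntegrable _, ?_, ?_⟩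
  · intro ζ hζ
    have := inner_eq_neg_inner_of_tendsto lim0 lim1
      fun n => inner_compLp_partialX (h n) hζ ψ hΦ hΦ0
    rwa [inner_testL2 _ hζ, inner_testL2 _ hζ.partialX] at this
  · intro ζ hζ
    have := inner_eq_neg_inner_of_tendsto lim0 lim2
      fun n => inner_compLp_partialY (h n) hζ ψ hΦ hΦ0
    rwa [inner_testL2 _ hζ, inner_testL2 _ hζ.partialY] at this

/-! ### The Gagliardo-Nirenberg-Sobolev inequality -/

/-- Fatou's lemma for almost everywhere convergent sequences with bounded integrals. -/
theorem lintegral_le_of_ae_tendsto {α : Type*} {m : MeasurableSpace α} {μ : Measure α}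
    {f : ℕ → α → ℝ≥0∞} {g : α → ℝ≥0∞} {C : ℝ≥0∞} (hf : ∀ n, AEMeasurable (f n) μ)
    (h : ∀ᵐ x ∂μ, Tendsto (fun n => f n x) atTop (𝓝 (g x))) (hC : ∀ n, ∫⁻ x, f n x ∂μ ≤ C) :
    ∫⁻ x, g x ∂μ ≤ C := by
  calc ∫⁻ x, g x ∂μ = ∫⁻ x, liminf (fun n => f n x) atTop ∂μ :=
        lintegral_congr_ae (h.mono fun x hx => hx.liminf_eq.symm)
    _ ≤ liminf (fun n => ∫⁻ x, f n x ∂μ) atTop := lintegral_liminf_le' hf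
    _ ≤ C := by
        refine (liminf_le_liminf (v := fun _ => C) (Eventually.of_forall hC)).trans ?_
        simp

/-- The element `|u|` of `L²`. -/
noncomputable def absL2 (u : L2Plane) : L2Plane := lipschitzWith_one_norm.compLp norm_zero u

theorem coeFn_absL2 (u : L2Plane) : absL2 u =ᵐ[volume] fun z => |u z| :=
  lipschitzWith_one_norm.coeFn_compLp norm_zero u

theorem continuous_absL2 : Continuous absL2 := lipschitzWith_one_norm.continuous_compLp norm_zero

theorem norm_absL2 (u : L2Plane) : ‖absL2 u‖ = ‖u‖ := by
  refine le_antisymm (Lp.norm_le_norm_of_ae_le ?_) (Lp.norm_le_norm_of_ae_le ?_) <;>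
  · filter_upwards [coeFn_absL2 u] with z hz
    simp [hz]

/-- The Sobolev inequality in `W^{1,1}(ℝ²)` for compositions of test functions. -/
theorem eLpNorm_comp_le_of_isTestFunction {φ : ℝ × ℝ → ℝ} (h : IsTestFunction φ) {Φ ψ : ℝ → ℝ}
    {K : ℝ≥0} (hψ : LipschitzWith K ψ) (hψ0 : ψ 0 = 0) (hψ1 : ∀ s, 0 ≤ ψ s)
    (hΦ : ∀ s, HasDerivAt Φ (ψ s) s) (hΦ0 : Φ 0 = 0) :
    eLpNorm (fun z => Φ (φ z)) 2 ≤ eLpNormLESNormFDerivOneConst (volume : Measure (ℝ × ℝ)) 2 *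
      ENNReal.ofReal (inner ℝ (hψ.compLp hψ0 (testL2 h))
        (absL2 (testL2 h.partialX) + absL2 (testL2 h.partialY))) := by
  have cΦ : ContDiff ℝ 1 Φ := by
    rw [contDiff_one_iff_deriv]
    refine ⟨fun s => (hΦ s).differentiableAt, ?_⟩
    rw [show deriv Φ = ψ from funext fun s => (hΦ s).deriv]
    exact hψ.continuous
  have dφ : Differentiable ℝ φ := h.1.differentiable (by simp)
  have hS := eLpNorm_le_eLpNorm_fderiv_one (μ := (volume : Measure (ℝ × ℝ)))
    (u := fun z => Φ (φ z)) (p := 2) (cΦ.comp (h.1.of_le (by simp)))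
    (h.2.comp_left hΦ0) (by
      simp only [Module.finrank_prod, Module.finrank_self]
      rw [NNReal.holderConjugate_iff]
      norm_num [← two_mul])
  refine hS.trans ?_
  refine mul_le_mul_right ?_ _
  have e : inner ℝ (hψ.compLp hψ0 (testL2 h))
        (absL2 (testL2 h.partialX) + absL2 (testL2 h.partialY)) =
      ∫ z, ψ (φ z) * (|partialX φ z| + |partialY φ z|) := by
    rw [l2_inner_eq]
    refine integral_congr_ae ?_
    filter_upwards [hψ.coeFn_compLp hψ0 (testL2 h), coeFn_testL2 h, coeFn_testL2 h.partialX,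
      coeFn_testL2 h.partialY, coeFn_absL2 (testL2 h.partialX), coeFn_absL2 (testL2 h.partialY),
      Lp.coeFn_add (absL2 (testL2 h.partialX)) (absL2 (testL2 h.partialY))]
      with z h1 h2 h3 h4 h5 h6 h7
    rw [h1, h7, Pi.add_apply, h5, h6, h3, h4, Function.comp_apply, h2]
  have hcont : Continuous (fun z => ψ (φ z) * (|partialX φ z| + |partialY φ z|)) :=
    (hψ.continuous.comp h.continuous).mul
      (h.partialX.continuous.abs.add h.partialY.continuous.abs)
  have hint : Integrable (fun z => ψ (φ z) * (|partialX φ z| + |partialY φ z|)) := by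
    refine hcont.integrable_of_hasCompactSupport ?_
    exact (h.2.comp_left (g := ψ) hψ0).mul_right
  rw [e, ofReal_integral_eq_lintegral_ofReal hint
    (ae_of_all _ fun z => mul_nonneg (hψ1 _) (by positivity)), eLpNorm_one_eq_lintegral_enorm]
  refine lintegral_mono fun z => ?_
  rw [← ofReal_norm]
  refine ENNReal.ofReal_le_ofReal ?_
  have hd := ((hΦ (φ z)).comp_hasFDerivAt z (dφ z).hasFDerivAt).fderiv
  simp only [Function.comp_def] at hd
  rw [hd, norm_smul, Real.norm_of_nonneg (hψ1 _)]
  refine mul_le_mul_of_nonneg_left ?_ (hψ1 _)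
  refine ContinuousLinearMap.opNorm_le_bound _ (by positivity) fun w => ?_
  have hw : fderiv ℝ φ z w = w.1 * partialX φ z + w.2 * partialY φ z := by
    have : w = w.1 • ((1 : ℝ), (0 : ℝ)) + w.2 • ((0 : ℝ), (1 : ℝ)) := by ext <;> simp
    conv_lhs => rw [this]
    rw [map_add, map_smul, map_smul]
    rfl
  rw [hw]
  have n1 : ‖w.1‖ ≤ ‖w‖ := norm_fst_le w
  have n2 : ‖w.2‖ ≤ ‖w‖ := norm_snd_le w
  calc ‖w.1 * partialX φ z + w.2 * partialY φ z‖
      ≤ ‖w.1‖ * |partialX φ z| + ‖w.2‖ * |partialY φ z| := by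
        refine (norm_add_le _ _).trans ?_
        rw [norm_mul, norm_mul]; rfl
    _ ≤ ‖w‖ * |partialX φ z| + ‖w‖ * |partialY φ z| := by gcongr
    _ = _ := by ring

/-- The Sobolev inequality in `W^{1,1}(ℝ²)` for compositions of `H¹` functions. -/
theorem eLpNorm_comp_le_of_hasWeakGradient {u g₁ g₂ : L2Plane} (hu : HasWeakGradient u g₁ g₂)
    {Φ ψ : ℝ → ℝ} {K : ℝ≥0} (hψ : LipschitzWith K ψ) (hψ0 : ψ 0 = 0) (hψ1 : ∀ s, 0 ≤ ψ s)
    (hΦ : ∀ s, HasDerivAt Φ (ψ s) s) (hΦ0 : Φ 0 = 0) :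
    eLpNorm (fun z => Φ (u z)) 2 ≤ eLpNormLESNormFDerivOneConst (volume : Measure (ℝ × ℝ)) 2 *
      ENNReal.ofReal (inner ℝ (hψ.compLp hψ0 u) (absL2 g₁ + absL2 g₂)) := by
  obtain ⟨φ, h, h0, h1, h2⟩ := hu.exists_testL2_seq
  obtain ⟨ns, hns, hae⟩ := exists_subseq_ae_tendsto h0
  have a0 : Tendsto (fun n => hψ.compLp hψ0 (testL2 (h (ns n)))) atTop (𝓝 (hψ.compLp hψ0 u)) := by
    have := (hψ.continuous_compLp (p := 2) (μ := (volume : Measure (ℝ × ℝ))) hψ0).tendsto u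
    exact this.comp (h0.comp hns.tendsto_atTop)
  have a1 : Tendsto (fun n => absL2 (testL2 (h (ns n)).partialX)) atTop (𝓝 (absL2 g₁)) :=
    (continuous_absL2.tendsto g₁).comp (h1.comp hns.tendsto_atTop)
  have a2 : Tendsto (fun n => absL2 (testL2 (h (ns n)).partialY)) atTop (𝓝 (absL2 g₂)) :=
    (continuous_absL2.tendsto g₂).comp (h2.comp hns.tendsto_atTop)
  have lim := a0.inner (𝕜 := ℝ) (a1.add a2)
  have lim' := ENNReal.Tendsto.const_mul
    (a := (eLpNormLESNormFDerivOneConst (volume : Measure (ℝ × ℝ)) 2 : ℝ≥0∞))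
    ((ENNReal.continuous_ofReal.tendsto _).comp lim) (Or.inr (by simp))
  have cΦ : Continuous Φ := continuous_iff_continuousAt.2 fun s => (hΦ s).continuousAt
  have hF := Lp.eLpNorm_lim_le_liminf_eLpNorm (p := 2) (μ := (volume : Measure (ℝ × ℝ)))
    (f := fun n z => Φ (testL2 (h (ns n)) z))
    (fun n => cΦ.comp_aestronglyMeasurable (Lp.aestronglyMeasurable _)) (fun z => Φ (u z))
    (hae.mono fun z hz => (cΦ.tendsto _).comp hz)
  refine hF.trans ((liminf_le_liminf (Eventually.of_forall fun n => ?_)).trans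
    lim'.liminf_eq.le)
  refine le_trans (le_of_eq (eLpNorm_congr_ae ?_))
    (eLpNorm_comp_le_of_isTestFunction (h (ns n)) hψ hψ0 hψ1 hΦ hΦ0)
  filter_upwards [coeFn_testL2 (h (ns n))] with z hz
  rw [hz]

/-- A Lipschitz approximation of the derivative of `s ↦ s₊ ^ (1 + θ)`. -/
noncomputable def powDerivReg (θ η s : ℝ) : ℝ := (1 + θ) * ((max s 0 + η) ^ θ - η ^ θ)

theorem powDerivReg_zero (θ η : ℝ) : powDerivReg θ η 0 = 0 := by simp [powDerivReg]

theorem powDerivReg_nonneg {θ η : ℝ} (hθ : 0 < θ) (hη : 0 < η) (s : ℝ) : 0 ≤ powDerivReg θ η s := by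
  have : η ^ θ ≤ (max s 0 + η) ^ θ :=
    Real.rpow_le_rpow hη.le (by linarith [le_max_right s 0]) hθ.le
  unfold powDerivReg
  have h1 : 0 ≤ (max s 0 + η) ^ θ - η ^ θ := by linarith
  positivity

theorem powDerivReg_le {θ η s : ℝ} (hθ : 0 < θ) (hθ1 : θ ≤ 1) (hη : 0 < η) (hs : 0 ≤ s) :
    powDerivReg θ η s ≤ (1 + θ) * s ^ θ := by
  unfold powDerivReg
  rw [max_eq_left hs]
  have := Real.rpow_add_le_add_rpow hs hη.le hθ.le hθ1
  gcongr
  linarith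

theorem exists_lipschitzWith_powDerivReg {θ η : ℝ} (hθ : 0 < θ) (hθ1 : θ ≤ 1) (hη : 0 < η) :
    ∃ K, LipschitzWith K (powDerivReg θ η) := by
  have h1 : LipschitzOnWith (θ * η ^ (θ - 1)).toNNReal (fun x : ℝ => x ^ θ) (Ici η) := by
    refine Convex.lipschitzOnWith_of_nnnorm_hasDerivWithin_le (convex_Ici η)
      (f' := fun x => θ * x ^ (θ - 1)) (fun x hx => ?_) (fun x hx => ?_)
    · exact (Real.hasDerivAt_rpow_const (Or.inl (hη.trans_le hx).ne')).hasDerivWithinAt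
    · have hx0 : 0 < x := hη.trans_le hx
      have h0 : 0 ≤ θ * x ^ (θ - 1) := by positivity
      rw [← NNReal.coe_le_coe, coe_nnnorm, Real.norm_of_nonneg h0,
        Real.coe_toNNReal _ (by positivity)]
      exact mul_le_mul_of_nonneg_left
        (Real.rpow_le_rpow_of_nonpos hη hx (by linarith)) hθ.le
  have h2 : LipschitzWith 1 (fun s : ℝ => max s 0 + η) := by
    refine LipschitzWith.of_dist_le_mul fun x y => ?_
    have := abs_max_sub_max_le_abs x y 0
    simpa [Real.dist_eq] using this
  have h3 := h1.comp (lipschitzOnWith_univ.2 h2)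
    (fun s _ => show η ≤ max s 0 + η by linarith [le_max_right s 0])
  rw [lipschitzOnWith_univ] at h3
  refine ⟨(1 + θ).toNNReal * ((θ * η ^ (θ - 1)).toNNReal * 1), ?_⟩
  refine LipschitzWith.of_dist_le_mul fun x y => ?_
  have h4 := h3.dist_le_mul x y
  rw [Real.dist_eq] at h4 ⊢
  have e : powDerivReg θ η x - powDerivReg θ η y =
      (1 + θ) * ((max x 0 + η) ^ θ - (max y 0 + η) ^ θ) := by
    unfold powDerivReg; ring
  rw [e, abs_mul, abs_of_pos (by linarith : 0 < 1 + θ), NNReal.coe_mul,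
    Real.coe_toNNReal _ (by linarith : 0 ≤ 1 + θ), mul_assoc]
  gcongr
  exact h4

theorem integral_powDerivReg {θ η s : ℝ} (hη : 0 < η) (hs : 0 ≤ s) :
    ∫ x in (0 : ℝ)..s, powDerivReg θ η x =
      (s + η) ^ (1 + θ) - η ^ (1 + θ) - (1 + θ) * η ^ θ * s := by
  have hd : ∀ x ∈ uIcc 0 s, HasDerivAt (fun x => (x + η) ^ (1 + θ) - (1 + θ) * η ^ θ * x)
      ((1 + θ) * ((x + η) ^ θ - η ^ θ)) x := by
    intro x hx
    rw [uIcc_of_le hs] at hx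
    have hx0 : x + η ≠ 0 := by linarith [hx.1]
    have h1 := ((hasDerivAt_id x).add_const η).rpow_const (p := 1 + θ) (Or.inl hx0)
    have h2 := (hasDerivAt_id x).const_mul ((1 + θ) * η ^ θ)
    refine (h1.sub h2).congr_deriv ?_
    simp only [id]
    rw [show 1 + θ - 1 = θ by ring]
    ring
  have e : ∫ x in (0 : ℝ)..s, powDerivReg θ η x =
      ∫ x in (0 : ℝ)..s, (1 + θ) * ((x + η) ^ θ - η ^ θ) := by
    refine intervalIntegral.integral_congr fun x hx => ?_
    rw [uIcc_of_le hs] at hx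
    simp only [powDerivReg, max_eq_left hx.1]
  rw [e, intervalIntegral.integral_eq_sub_of_hasDerivAt hd]
  · ring_nf
  · refine ContinuousOn.intervalIntegrable fun x hx => ?_
    rw [uIcc_of_le hs] at hx
    have hx0 : x + η ≠ 0 := by linarith [hx.1]
    have h1 : ContinuousAt (fun x : ℝ => (x + η) ^ θ) x :=
      (Real.continuousAt_rpow_const _ _ (Or.inl hx0)).comp
        (f := fun x : ℝ => x + η) (by fun_prop)
    exact (continuousAt_const.mul (h1.sub continuousAt_const)).continuousWithinAt

theorem lintegral_rpow_le_of_hasWeakGradient {u g₁ g₂ : L2Plane} (hu : HasWeakGradient u g₁ g₂)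
    {θ : ℝ} (hθ : 0 < θ) (hθ1 : θ ≤ 1) {ξ : ℝ × ℝ → ℝ} (hξ : Integrable ξ)
    (hu0 : ∀ᵐ z, 0 ≤ u z) (hξu : ∀ᵐ z, ξ z = u z ^ (2 * θ)) :
    ∫⁻ z, ENNReal.ofReal (u z ^ (2 * (1 + θ))) ≤
      ENNReal.ofReal ((eLpNormLESNormFDerivOneConst (volume : Measure (ℝ × ℝ)) 2) ^ 2 *
        (2 * (1 + θ) ^ 2) * (∫ z, ξ z) * (‖g₁‖ ^ 2 + ‖g₂‖ ^ 2)) := by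
  set S : ℝ≥0 := eLpNormLESNormFDerivOneConst (volume : Measure (ℝ × ℝ)) 2
  let η : ℕ → ℝ := fun n => 1 / ((n : ℝ) + 1)
  have hη : ∀ n, 0 < η n := fun n => by positivity
  have hη0 : Tendsto η atTop (𝓝 0) := tendsto_one_div_add_atTop_nhds_zero_nat
  let Φ : ℕ → ℝ → ℝ := fun n s => ∫ x in (0 : ℝ)..s, powDerivReg θ (η n) x
  choose K hK using fun n => exists_lipschitzWith_powDerivReg hθ hθ1 (hη n)
  have hΦ : ∀ n s, HasDerivAt (Φ n) (powDerivReg θ (η n) s) s := fun n s =>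
    intervalIntegral.integral_hasDerivAt_right ((hK n).continuous.intervalIntegrable _ _)
      ((hK n).continuous.stronglyMeasurableAtFilter _ _) (hK n).continuous.continuousAt
  have cΦ : ∀ n, Continuous (Φ n) :=
    fun n => continuous_iff_continuousAt.2 fun s => (hΦ n s).continuousAt
  have hΦ0 : ∀ n, Φ n 0 = 0 := fun n => by simp [Φ]
  have hξ0 : 0 ≤ ∫ z, ξ z := by
    refine integral_nonneg_of_ae ?_
    filter_upwards [hu0, hξu] with z h1 h2
    rw [h2]; positivity
  have bound : ∀ n, ∫⁻ z, ENNReal.ofReal (Φ n (u z) ^ 2) ≤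
      ENNReal.ofReal ((S : ℝ) ^ 2 *
        (2 * (1 + θ) ^ 2) * (∫ z, ξ z) * (‖g₁‖ ^ 2 + ‖g₂‖ ^ 2)) := by
    intro n
    have h1 := eLpNorm_comp_le_of_hasWeakGradient hu (hK n) (powDerivReg_zero _ _)
      (powDerivReg_nonneg hθ (hη n)) (hΦ n) (hΦ0 n)
    set a : L2Plane := (hK n).compLp (powDerivReg_zero _ _) u with ha
    have h2 : ‖a‖ ^ 2 ≤ (1 + θ) ^ 2 * ∫ z, ξ z := by
      rw [l2_norm_sq_eq, ← integral_const_mul]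
      refine integral_mono_ae (Lp.memLp a).integrable_sq (hξ.const_mul _) ?_
      filter_upwards [(hK n).coeFn_compLp (powDerivReg_zero _ _) u, hu0, hξu] with z h3 h4 h5
      rw [ha, h3, Function.comp_apply, h5]
      have h6 := powDerivReg_le hθ hθ1 (hη n) h4
      have h7 := powDerivReg_nonneg hθ (hη n) (u z)
      have h8 : u z ^ (2 * θ) = (u z ^ θ) ^ 2 := by
        rw [← Real.rpow_mul_natCast h4]
        push_cast; ring_nf
      rw [h8, ← mul_pow]
      exact pow_le_pow_left₀ h7 h6 2
    have h3 : inner ℝ a (absL2 g₁ + absL2 g₂) ≤ ‖a‖ * (‖g₁‖ + ‖g₂‖) := by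
      refine (real_inner_le_norm _ _).trans ?_
      gcongr
      exact (norm_add_le _ _).trans (by rw [norm_absL2, norm_absL2])
    have h4 : ∫⁻ z, ENNReal.ofReal (Φ n (u z) ^ 2) = eLpNorm (fun z => Φ n (u z)) 2 ^ 2 := by
      rw [eLpNorm_two_sq]
      refine lintegral_congr fun z => ?_
      rw [← ofReal_norm, ← ENNReal.ofReal_pow (norm_nonneg _), Real.norm_eq_abs, sq_abs]
    rw [h4]
    have h5 : eLpNorm (fun z => Φ n (u z)) 2 ≤ ENNReal.ofReal (S * (‖a‖ * (‖g₁‖ + ‖g₂‖))) := by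
      refine h1.trans ?_
      rw [ENNReal.ofReal_mul (by positivity), ENNReal.ofReal_coe_nnreal]
      gcongr
    refine (pow_le_pow_left₀ (by simp) h5 2).trans ?_
    rw [← ENNReal.ofReal_pow (by positivity)]
    refine ENNReal.ofReal_le_ofReal ?_
    calc (S * (‖a‖ * (‖g₁‖ + ‖g₂‖))) ^ 2 = (S : ℝ) ^ 2 * (‖a‖ ^ 2 * (‖g₁‖ + ‖g₂‖) ^ 2) := by ring
      _ ≤ (S : ℝ) ^ 2 * (((1 + θ) ^ 2 * ∫ z, ξ z) * (2 * (‖g₁‖ ^ 2 + ‖g₂‖ ^ 2))) := by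
          gcongr
          nlinarith [sq_nonneg (‖g₁‖ - ‖g₂‖)]
      _ = _ := by ring
  refine lintegral_le_of_ae_tendsto (f := fun n z => ENNReal.ofReal (Φ n (u z) ^ 2)) (fun n => ?_) ?_ bound
  · exact (((cΦ n).comp_aestronglyMeasurable (Lp.aestronglyMeasurable u)).pow 2).aemeasurable.ennreal_ofReal
  · filter_upwards [hu0] with z hz
    refine (ENNReal.continuous_ofReal.tendsto _).comp ?_
    have e : u z ^ (2 * (1 + θ)) =
        ((u z + 0) ^ (1 + θ) - 0 ^ (1 + θ) - (1 + θ) * 0 ^ θ * u z) ^ 2 := by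
      rw [Real.zero_rpow (by linarith), Real.zero_rpow hθ.ne']
      simp only [add_zero, mul_zero, zero_mul, sub_zero]
      rw [← Real.rpow_mul_natCast hz]
      push_cast; ring_nf
    rw [e]
    refine Tendsto.pow ?_ 2
    have hr : ∀ q : ℝ, 0 ≤ q → Tendsto (fun x : ℝ => x ^ q) (𝓝 0) (𝓝 (0 ^ q)) := fun q hq =>
      (Real.continuous_rpow_const hq).tendsto 0
    have t1 : Tendsto (fun n => (u z + η n) ^ (1 + θ)) atTop (𝓝 ((u z + 0) ^ (1 + θ))) :=
      ((Real.continuous_rpow_const (by linarith)).tendsto _).comp (tendsto_const_nhds.add hη0)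
    have t2 := (hr (1 + θ) (by linarith)).comp hη0
    have t3 := (((hr θ hθ.le).comp hη0).const_mul (1 + θ)).mul_const (u z)
    refine ((t1.sub t2).sub t3).congr fun n => ?_
    simp only [Φ, integral_powDerivReg (hη n) hz, Function.comp]

theorem HasWeakGradient.toLp {u g₁ g₂ : ℝ × ℝ → ℝ} (h : HasWeakGradient u g₁ g₂)
    (hu : MemLp u 2) (h₁ : MemLp g₁ 2) (h₂ : MemLp g₂ 2) :
    HasWeakGradient (hu.toLp u) (h₁.toLp g₁) (h₂.toLp g₂) :=
  h.congr_ae hu.coeFn_toLp.symm h₁.coeFn_toLp.symm h₂.coeFn_toLp.symm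

/-- For every `p ≥ 1` the Gagliardo-Nirenberg-Sobolev inequality holds with some constant. -/
theorem exists_isGNSConstant {p : ℝ} (hp : 1 ≤ p) : ∃ C, IsGNSConstant p C := by
  have hp0 : 0 < p := by linarith
  set S : ℝ≥0 := eLpNormLESNormFDerivOneConst (volume : Measure (ℝ × ℝ)) 2 with hS
  refine ⟨(S : ℝ) ^ 2 * (2 * (1 + 1 / p) ^ 2), by positivity, ?_⟩
  intro ξ g₁ g₂ hξ0 hξ hm hw h₁ h₂
  have hθ : 0 < 1 / p := by positivity
  have hθ1 : 1 / p ≤ 1 := by rw [div_le_one hp0]; exact hp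
  have key := lintegral_rpow_le_of_hasWeakGradient (hw.toLp hm h₁ h₂) hθ hθ1 hξ
    (by filter_upwards [hm.coeFn_toLp] with z hz
        rw [hz]; exact Real.rpow_nonneg (hξ0 z) _)
    (by filter_upwards [hm.coeFn_toLp] with z hz
        rw [hz, ← Real.rpow_mul (hξ0 z)]
        rw [show p / 2 * (2 * (1 / p)) = 1 by field_simp, Real.rpow_one])
  rw [toLp_norm_sq_eq, toLp_norm_sq_eq, ← integral_add h₁.integrable_sq h₂.integrable_sq] at key
  refine le_trans (le_of_eq (lintegral_congr_ae ?_)) key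
  filter_upwards [hm.coeFn_toLp] with z hz
  rw [hz, ← Real.rpow_mul (hξ0 z)]
  rw [show p / 2 * (2 * (1 + 1 / p)) = p + 1 by field_simp]

/-- The infimum defining the best constant is attained. -/
theorem isGNSConstant_gnsConst {p : ℝ} (hp : 1 ≤ p) : IsGNSConstant p (gnsConst p) := by
  have hb : BddBelow {C : ℝ | IsGNSConstant p C} := ⟨0, fun C hC => hC.1⟩
  obtain ⟨c, -, hc, hcm⟩ := exists_seq_tendsto_sInf (S := {C : ℝ | IsGNSConstant p C})
    (exists_isGNSConstant hp) hb
  refine ⟨ge_of_tendsto' hc fun n => (hcm n).1, ?_⟩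
  intro ξ g₁ g₂ hξ0 hξ hm hw h₁ h₂
  have h := ((hc.mul_const (∫ z, ξ z)).mul_const (∫ z, (g₁ z ^ 2 + g₂ z ^ 2)))
  exact ge_of_tendsto' ((ENNReal.continuous_ofReal.tendsto _).comp h)
    fun n => (hcm n).2 ξ g₁ g₂ hξ0 hξ hm hw h₁ h₂

theorem gnsConst_nonneg {p : ℝ} (hp : 1 ≤ p) : 0 ≤ gnsConst p := (isGNSConstant_gnsConst hp).1

/-- The Gagliardo-Nirenberg-Sobolev inequality with the best constant, for elements of `L²`. -/
theorem lintegral_le_gnsConst {p : ℝ} (hp : 1 ≤ p) {ξ : ℝ × ℝ → ℝ} {u g₁ g₂ : L2Plane}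
    (hξ0 : ∀ᵐ z, 0 ≤ ξ z) (hξ : Integrable ξ) (hu : HasWeakGradient u g₁ g₂)
    (huξ : ∀ᵐ z, u z = ξ z ^ (p / 2)) :
    ∫⁻ z, ENNReal.ofReal (ξ z ^ (p + 1)) ≤
      ENNReal.ofReal (gnsConst p * (∫ z, ξ z) * (‖g₁‖ ^ 2 + ‖g₂‖ ^ 2)) := by
  have e : (fun z => max (ξ z) 0) =ᵐ[volume] ξ := hξ0.mono fun z hz => max_eq_left hz
  have eu : (u : ℝ × ℝ → ℝ) =ᵐ[volume] fun z => max (ξ z) 0 ^ (p / 2) := by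
    filter_upwards [e, huξ] with z h1 h2
    rw [h1, h2]
  have key := (isGNSConstant_gnsConst hp).2 (fun z => max (ξ z) 0) g₁ g₂
    (fun z => le_max_right _ _) (hξ.congr e.symm) ((memLp_congr_ae eu).1 (Lp.memLp u))
    (hu.congr_ae eu (ae_eq_refl _) (ae_eq_refl _)) (Lp.memLp g₁) (Lp.memLp g₂)
  rw [integral_add (Lp.memLp g₁).integrable_sq (Lp.memLp g₂).integrable_sq, ← l2_norm_sq_eq,
    ← l2_norm_sq_eq, integral_congr_ae e] at key
  refine le_trans (le_of_eq (lintegral_congr_ae ?_)) key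
  filter_upwards [e] with z h1
  rw [h1]

/-! ### Passing from increments to an integrated inequality in time -/

section Steklov

variable {X : Type*} [NormedAddCommGroup X] [InnerProductSpace ℝ X]

theorem abs_integral_inner_le {α : Type*} {m : MeasurableSpace α} {μ : Measure α} {f g : α → X}
    (hf : MemLp f 2 μ) (hg : MemLp g 2 μ) :
    |∫ x, inner ℝ (f x) (g x) ∂μ| ≤ (eLpNorm f 2 μ).toReal * (eLpNorm g 2 μ).toReal := by
  have h := abs_real_inner_le_norm (hf.toLp f) (hg.toLp g)
  rw [L2.inner_def, Lp.norm_toLp, Lp.norm_toLp] at h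
  refine le_trans (le_of_eq (congrArg _ (integral_congr_ae ?_))) h
  filter_upwards [hf.coeFn_toLp, hg.coeFn_toLp] with x h1 h2
  rw [h1, h2]

theorem integrable_inner_of_memLp {α : Type*} {m : MeasurableSpace α} {μ : Measure α} {f g : α → X}
    (hf : MemLp f 2 μ) (hg : MemLp g 2 μ) : Integrable (fun x => inner ℝ (f x) (g x)) μ := by
  have h := L2.integrable_inner (𝕜 := ℝ) (hf.toLp f) (hg.toLp g)
  refine h.congr ?_
  filter_upwards [hf.coeFn_toLp, hg.coeFn_toLp] with x h1 h2
  rw [h1, h2]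

theorem integrable_inner_translate {V W : ℝ → X} (hVm : StronglyMeasurable V)
    (hWm : StronglyMeasurable W) (hV : MemLp V 2) (hW : MemLp W 2) (h : ℝ) :
    Integrable (fun p : ℝ × ℝ => inner ℝ (V (p.2 - p.1)) (W p.2))
      ((volume.restrict (Ioc 0 h)).prod volume) := by
  have hm : StronglyMeasurable (fun p : ℝ × ℝ => inner ℝ (V (p.2 - p.1)) (W p.2)) :=
    (hVm.comp_measurable (measurable_snd.sub measurable_fst)).inner
      (hWm.comp_measurable measurable_snd)
  have hVt : ∀ θ : ℝ, MemLp (fun x => V (x - θ)) 2 := fun θ =>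
    hV.comp_measurePreserving (measurePreserving_sub_right volume θ)
  refine (integrable_prod_iff hm.aestronglyMeasurable).2 ⟨ae_of_all _ fun θ => ?_, ?_⟩
  · exact integrable_inner_of_memLp (hVt θ) hW
  · refine Integrable.of_bound (C := (∫ x, ‖V x‖ ^ 2) + ∫ x, ‖W x‖ ^ 2)
      (hm.norm.integral_prod_right').aestronglyMeasurable (ae_of_all _ fun θ => ?_)
    have hV2 : Integrable (fun x => ‖V x‖ ^ 2) := hV.integrable_norm_pow (by norm_num)
    have hW2 : Integrable (fun x => ‖W x‖ ^ 2) := hW.integrable_norm_pow (by norm_num)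
    have hVθ : Integrable (fun x => ‖V (x - θ)‖ ^ 2) :=
      (hVt θ).integrable_norm_pow (by norm_num)
    rw [Real.norm_of_nonneg (integral_nonneg fun _ => norm_nonneg _)]
    have e : ∫ x, ‖V x‖ ^ 2 = ∫ x, ‖V (x - θ)‖ ^ 2 :=
      (integral_sub_right_eq_self (fun x => ‖V x‖ ^ 2) θ).symm
    rw [e, ← integral_add hVθ hW2]
    refine integral_mono (integrable_inner_of_memLp (hVt θ) hW).norm (hVθ.add hW2) fun x => ?_
    refine (norm_inner_le_norm _ _).trans ?_
    nlinarith [sq_nonneg (‖V (x - θ)‖ - ‖W x‖), sq_nonneg (‖V (x - θ)‖), sq_nonneg (‖W x‖)]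

/-- The integral of `⟪∫ V, W⟫` over windows of length `h` is an average of translated pairings. -/
theorem steklov_fubini {V W : ℝ → X} (hVm : StronglyMeasurable V)
    (hWm : StronglyMeasurable W) (hV : MemLp V 2) (hW : MemLp W 2) {h : ℝ} (h0 : 0 < h)
    (S : Set ℝ) :
    Integrable (fun σ => ∫ q in (σ - h)..σ, inner ℝ (V q) (W σ)) (volume.restrict S) ∧
    ∫ σ in S, ∫ q in (σ - h)..σ, inner ℝ (V q) (W σ) =
      ∫ θ in (0 : ℝ)..h, ∫ σ in S, inner ℝ (V (σ - θ)) (W σ) := by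
  have hi := integrable_inner_translate hVm hWm hV hW h
  have hi' : Integrable (fun p : ℝ × ℝ => inner ℝ (V (p.2 - p.1)) (W p.2))
      ((volume.restrict (Ioc 0 h)).prod (volume.restrict S)) := by
    refine hi.mono_measure ?_
    exact Measure.prod_mono le_rfl Measure.restrict_le_self
  have e : ∀ σ, ∫ q in (σ - h)..σ, inner ℝ (V q) (W σ) =
      ∫ θ in Ioc 0 h, inner ℝ (V (σ - θ)) (W σ) := by
    intro σ
    rw [← intervalIntegral.integral_of_le h0.le]
    have := intervalIntegral.integral_comp_sub_left (a := 0) (b := h)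
      (fun q => inner ℝ (V q) (W σ)) σ
    rw [this, sub_zero]
  simp only [e]
  refine ⟨hi'.integral_prod_right, ?_⟩
  rw [intervalIntegral.integral_of_le h0.le]
  exact (integral_integral_swap hi').symm

/-- Averages of translates converge when paired with a fixed function. -/
theorem tendsto_steklov {V W : ℝ → X} (hVm : StronglyMeasurable V)
    (hWm : StronglyMeasurable W) (hV : MemLp V 2) (hW : MemLp W 2) (a b : ℝ) :
    Tendsto (fun h => h⁻¹ * ∫ σ in Ioc (a + h) b, ∫ q in (σ - h)..σ, inner ℝ (V q) (W σ))
      (𝓝[>] 0) (𝓝 (∫ σ in Ioc a b, inner ℝ (V σ) (W σ))) := by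
  have hVW := integrable_inner_of_memLp hV hW
  have hI : Tendsto (fun h => ∫ σ in Ioc (a + h) b, inner ℝ (V σ) (W σ)) (𝓝[>] 0)
      (𝓝 (∫ σ in Ioc a b, inner ℝ (V σ) (W σ))) := by
    have h1 : ∀ c, ∫ σ in Ioc c b, inner ℝ (V σ) (W σ) =
        ∫ σ, (Ioc c b).indicator (fun σ => inner ℝ (V σ) (W σ)) σ :=
      fun c => (integral_indicator measurableSet_Ioc).symm
    simp only [h1]
    refine tendsto_integral_filter_of_dominated_convergence (fun σ => ‖inner ℝ (V σ) (W σ)‖)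
      ?_ ?_ hVW.norm ?_
    · exact Eventually.of_forall fun h =>
        hVW.aestronglyMeasurable.indicator measurableSet_Ioc
    · exact Eventually.of_forall fun h => ae_of_all _ fun σ => norm_indicator_le_norm_self _ _
    · refine ae_of_all _ fun σ => ?_
      refine tendsto_const_nhds.congr' ?_
      by_cases hσ : a < σ
      · have : ∀ᶠ h in 𝓝[>] (0 : ℝ), h < σ - a :=
          nhdsWithin_le_nhds (gt_mem_nhds (by linarith))
        filter_upwards [this] with h hh
        by_cases hb : σ ≤ b
        · rw [indicator_of_mem (show σ ∈ Ioc a b from ⟨hσ, hb⟩),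
            indicator_of_mem (show σ ∈ Ioc (a + h) b from ⟨by linarith, hb⟩)]
        · rw [indicator_of_notMem (fun hc => hb hc.2), indicator_of_notMem (fun hc => hb hc.2)]
      · filter_upwards [self_mem_nhdsWithin] with h hh
        have hh' : 0 < h := hh
        rw [indicator_of_notMem (fun hc => hσ hc.1), indicator_of_notMem (fun hc => hσ ?_)]
        linarith [hc.1]
  have hD : Tendsto (fun h => h⁻¹ * (∫ σ in Ioc (a + h) b, ∫ q in (σ - h)..σ, inner ℝ (V q) (W σ)) -
      ∫ σ in Ioc (a + h) b, inner ℝ (V σ) (W σ)) (𝓝[>] 0) (𝓝 0) := by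
    rw [Metric.tendsto_nhdsWithin_nhds]
    intro ε hε
    set w : ℝ := (eLpNorm W 2).toReal with hw
    have hw0 : 0 ≤ w := ENNReal.toReal_nonneg
    have ht := tendsto_eLpNorm_translate_sub hV
    have hp : 0 < ENNReal.ofReal (ε / (2 * (w + 1))) := ENNReal.ofReal_pos.2 (by positivity)
    obtain ⟨δ, hδ, hb⟩ := Metric.eventually_nhds_iff.1
      (ht.eventually (ge_mem_nhds hp))
    refine ⟨δ, hδ, fun {h} h0 hh => ?_⟩
    have h0 : 0 < h := h0
    rw [Real.dist_eq, sub_zero, abs_of_pos h0] at hh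
    rw [Real.dist_eq, sub_zero]
    set S := Ioc (a + h) b
    have hVt : ∀ θ : ℝ, MemLp (fun x => V (x - θ)) 2 := fun θ =>
      hV.comp_measurePreserving (measurePreserving_sub_right volume θ)
    have hi' : Integrable (fun p : ℝ × ℝ => inner ℝ (V (p.2 - p.1)) (W p.2))
        ((volume.restrict (Ioc 0 h)).prod (volume.restrict S)) :=
      (integrable_inner_translate hVm hWm hV hW h).mono_measure
        (Measure.prod_mono le_rfl Measure.restrict_le_self)
    rw [(steklov_fubini hVm hWm hV hW h0 S).2]
    have hJ : IntervalIntegrable (fun θ => ∫ σ in S, inner ℝ (V (σ - θ)) (W σ)) volume 0 h := by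
      rw [intervalIntegrable_iff_integrableOn_Ioc_of_le h0.le]
      exact hi'.integral_prod_left
    have e : h⁻¹ * (∫ θ in (0 : ℝ)..h, ∫ σ in S, inner ℝ (V (σ - θ)) (W σ)) -
        ∫ σ in S, inner ℝ (V σ) (W σ) =
        h⁻¹ * ∫ θ in (0 : ℝ)..h, ((∫ σ in S, inner ℝ (V (σ - θ)) (W σ)) -
          ∫ σ in S, inner ℝ (V σ) (W σ)) := by
      rw [intervalIntegral.integral_sub hJ intervalIntegrable_const,
        intervalIntegral.integral_const, mul_sub]
      simp [h0.ne']
    rw [e]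
    have hbd : ‖∫ θ in (0 : ℝ)..h, ((∫ σ in S, inner ℝ (V (σ - θ)) (W σ)) -
          ∫ σ in S, inner ℝ (V σ) (W σ))‖ ≤ ε / (2 * (w + 1)) * w * |h - 0| := by
      refine intervalIntegral.norm_integral_le_of_norm_le_const fun θ hθ => ?_
      rw [uIoc_of_le h0.le] at hθ
      rw [← integral_sub ((integrable_inner_of_memLp (hVt θ) hW).integrableOn) hVW.integrableOn]
      have e2 : ∀ σ, inner ℝ (V (σ - θ)) (W σ) - inner ℝ (V σ) (W σ) =
          inner ℝ (V (σ - θ) - V σ) (W σ) := fun σ => (inner_sub_left _ _ _).symm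
      simp only [e2]
      have hdm : MemLp (fun σ => V (σ - θ) - V σ) 2 := (hVt θ).sub hV
      refine (abs_integral_inner_le (hdm.restrict S) (hW.restrict S)).trans ?_
      have b1 : (eLpNorm (fun σ => V (σ - θ) - V σ) 2 (volume.restrict S)).toReal ≤
          ε / (2 * (w + 1)) := by
        refine ENNReal.toReal_le_of_le_ofReal (by positivity) ?_
        refine (eLpNorm_mono_measure _ Measure.restrict_le_self).trans (hb ?_)
        rw [Real.dist_eq, sub_zero, abs_of_pos hθ.1]
        exact hθ.2.trans_lt hh
      have b2 : (eLpNorm W 2 (volume.restrict S)).toReal ≤ w :=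
        ENNReal.toReal_mono hW.2.ne (eLpNorm_mono_measure _ Measure.restrict_le_self)
      gcongr
    rw [abs_mul, abs_of_pos (inv_pos.2 h0)]
    rw [Real.norm_eq_abs, sub_zero, abs_of_pos h0] at hbd
    calc h⁻¹ * _ ≤ h⁻¹ * (ε / (2 * (w + 1)) * w * h) := by gcongr
      _ = ε / 2 * (w / (w + 1)) := by field_simp
      _ ≤ ε / 2 * 1 := by
          gcongr
          rw [div_le_one (by linarith)]; linarith
      _ < ε := by linarith
  have := hD.add hI
  simpa using this

/-- The averaged increments of a continuous function recover its total increment: by telescoping,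
they are differences of averages near the two end points. -/
theorem tendsto_average_increment {E : ℝ → ℝ} {a b : ℝ} (hab : a < b)
    (hE : ContinuousOn E (Icc a b)) :
    Tendsto (fun h => h⁻¹ * ∫ σ in Ioc (a + h) b, (E σ - E (σ - h))) (𝓝[>] 0)
      (𝓝 (E b - E a)) := by
  -- Replace `E` by a continuous function on the line.
  set F : ℝ → ℝ := IccExtend hab.le ((Icc a b).domRestrict E) with hF
  have cF : Continuous F := (continuousOn_iff_continuous_domRestrict.1 hE).Icc_extend'
  have FE : ∀ x ∈ Icc a b, F x = E x := fun x hx => by rw [hF, IccExtend_of_mem _ _ hx]; rfl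
  have ii : ∀ x y, IntervalIntegrable F volume x y := fun x y => cF.intervalIntegrable x y
  have dF : ∀ x, HasDerivAt (fun y => ∫ t in a..y, F t) (F x) x := fun x =>
    intervalIntegral.integral_hasDerivAt_right (ii _ _) (cF.stronglyMeasurableAtFilter _ _)
      cF.continuousAt
  have l1 : Tendsto (fun h => h⁻¹ * ((∫ t in a..(a + h), F t) - ∫ t in a..a, F t)) (𝓝[>] 0)
      (𝓝 (F a)) := by
    have := (dF a).tendsto_slope_zero_right
    simpa using this
  have l2 : Tendsto (fun h => h⁻¹ * ((∫ t in a..b, F t) - ∫ t in a..(b - h), F t)) (𝓝[>] 0)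
      (𝓝 (F b)) := by
    have h1 := (dF b).tendsto_slope_zero_left
    have h2 : Tendsto (fun h : ℝ => -h) (𝓝[>] 0) (𝓝[<] 0) := by
      have := tendsto_neg_nhdsGT (a := (0 : ℝ))
      simpa using this
    refine (h1.comp h2).congr fun h => ?_
    simp only [Function.comp, smul_eq_mul, inv_neg, ← sub_eq_add_neg]
    ring
  have l3 := l2.sub l1
  rw [FE b (right_mem_Icc.2 hab.le), FE a (left_mem_Icc.2 hab.le)] at l3
  refine l3.congr' ?_
  have : ∀ᶠ h in 𝓝[>] (0 : ℝ), h < b - a := nhdsWithin_le_nhds (gt_mem_nhds (by linarith))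
  filter_upwards [this, self_mem_nhdsWithin] with h hh h0
  have h0 : 0 < h := h0
  have e1 : ∫ σ in Ioc (a + h) b, (E σ - E (σ - h)) = ∫ σ in Ioc (a + h) b, (F σ - F (σ - h)) := by
    refine setIntegral_congr_fun measurableSet_Ioc fun σ hσ => ?_
    rw [FE σ ⟨by linarith [hσ.1], hσ.2⟩, FE (σ - h) ⟨by linarith [hσ.1], by linarith [hσ.2]⟩]
  have ii' : ∀ x y, IntervalIntegrable (fun σ => F (σ - h)) volume x y := fun x y =>
    Continuous.intervalIntegrable (by fun_prop) x y
  rw [e1, ← intervalIntegral.integral_of_le (by linarith),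
    intervalIntegral.integral_sub (ii _ _)
      (ii' _ _),
    intervalIntegral.integral_comp_sub_right]
  have i1 := intervalIntegral.integral_add_adjacent_intervals (ii a (a + h)) (ii (a + h) b)
  have i2 := intervalIntegral.integral_add_adjacent_intervals (ii a (a + h)) (ii (a + h) (b - h))
  simp only [intervalIntegral.integral_same, sub_zero, add_sub_cancel_right]
  rw [← i1]
  ring

/-- If the increments of `E` over `[r, s]` are controlled by the integral of `⟨V, W s⟩`, with the
second argument frozen at the right endpoint, then the increment of `E` over `[a, b]` is at most the
integral of `⟨V, W⟩`. This replaces the chain rule in time. -/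
theorem increment_le_integral_inner {V₁ V₂ W₁ W₂ : ℝ → X} {E : ℝ → ℝ} {a b : ℝ} (hab : a < b)
    (hV₁ : MemLp V₁ 2 (volume.restrict (Ioc a b))) (hV₂ : MemLp V₂ 2 (volume.restrict (Ioc a b)))
    (hW₁ : MemLp W₁ 2 (volume.restrict (Ioc a b))) (hW₂ : MemLp W₂ 2 (volume.restrict (Ioc a b)))
    (hE : ContinuousOn E (Icc a b))
    (h : ∀ᵐ s ∂(volume.restrict (Ioc a b)), ∀ r ∈ Icc a s,
      E s - E r ≤ (∫ q in r..s, inner ℝ (V₁ q) (W₁ s)) + ∫ q in r..s, inner ℝ (V₂ q) (W₂ s)) :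
    E b - E a ≤ ∫ q in Ioc a b, (inner ℝ (V₁ q) (W₁ q) + inner ℝ (V₂ q) (W₂ q)) := by
  -- Pass to strongly measurable representatives on the line, extended by zero.
  have ext : ∀ {V : ℝ → X}, MemLp V 2 (volume.restrict (Ioc a b)) → ∃ U : ℝ → X,
      StronglyMeasurable U ∧ MemLp U 2 ∧ V =ᵐ[volume.restrict (Ioc a b)] U := by
    intro V hV
    have hs := hV.1.stronglyMeasurable_mk
    refine ⟨(Ioc a b).indicator (hV.1.mk V), hs.indicator measurableSet_Ioc, ?_, ?_⟩
    · rw [memLp_indicator_iff_restrict measurableSet_Ioc]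
      exact (memLp_congr_ae hV.1.ae_eq_mk).1 hV
    · filter_upwards [hV.1.ae_eq_mk, ae_restrict_mem measurableSet_Ioc] with x h1 h2
      rw [indicator_of_mem h2, h1]
  obtain ⟨A₁, mA₁, lA₁, eA₁⟩ := ext hV₁
  obtain ⟨A₂, mA₂, lA₂, eA₂⟩ := ext hV₂
  obtain ⟨B₁, mB₁, lB₁, eB₁⟩ := ext hW₁
  obtain ⟨B₂, mB₂, lB₂, eB₂⟩ := ext hW₂
  have t1 := tendsto_steklov mA₁ mB₁ lA₁ lB₁ a b
  have t2 := tendsto_steklov mA₂ mB₂ lA₂ lB₂ a b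
  have tE := tendsto_average_increment hab hE
  have key := le_of_tendsto_of_tendsto tE (t1.add t2) ?_
  · refine key.trans (le_of_eq ?_)
    rw [← integral_add ((integrable_inner_of_memLp lA₁ lB₁).integrableOn)
      ((integrable_inner_of_memLp lA₂ lB₂).integrableOn)]
    refine integral_congr_ae ?_
    filter_upwards [eA₁, eA₂, eB₁, eB₂] with x h1 h2 h3 h4
    rw [h1, h2, h3, h4]
  have : ∀ᶠ h in 𝓝[>] (0 : ℝ), h < b - a := nhdsWithin_le_nhds (gt_mem_nhds (by linarith))
  filter_upwards [this, self_mem_nhdsWithin] with τ hτ τ0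
  have τ0 : 0 < τ := τ0
  have f1 := (steklov_fubini mA₁ mB₁ lA₁ lB₁ τ0 (Ioc (a + τ) b)).1
  have f2 := (steklov_fubini mA₂ mB₂ lA₂ lB₂ τ0 (Ioc (a + τ) b)).1
  rw [← mul_add, ← integral_add f1 f2]
  refine mul_le_mul_of_nonneg_left ?_ (inv_pos.2 τ0).le
  refine integral_mono_ae ?_ (f1.add f2) ?_
  · have cE : ContinuousOn (fun σ => E σ - E (σ - τ)) (Icc (a + τ) b) := by
      refine (hE.mono (Icc_subset_Icc (by linarith) le_rfl)).sub
        (hE.comp (by fun_prop) fun σ hσ => ⟨by linarith [hσ.1], by linarith [hσ.2]⟩)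
    exact cE.integrableOn_Icc.mono_set Ioc_subset_Icc_self
  · have sub : Ioc (a + τ) b ⊆ Ioc a b := Ioc_subset_Ioc (by linarith) le_rfl
    have hr := ae_restrict_of_ae_restrict_of_subset sub h
    filter_upwards [hr, ae_restrict_mem measurableSet_Ioc,
      ae_restrict_of_ae_restrict_of_subset sub eB₁,
      ae_restrict_of_ae_restrict_of_subset sub eB₂] with σ h1 h2 h3 h4
    have h5 := h1 (σ - τ) ⟨by linarith [h2.1], by linarith⟩
    refine h5.trans (le_of_eq ?_)
    have cong : ∀ (V A : ℝ → X) (w : X), V =ᵐ[volume.restrict (Ioc a b)] A →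
        ∫ q in (σ - τ)..σ, inner ℝ (V q) w = ∫ q in (σ - τ)..σ, inner ℝ (A q) w := by
      intro V A w hVA
      rw [intervalIntegral.integral_of_le (by linarith), intervalIntegral.integral_of_le (by linarith)]
      refine integral_congr_ae ?_
      have sub' : Ioc (σ - τ) σ ⊆ Ioc a b := Ioc_subset_Ioc (by linarith [h2.1]) h2.2
      filter_upwards [ae_restrict_of_ae_restrict_of_subset sub' hVA] with q hq
      rw [hq]
    rw [cong V₁ A₁ _ eA₁, cong V₂ A₂ _ eA₂, h3, h4]

end Steklov

/-! ### The regularized kernels -/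

theorem deltaReg_nonneg {ε : ℝ} (hε : 0 < ε) (u : ℝ) : 0 ≤ deltaReg ε u := by
  unfold deltaReg; positivity

theorem deltaReg_le {ε : ℝ} (hε : 0 < ε) (u : ℝ) : deltaReg ε u ≤ deltaReg ε 0 := by
  unfold deltaReg
  have : Real.exp (-u ^ 2 / (2 * ε ^ 2)) ≤ Real.exp (-0 ^ 2 / (2 * ε ^ 2)) := by
    rw [Real.exp_le_exp]
    have : -u ^ 2 ≤ -0 ^ 2 := by nlinarith [sq_nonneg u]
    exact div_le_div_of_nonneg_right this (by positivity)
  gcongr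

theorem deltaReg_neg (ε u : ℝ) : deltaReg ε (-u) = deltaReg ε u := by simp [deltaReg]

theorem contDiff_deltaReg (ε : ℝ) : ContDiff ℝ ∞ (deltaReg ε) := by
  unfold deltaReg; fun_prop

theorem deltaReg_eq (ε : ℝ) : deltaReg ε =
    fun u => 1 / (ε * Real.sqrt (2 * Real.pi)) * Real.exp (-(1 / (2 * ε ^ 2)) * u ^ 2) := by
  funext u
  unfold deltaReg
  congr 2
  ring

theorem integrable_deltaReg {ε : ℝ} (hε : 0 < ε) : Integrable (deltaReg ε) := by
  rw [deltaReg_eq]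
  exact (integrable_exp_neg_mul_sq (by positivity)).const_mul _

theorem integral_deltaReg {ε : ℝ} (hε : 0 < ε) : ∫ u, deltaReg ε u = 1 := by
  rw [deltaReg_eq, integral_const_mul, integral_gaussian]
  have : Real.pi / (1 / (2 * ε ^ 2)) = ε ^ 2 * (2 * Real.pi) := by field_simp
  rw [this, Real.sqrt_mul (sq_nonneg ε), Real.sqrt_sq hε.le]
  have : 0 < Real.sqrt (2 * Real.pi) := by positivity
  field_simp

theorem sgnReg_eq (ε : ℝ) : sgnReg ε = fun u => ∫ v in (0 : ℝ)..u, 2 * deltaReg ε v := by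
  funext u
  unfold sgnReg deltaReg
  rw [← intervalIntegral.integral_const_mul]
  simp only [mul_assoc]

theorem hasDerivAt_sgnReg (ε u : ℝ) : HasDerivAt (sgnReg ε) (2 * deltaReg ε u) u := by
  have hc : Continuous (fun v => 2 * deltaReg ε v) :=
    continuous_const.mul (contDiff_deltaReg ε).continuous
  rw [sgnReg_eq]
  exact intervalIntegral.integral_hasDerivAt_right (hc.intervalIntegrable _ _)
    (hc.stronglyMeasurableAtFilter _ _) hc.continuousAt

theorem contDiff_sgnReg (ε : ℝ) : ContDiff ℝ ∞ (sgnReg ε) := by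
  rw [contDiff_infty_iff_deriv]
  refine ⟨fun u => (hasDerivAt_sgnReg ε u).differentiableAt, ?_⟩
  rw [show deriv (sgnReg ε) = fun u => 2 * deltaReg ε u from
    funext fun u => (hasDerivAt_sgnReg ε u).deriv]
  exact contDiff_const.mul (contDiff_deltaReg ε)

theorem abs_sgnReg_le {ε : ℝ} (hε : 0 < ε) (u : ℝ) : |sgnReg ε u| ≤ 2 := by
  rw [sgnReg_eq, ← Real.norm_eq_abs]
  have hi : Integrable (fun v => 2 * deltaReg ε v) := (integrable_deltaReg hε).const_mul 2
  refine (intervalIntegral.norm_integral_le_integral_norm_uIoc).trans ?_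
  refine (setIntegral_le_integral hi.norm (ae_of_all _ fun v => norm_nonneg _)).trans ?_
  have : ∀ v, ‖2 * deltaReg ε v‖ = 2 * deltaReg ε v := fun v =>
    Real.norm_of_nonneg (mul_nonneg (by norm_num) (deltaReg_nonneg hε v))
  simp only [this]
  rw [integral_const_mul, integral_deltaReg hε, mul_one]

theorem sgnReg_neg (ε u : ℝ) : sgnReg ε (-u) = -sgnReg ε u := by
  rw [sgnReg_eq]
  have := intervalIntegral.integral_comp_neg (a := 0) (b := u) (fun v => 2 * deltaReg ε v)
  simp only [deltaReg_neg, neg_zero] at this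
  simp only
  rw [this, intervalIntegral.integral_symm]

theorem sgnReg_nonneg {ε u : ℝ} (hε : 0 < ε) (hu : 0 ≤ u) : 0 ≤ sgnReg ε u := by
  rw [sgnReg_eq]
  exact intervalIntegral.integral_nonneg hu
    fun v _ => mul_nonneg (by norm_num) (deltaReg_nonneg hε v)

/-- The kernel `sgn^(ε)(x) δ^(ε)(y)` of the first component of the force. -/
noncomputable def kernelX (ε : ℝ) (z : ℝ × ℝ) : ℝ := sgnReg ε z.1 * deltaReg ε z.2

/-- The kernel `sgn^(ε)(y) δ^(ε)(x)` of the second component of the force. -/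
noncomputable def kernelY (ε : ℝ) (z : ℝ × ℝ) : ℝ := sgnReg ε z.2 * deltaReg ε z.1

/-- The Gaussian approximation `δ^(ε)(x) δ^(ε)(y)` of the Dirac mass on the plane. -/
noncomputable def kernelDelta (ε : ℝ) (z : ℝ × ℝ) : ℝ := deltaReg ε z.1 * deltaReg ε z.2

theorem contDiff_kernelX (ε : ℝ) : ContDiff ℝ ∞ (kernelX ε) :=
  ((contDiff_sgnReg ε).comp contDiff_fst).mul ((contDiff_deltaReg ε).comp contDiff_snd)

theorem contDiff_kernelY (ε : ℝ) : ContDiff ℝ ∞ (kernelY ε) :=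
  ((contDiff_sgnReg ε).comp contDiff_snd).mul ((contDiff_deltaReg ε).comp contDiff_fst)

theorem contDiff_kernelDelta (ε : ℝ) : ContDiff ℝ ∞ (kernelDelta ε) :=
  ((contDiff_deltaReg ε).comp contDiff_fst).mul ((contDiff_deltaReg ε).comp contDiff_snd)

theorem abs_kernelX_le {ε : ℝ} (hε : 0 < ε) (z : ℝ × ℝ) : |kernelX ε z| ≤ 2 * deltaReg ε 0 := by
  rw [kernelX, abs_mul, abs_of_nonneg (deltaReg_nonneg hε _)]
  exact mul_le_mul (abs_sgnReg_le hε _) (deltaReg_le hε _) (deltaReg_nonneg hε _) (by norm_num)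

theorem abs_kernelY_le {ε : ℝ} (hε : 0 < ε) (z : ℝ × ℝ) : |kernelY ε z| ≤ 2 * deltaReg ε 0 := by
  rw [kernelY, abs_mul, abs_of_nonneg (deltaReg_nonneg hε _)]
  exact mul_le_mul (abs_sgnReg_le hε _) (deltaReg_le hε _) (deltaReg_nonneg hε _) (by norm_num)

theorem kernelDelta_nonneg {ε : ℝ} (hε : 0 < ε) (z : ℝ × ℝ) : 0 ≤ kernelDelta ε z :=
  mul_nonneg (deltaReg_nonneg hε _) (deltaReg_nonneg hε _)

theorem kernelDelta_le {ε : ℝ} (hε : 0 < ε) (z : ℝ × ℝ) : kernelDelta ε z ≤ deltaReg ε 0 ^ 2 := by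
  rw [sq]
  exact mul_le_mul (deltaReg_le hε _) (deltaReg_le hε _) (deltaReg_nonneg hε _)
    (deltaReg_nonneg hε _)

theorem abs_kernelDelta_le {ε : ℝ} (hε : 0 < ε) (z : ℝ × ℝ) :
    |kernelDelta ε z| ≤ deltaReg ε 0 ^ 2 := by
  rw [abs_of_nonneg (kernelDelta_nonneg hε z)]; exact kernelDelta_le hε z

theorem kernelDelta_neg (ε : ℝ) (z : ℝ × ℝ) : kernelDelta ε (-z) = kernelDelta ε z := by
  simp [kernelDelta, deltaReg_neg]

theorem integral_kernelDelta {ε : ℝ} (hε : 0 < ε) : ∫ z, kernelDelta ε z = 1 := by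
  have := integral_prod_mul (μ := (volume : Measure ℝ)) (ν := (volume : Measure ℝ))
    (deltaReg ε) (deltaReg ε)
  rw [integral_deltaReg hε, one_mul] at this
  exact this

theorem integrable_kernelDelta {ε : ℝ} (hε : 0 < ε) : Integrable (kernelDelta ε) :=
  (integrable_deltaReg hε).mul_prod (integrable_deltaReg hε)

theorem partialX_kernelX (ε : ℝ) (z : ℝ × ℝ) :
    partialX (kernelX ε) z = 2 * kernelDelta ε z := by
  have h1 : HasFDerivAt (fun z : ℝ × ℝ => sgnReg ε z.1)
      ((2 * deltaReg ε z.1) • ContinuousLinearMap.fst ℝ ℝ ℝ) z :=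
    (hasDerivAt_sgnReg ε z.1).comp_hasFDerivAt z hasFDerivAt_fst
  have h2 : HasFDerivAt (fun z : ℝ × ℝ => deltaReg ε z.2)
      (deriv (deltaReg ε) z.2 • ContinuousLinearMap.snd ℝ ℝ ℝ) z :=
    (((contDiff_deltaReg ε).differentiable (by simp) z.2).hasDerivAt).comp_hasFDerivAt z
      hasFDerivAt_snd
  have h3 := (h1.mul h2).fderiv
  change fderiv ℝ (fun z : ℝ × ℝ => sgnReg ε z.1 * deltaReg ε z.2) z (1, 0) = _
  erw [h3]
  simp [kernelDelta]
  ring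

theorem partialY_kernelY (ε : ℝ) (z : ℝ × ℝ) :
    partialY (kernelY ε) z = 2 * kernelDelta ε z := by
  have h1 : HasFDerivAt (fun z : ℝ × ℝ => sgnReg ε z.2)
      ((2 * deltaReg ε z.2) • ContinuousLinearMap.snd ℝ ℝ ℝ) z :=
    (hasDerivAt_sgnReg ε z.2).comp_hasFDerivAt z hasFDerivAt_snd
  have h2 : HasFDerivAt (fun z : ℝ × ℝ => deltaReg ε z.1)
      (deriv (deltaReg ε) z.1 • ContinuousLinearMap.fst ℝ ℝ ℝ) z :=
    (((contDiff_deltaReg ε).differentiable (by simp) z.1).hasDerivAt).comp_hasFDerivAt z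
      hasFDerivAt_fst
  have h3 := (h1.mul h2).fderiv
  change fderiv ℝ (fun z : ℝ × ℝ => sgnReg ε z.2 * deltaReg ε z.1) z (0, 1) = _
  erw [h3]
  simp [kernelDelta]
  ring

theorem regForceX_eq (ε : ℝ) (g : ℝ × ℝ → ℝ) (z : ℝ × ℝ) :
    regForceX ε g z = -kernelConv (kernelX ε) g z := by
  unfold regForceX kernelConv kernelX
  congr 2
  funext w
  simp only [Prod.fst_sub, Prod.snd_sub]
  ring

theorem regForceY_eq (ε : ℝ) (g : ℝ × ℝ → ℝ) (z : ℝ × ℝ) :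
    regForceY ε g z = -kernelConv (kernelY ε) g z := by
  unfold regForceY kernelConv kernelY
  congr 2
  funext w
  simp only [Prod.fst_sub, Prod.snd_sub]
  ring

/-! ### Convolution with bounded kernels and integration by parts -/

section BoundedKernel

variable {K : ℝ × ℝ → ℝ} {B : ℝ}

theorem integrable_mul_kernel {g : ℝ × ℝ → ℝ} (hK : Continuous K) (hB : ∀ z, |K z| ≤ B)
    (hg : Integrable g) (z : ℝ × ℝ) : Integrable (fun w => g w * K (z - w)) :=
  hg.mul_bdd (c := B) (hK.comp (by fun_prop)).aestronglyMeasurable (ae_of_all _ fun w => hB _)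

theorem abs_kernelConv_le {g : ℝ × ℝ → ℝ} (hB : ∀ z, |K z| ≤ B)
    (hg : Integrable g) (z : ℝ × ℝ) : |kernelConv K g z| ≤ B * ∫ w, |g w| := by
  rw [← integral_const_mul, ← Real.norm_eq_abs]
  refine norm_integral_le_of_norm_le (hg.abs.const_mul B) (ae_of_all _ fun w => ?_)
  rw [norm_mul, mul_comm]
  exact mul_le_mul_of_nonneg_right (hB _) (norm_nonneg _)

theorem continuous_kernelConv {g : ℝ × ℝ → ℝ} (hK : Continuous K) (hB : ∀ z, |K z| ≤ B)
    (hg : Integrable g) : Continuous (kernelConv K g) := by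
  refine continuous_of_dominated (bound := fun w => B * |g w|)
    (fun z => (integrable_mul_kernel hK hB hg z).aestronglyMeasurable)
    (fun z => ae_of_all _ fun w => ?_) (hg.abs.const_mul B) (ae_of_all _ fun w => ?_)
  · rw [norm_mul, mul_comm]
    exact mul_le_mul_of_nonneg_right (hB _) (norm_nonneg _)
  · fun_prop

theorem integrable_prod_kernel {v g : ℝ × ℝ → ℝ} (hK : Continuous K) (hB : ∀ z, |K z| ≤ B)
    (hv : Integrable v) (hg : Integrable g) :
    Integrable (fun p : (ℝ × ℝ) × (ℝ × ℝ) => v p.1 * g p.2 * K (p.1 - p.2)) :=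
  (hv.mul_prod hg).mul_bdd (c := B) (hK.comp (by fun_prop)).aestronglyMeasurable
    (ae_of_all _ fun w => hB _)

theorem integral_mul_kernelConv {v g : ℝ × ℝ → ℝ} (hK : Continuous K) (hB : ∀ z, |K z| ≤ B)
    (hv : Integrable v) (hg : Integrable g) :
    ∫ z, v z * kernelConv K g z =
      ∫ p : (ℝ × ℝ) × (ℝ × ℝ), v p.1 * g p.2 * K (p.1 - p.2) := by
  have := integral_prod _ (integrable_prod_kernel hK hB hv hg)
  rw [show (volume : Measure ((ℝ × ℝ) × (ℝ × ℝ))) = volume.prod volume from rfl, this]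
  refine integral_congr_ae (ae_of_all _ fun z => ?_)
  simp only [kernelConv]
  rw [← integral_const_mul]
  simp only [mul_assoc]

theorem integral_prod_kernel_swap {v g : ℝ × ℝ → ℝ} (hK : Continuous K) (hB : ∀ z, |K z| ≤ B)
    (hv : Integrable v) (hg : Integrable g) :
    ∫ p : (ℝ × ℝ) × (ℝ × ℝ), v p.1 * g p.2 * K (p.1 - p.2) =
      ∫ w, g w * ∫ z, v z * K (z - w) := by
  have := integral_prod_symm _ (integrable_prod_kernel hK hB hv hg)
  rw [show (volume : Measure ((ℝ × ℝ) × (ℝ × ℝ))) = volume.prod volume from rfl, this]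
  refine integral_congr_ae (ae_of_all _ fun w => ?_)
  simp only
  rw [← integral_const_mul]
  refine integral_congr_ae (ae_of_all _ fun z => ?_)
  simp only
  ring

end BoundedKernel

/-- Weak derivatives may be tested against smooth functions that are bounded together with their
derivative, rather than compactly supported, when the functions involved are integrable. -/
theorem integral_mul_partialX_of_bounded {v w₁ w₂ f : ℝ × ℝ → ℝ} (h : HasWeakGradient v w₁ w₂)
    (hv : Integrable v) (hw : Integrable w₁) (hf : ContDiff ℝ ∞ f) {B B' : ℝ}
    (hB : ∀ z, |f z| ≤ B) (hB' : ∀ z, |partialX f z| ≤ B') :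
    ∫ z, v z * partialX f z = -∫ z, w₁ z * f z := by
  obtain ⟨C, hC0, hC⟩ := exists_cutoff_bound
  have hB0 : 0 ≤ B := (abs_nonneg _).trans (hB 0)
  have df : Differentiable ℝ f := hf.differentiable (by simp)
  have dc : ∀ n, Differentiable ℝ (cutoff n) :=
    fun n => (cutoff_isTest n).1.differentiable (by simp)
  have eq : ∀ n, ∫ z, v z * (f z * partialX (cutoff n) z + partialX f z * cutoff n z) =
      -∫ z, w₁ z * (f z * cutoff n z) := by
    intro n
    have := h.weakX _ ((cutoff_isTest n).mul_contDiff hf)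
    rw [← this]
    refine integral_congr_ae (ae_of_all _ fun z => ?_)
    simp only
    rw [partialX_mul (df z) (dc n z)]
  have l1 : Tendsto (fun n => ∫ z, v z * (f z * partialX (cutoff n) z + partialX f z * cutoff n z))
      atTop (𝓝 (∫ z, v z * partialX f z)) := by
    refine tendsto_integral_of_dominated_convergence (fun z => |v z| * (B * C + B'))
      (fun n => hv.1.mul ?_) (hv.abs.mul_const _) (fun n => ae_of_all _ fun z => ?_)
      (ae_of_all _ fun z => ?_)
    · exact ((hf.continuous.mul (cutoff_isTest n).partialX.continuous).add
        (hf.partialX.continuous.mul (cutoff_isTest n).continuous)).aestronglyMeasurable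
    · rw [norm_mul]
      refine mul_le_mul_of_nonneg_left ?_ (norm_nonneg _)
      refine (norm_add_le _ _).trans (add_le_add ?_ ?_)
      · rw [norm_mul]
        refine mul_le_mul (hB z) ?_ (norm_nonneg _) hB0
        have := (hC n z).2.2.1
        rw [Real.norm_eq_abs]
        nlinarith [mul_nonneg (abs_nonneg (partialX (cutoff n) z)) (norm_nonneg z)]
      · rw [norm_mul]
        exact (mul_le_of_le_one_right (norm_nonneg _) (abs_cutoff_le_one n z)).trans (hB' z)
    · refine tendsto_const_nhds.congr' ?_
      filter_upwards [cutoff_eventually_one z] with n hn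
      have h1 := hn.self_of_nhds
      have h2 := hn.partialX_eq.self_of_nhds
      simp only at h1
      rw [h1, h2]
      simp [partialX]
  have l2 : Tendsto (fun n => -∫ z, w₁ z * (f z * cutoff n z)) atTop (𝓝 (-∫ z, w₁ z * f z)) := by
    refine (tendsto_integral_of_dominated_convergence (fun z => |w₁ z| * B)
      (fun n => hw.1.mul ?_) (hw.abs.mul_const _) (fun n => ae_of_all _ fun z => ?_)
      (ae_of_all _ fun z => ?_)).neg
    · exact (hf.continuous.mul (cutoff_isTest n).continuous).aestronglyMeasurable
    · change ‖w₁ z * (f z * cutoff n z)‖ ≤ _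
      rw [norm_mul]
      refine mul_le_mul_of_nonneg_left ?_ (norm_nonneg _)
      rw [norm_mul]
      exact (mul_le_of_le_one_right (norm_nonneg _) (abs_cutoff_le_one n z)).trans (hB z)
    · have := ((cutoff_tendsto z).const_mul (f z)).const_mul (w₁ z)
      simpa using this
  exact tendsto_nhds_unique l1 (l2.congr fun n => (eq n).symm)

theorem integral_mul_partialY_of_bounded {v w₁ w₂ f : ℝ × ℝ → ℝ} (h : HasWeakGradient v w₁ w₂)
    (hv : Integrable v) (hw : Integrable w₂) (hf : ContDiff ℝ ∞ f) {B B' : ℝ}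
    (hB : ∀ z, |f z| ≤ B) (hB' : ∀ z, |partialY f z| ≤ B') :
    ∫ z, v z * partialY f z = -∫ z, w₂ z * f z := by
  obtain ⟨C, hC0, hC⟩ := exists_cutoff_bound
  have hB0 : 0 ≤ B := (abs_nonneg _).trans (hB 0)
  have df : Differentiable ℝ f := hf.differentiable (by simp)
  have dc : ∀ n, Differentiable ℝ (cutoff n) :=
    fun n => (cutoff_isTest n).1.differentiable (by simp)
  have eq : ∀ n, ∫ z, v z * (f z * partialY (cutoff n) z + partialY f z * cutoff n z) =
      -∫ z, w₂ z * (f z * cutoff n z) := by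
    intro n
    have := h.weakY _ ((cutoff_isTest n).mul_contDiff hf)
    rw [← this]
    refine integral_congr_ae (ae_of_all _ fun z => ?_)
    simp only
    rw [partialY_mul (df z) (dc n z)]
  have l1 : Tendsto (fun n => ∫ z, v z * (f z * partialY (cutoff n) z + partialY f z * cutoff n z))
      atTop (𝓝 (∫ z, v z * partialY f z)) := by
    refine tendsto_integral_of_dominated_convergence (fun z => |v z| * (B * C + B'))
      (fun n => hv.1.mul ?_) (hv.abs.mul_const _) (fun n => ae_of_all _ fun z => ?_)
      (ae_of_all _ fun z => ?_)
    · exact ((hf.continuous.mul (cutoff_isTest n).partialY.continuous).add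
        (hf.partialY.continuous.mul (cutoff_isTest n).continuous)).aestronglyMeasurable
    · rw [norm_mul]
      refine mul_le_mul_of_nonneg_left ?_ (norm_nonneg _)
      refine (norm_add_le _ _).trans (add_le_add ?_ ?_)
      · rw [norm_mul]
        refine mul_le_mul (hB z) ?_ (norm_nonneg _) hB0
        have := (hC n z).2.2.2.1
        rw [Real.norm_eq_abs]
        nlinarith [mul_nonneg (abs_nonneg (partialY (cutoff n) z)) (norm_nonneg z)]
      · rw [norm_mul]
        exact (mul_le_of_le_one_right (norm_nonneg _) (abs_cutoff_le_one n z)).trans (hB' z)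
    · refine tendsto_const_nhds.congr' ?_
      filter_upwards [cutoff_eventually_one z] with n hn
      have h1 := hn.self_of_nhds
      have h2 := hn.partialY_eq.self_of_nhds
      simp only at h1
      rw [h1, h2]
      simp [partialY]
  have l2 : Tendsto (fun n => -∫ z, w₂ z * (f z * cutoff n z)) atTop (𝓝 (-∫ z, w₂ z * f z)) := by
    refine (tendsto_integral_of_dominated_convergence (fun z => |w₂ z| * B)
      (fun n => hw.1.mul ?_) (hw.abs.mul_const _) (fun n => ae_of_all _ fun z => ?_)
      (ae_of_all _ fun z => ?_)).neg
    · exact (hf.continuous.mul (cutoff_isTest n).continuous).aestronglyMeasurable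
    · change ‖w₂ z * (f z * cutoff n z)‖ ≤ _
      rw [norm_mul]
      refine mul_le_mul_of_nonneg_left ?_ (norm_nonneg _)
      rw [norm_mul]
      exact (mul_le_of_le_one_right (norm_nonneg _) (abs_cutoff_le_one n z)).trans (hB z)
    · have := ((cutoff_tendsto z).const_mul (f z)).const_mul (w₂ z)
      simpa using this
  exact tendsto_nhds_unique l1 (l2.congr fun n => (eq n).symm)

/-- The interaction energy `∬∬ v(z) g(w) δ^(ε)(z - w) dz dw`. -/
noncomputable def interaction (ε : ℝ) (v g : ℝ × ℝ → ℝ) : ℝ :=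
  ∫ p : (ℝ × ℝ) × (ℝ × ℝ), v p.1 * g p.2 * kernelDelta ε (p.1 - p.2)

theorem integral_mul_regForceX {v w₁ w₂ g : ℝ × ℝ → ℝ} {ε : ℝ} (hε : 0 < ε)
    (h : HasWeakGradient v w₁ w₂) (hv : Integrable v) (hw : Integrable w₁) (hg : Integrable g) :
    ∫ z, w₁ z * regForceX ε g z = 2 * interaction ε v g := by
  have cK := (contDiff_kernelX ε).continuous
  have cD := (contDiff_kernelDelta ε).continuous
  simp only [regForceX_eq, mul_neg]
  rw [integral_neg, integral_mul_kernelConv cK (abs_kernelX_le hε) hw hg,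
    integral_prod_kernel_swap cK (abs_kernelX_le hε) hw hg, interaction,
    integral_prod_kernel_swap cD (abs_kernelDelta_le hε) hv hg, ← integral_neg,
    ← integral_const_mul]
  refine integral_congr_ae (ae_of_all _ fun w => ?_)
  have sh : ∀ z, partialX (fun z => kernelX ε (z - w)) z = 2 * kernelDelta ε (z - w) := by
    intro z
    rw [← partialX_kernelX, partialX, partialX, fderiv_comp_sub]
  have cS : ContDiff ℝ ∞ (fun z => kernelX ε (z - w)) :=
    (contDiff_kernelX ε).comp (contDiff_id.sub contDiff_const)
  have := integral_mul_partialX_of_bounded h hv hw cS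
    (fun z => abs_kernelX_le hε (z - w)) (B' := 2 * deltaReg ε 0 ^ 2) (fun z => by
      rw [sh, abs_mul, abs_two]
      exact mul_le_mul_of_nonneg_left (abs_kernelDelta_le hε _) (by norm_num))
  rw [integral_congr_ae (ae_of_all _ fun z => congrArg (v z * ·) (sh z))] at this
  have e : ∫ z, v z * (2 * kernelDelta ε (z - w)) = 2 * ∫ z, v z * kernelDelta ε (z - w) := by
    rw [← integral_const_mul]
    refine integral_congr_ae (ae_of_all _ fun z => ?_)
    simp only
    ring
  rw [e] at this
  linear_combination -(g w) * this

theorem integral_mul_regForceY {v w₁ w₂ g : ℝ × ℝ → ℝ} {ε : ℝ} (hε : 0 < ε)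
    (h : HasWeakGradient v w₁ w₂) (hv : Integrable v) (hw : Integrable w₂) (hg : Integrable g) :
    ∫ z, w₂ z * regForceY ε g z = 2 * interaction ε v g := by
  have cK := (contDiff_kernelY ε).continuous
  have cD := (contDiff_kernelDelta ε).continuous
  simp only [regForceY_eq, mul_neg]
  rw [integral_neg, integral_mul_kernelConv cK (abs_kernelY_le hε) hw hg,
    integral_prod_kernel_swap cK (abs_kernelY_le hε) hw hg, interaction,
    integral_prod_kernel_swap cD (abs_kernelDelta_le hε) hv hg, ← integral_neg,
    ← integral_const_mul]
  refine integral_congr_ae (ae_of_all _ fun w => ?_)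
  have sh : ∀ z, partialY (fun z => kernelY ε (z - w)) z = 2 * kernelDelta ε (z - w) := by
    intro z
    rw [← partialY_kernelY, partialY, partialY, fderiv_comp_sub]
  have cS : ContDiff ℝ ∞ (fun z => kernelY ε (z - w)) :=
    (contDiff_kernelY ε).comp (contDiff_id.sub contDiff_const)
  have := integral_mul_partialY_of_bounded h hv hw cS
    (fun z => abs_kernelY_le hε (z - w)) (B' := 2 * deltaReg ε 0 ^ 2) (fun z => by
      rw [sh, abs_mul, abs_two]
      exact mul_le_mul_of_nonneg_left (abs_kernelDelta_le hε _) (by norm_num))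
  rw [integral_congr_ae (ae_of_all _ fun z => congrArg (v z * ·) (sh z))] at this
  have e : ∫ z, v z * (2 * kernelDelta ε (z - w)) = 2 * ∫ z, v z * kernelDelta ε (z - w) := by
    rw [← integral_const_mul]
    refine integral_congr_ae (ae_of_all _ fun z => ?_)
    simp only
    ring
  rw [e] at this
  linear_combination -(g w) * this

/-- The divergence of the force is `-4 δ^(ε) * g`, tested against a function in `W^{1,1}`. -/
theorem integral_mul_regForce {v w₁ w₂ g : ℝ × ℝ → ℝ} {ε : ℝ} (hε : 0 < ε)
    (h : HasWeakGradient v w₁ w₂) (hv : Integrable v) (hw₁ : Integrable w₁) (hw₂ : Integrable w₂)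
    (hg : Integrable g) :
    (∫ z, w₁ z * regForceX ε g z) + ∫ z, w₂ z * regForceY ε g z = 4 * interaction ε v g := by
  rw [integral_mul_regForceX hε h hv hw₁ hg, integral_mul_regForceY hε h hv hw₂ hg]
  ring

theorem integrable_interaction {ε : ℝ} (hε : 0 < ε) {v g : ℝ × ℝ → ℝ} (hv : Integrable v)
    (hg : Integrable g) :
    Integrable (fun p : (ℝ × ℝ) × (ℝ × ℝ) => v p.1 * g p.2 * kernelDelta ε (p.1 - p.2)) :=
  integrable_prod_kernel (contDiff_kernelDelta ε).continuous (abs_kernelDelta_le hε) hv hg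

theorem abs_interaction_le {ε : ℝ} (hε : 0 < ε) {v g : ℝ × ℝ → ℝ} (hv : Integrable v)
    (hg : Integrable g) :
    |interaction ε v g| ≤ deltaReg ε 0 ^ 2 * (∫ z, |g z|) * ∫ z, |v z| := by
  have h1 := integral_mul_kernelConv (contDiff_kernelDelta ε).continuous
    (abs_kernelDelta_le hε) hv hg
  rw [interaction, ← h1, ← integral_const_mul, ← Real.norm_eq_abs]
  refine norm_integral_le_of_norm_le (hv.abs.const_mul _) (ae_of_all _ fun z => ?_)
  rw [norm_mul, mul_comm]
  exact mul_le_mul_of_nonneg_right (abs_kernelConv_le (abs_kernelDelta_le hε) hg z) (norm_nonneg _)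

/-! ### The drift term as an element of `L²` -/

theorem memLp_kernelConv_mul {K f : ℝ × ℝ → ℝ} {B : ℝ} (hK : Continuous K) (hB : ∀ z, |K z| ≤ B)
    (hf : Integrable f) (u : L2Plane) : MemLp (fun z => kernelConv K f z * u z) 2 := by
  refine (Lp.memLp u).of_le_mul (c := B * ∫ w, |f w|)
    ((continuous_kernelConv hK hB hf).aestronglyMeasurable.mul (Lp.aestronglyMeasurable u))
    (ae_of_all _ fun z => ?_)
  rw [norm_mul]
  exact mul_le_mul_of_nonneg_right (abs_kernelConv_le hB hf z) (norm_nonneg _)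

open Classical in
/-- The product `(K * f) u` as an element of `L²`; it is `0` when the product is not square
integrable. -/
noncomputable def convMul (K f : ℝ × ℝ → ℝ) (u : L2Plane) : L2Plane :=
  if h : MemLp (fun z => kernelConv K f z * u z) 2 then h.toLp _ else 0

theorem coeFn_convMul {K f : ℝ × ℝ → ℝ} {B : ℝ} (hK : Continuous K) (hB : ∀ z, |K z| ≤ B)
    (hf : Integrable f) (u : L2Plane) :
    convMul K f u =ᵐ[volume] fun z => kernelConv K f z * u z := by
  rw [convMul, dif_pos (memLp_kernelConv_mul hK hB hf u)]
  exact MemLp.coeFn_toLp _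

theorem norm_convMul_le {K f : ℝ × ℝ → ℝ} {B : ℝ} (hK : Continuous K) (hB : ∀ z, |K z| ≤ B)
    (hf : Integrable f) (u : L2Plane) : ‖convMul K f u‖ ≤ B * (∫ w, |f w|) * ‖u‖ := by
  refine Lp.norm_le_mul_norm_of_ae_le_mul ?_
  filter_upwards [coeFn_convMul hK hB hf u] with z hz
  rw [hz, norm_mul]
  exact mul_le_mul_of_nonneg_right (abs_kernelConv_le hB hf z) (norm_nonneg _)

theorem kernelConv_sub {K f g : ℝ × ℝ → ℝ} {B : ℝ} (hK : Continuous K) (hB : ∀ z, |K z| ≤ B)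
    (hf : Integrable f) (hg : Integrable g) (z : ℝ × ℝ) :
    kernelConv K (fun w => f w - g w) z = kernelConv K f z - kernelConv K g z := by
  simp only [kernelConv, sub_mul]
  exact integral_sub (integrable_mul_kernel hK hB hf z) (integrable_mul_kernel hK hB hg z)

theorem norm_convMul_sub_le {K f g : ℝ × ℝ → ℝ} {B : ℝ} (hK : Continuous K) (hB : ∀ z, |K z| ≤ B)
    (hf : Integrable f) (hg : Integrable g) (u v : L2Plane) :
    ‖convMul K f u - convMul K g v‖ ≤
      B * (∫ w, |f w - g w|) * ‖u‖ + B * (∫ w, |g w|) * ‖u - v‖ := by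
  have e : convMul K f u - convMul K g v =
      convMul K (fun w => f w - g w) u + convMul K g (u - v) := by
    refine Lp.ext ?_
    filter_upwards [coeFn_convMul hK hB hf u, coeFn_convMul hK hB hg v,
      coeFn_convMul hK hB (hf.sub hg) u, coeFn_convMul hK hB hg (u - v),
      Lp.coeFn_sub (convMul K f u) (convMul K g v), Lp.coeFn_sub u v,
      Lp.coeFn_add (convMul K (fun w => f w - g w) u) (convMul K g (u - v))]
      with z h1 h2 h3 h4 h5 h6 h7
    have h3' : (convMul K (fun w => f w - g w) u) z = kernelConv K (fun w => f w - g w) z * u z := h3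
    rw [h5, h7, Pi.sub_apply, Pi.add_apply, h1, h2, h3', h4, h6, Pi.sub_apply,
      kernelConv_sub hK hB hf hg]
    ring
  rw [e]
  exact (norm_add_le _ _).trans (add_le_add (norm_convMul_le hK hB (hf.sub hg) u)
    (norm_convMul_le hK hB hg (u - v)))

/-- The indicator of a ball as an element of `L²`. -/
noncomputable def ballIndicator (N : ℝ) : L2Plane :=
  indicatorConstLp 2 (measurableSet_ball (x := (0 : ℝ × ℝ)) (ε := N))
    (measure_ball_lt_top (μ := volume)).ne (1 : ℝ)

/-- On a ball, the `L¹` norm is controlled by the `L²` norm. -/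
theorem integral_abs_indicator_le (u : L2Plane) (N : ℝ) :
    Integrable ((Metric.ball 0 N).indicator u) ∧
    ∫ z, |(Metric.ball (0 : ℝ × ℝ) N).indicator u z| ≤
      ‖ballIndicator N‖ * ‖u‖ := by
  have hi : IntegrableOn u (Metric.ball 0 N) := by
    have : IsFiniteMeasure (volume.restrict (Metric.ball (0 : ℝ × ℝ) N)) :=
      ⟨by simpa using measure_ball_lt_top⟩
    exact ((Lp.memLp u).restrict _).integrable (by norm_num)
  refine ⟨hi.integrable_indicator measurableSet_ball, ?_⟩
  rw [mul_comm, ← norm_absL2 u]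
  refine le_trans (le_of_eq ?_) (real_inner_le_norm _ _)
  rw [l2_inner_eq]
  refine integral_congr_ae ?_
  filter_upwards [coeFn_absL2 u, indicatorConstLp_coeFn (p := 2)
    (hs := measurableSet_ball (x := (0 : ℝ × ℝ)) (ε := N)) 
    (hμs := (measure_ball_lt_top (μ := volume)).ne) (c := (1 : ℝ))] with z h1 h2
  rw [h1, ballIndicator, h2]
  by_cases hz : z ∈ Metric.ball (0 : ℝ × ℝ) N
  · simp [hz]
  · simp [hz]

theorem aestronglyMeasurable_convMul {K : ℝ × ℝ → ℝ} {B : ℝ} (hK : Continuous K)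
    (hB : ∀ z, |K z| ≤ B) {ρ : ℝ → L2Plane} {S : Set ℝ} (hS : MeasurableSet S)
    (hρ : ContinuousOn ρ S) (h1 : ∀ s ∈ S, Integrable (ρ s)) :
    AEStronglyMeasurable (fun s => convMul K (ρ s) (ρ s)) (volume.restrict S) := by
  have hB0 : 0 ≤ B := (abs_nonneg _).trans (hB 0)
  let P : ℕ → L2Plane → ℝ × ℝ → ℝ := fun N u => (Metric.ball 0 N).indicator u
  have hP : ∀ N u, Integrable (P N u) := fun N u => (integral_abs_indicator_le u N).1
  have hc : ∀ N, Continuous (fun u => convMul K (P N u) u) := by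
    intro N
    rw [continuous_iff_continuousAt]
    intro v
    set c := ‖ballIndicator N‖
    have bd : ∀ u : L2Plane, ‖convMul K (P N u) u - convMul K (P N v) v‖ ≤
        B * (c * ‖u - v‖) * ‖u‖ + B * (∫ w, |P N v w|) * ‖u - v‖ := by
      intro u
      refine (norm_convMul_sub_le hK hB (hP N u) (hP N v) u v).trans ?_
      gcongr
      refine le_trans (le_of_eq (integral_congr_ae ?_)) (integral_abs_indicator_le (u - v) N).2
      filter_upwards [Lp.coeFn_sub u v] with z hz
      by_cases hzb : z ∈ Metric.ball (0 : ℝ × ℝ) N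
      · simp only [P, indicator_of_mem hzb]
        rw [hz, Pi.sub_apply]
      · simp only [P, indicator_of_notMem hzb, sub_zero]
    refine tendsto_iff_norm_sub_tendsto_zero.2 (squeeze_zero (fun _ => norm_nonneg _) bd ?_)
    have : Continuous fun u : L2Plane =>
        B * (c * ‖u - v‖) * ‖u‖ + B * (∫ w, |P N v w|) * ‖u - v‖ := by fun_prop
    have := this.tendsto v
    simpa using this
  refine aestronglyMeasurable_of_tendsto_ae atTop
    (f := fun (N : ℕ) s => convMul K (P N (ρ s)) (ρ s))
    (fun N => ((hc N).comp_continuousOn hρ).aestronglyMeasurable hS) ?_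
  filter_upwards [ae_restrict_mem hS] with s hs
  have hs1 := h1 s hs
  have lim : Tendsto (fun N : ℕ => ∫ w, |P N (ρ s) w - ρ s w|) atTop (𝓝 (∫ _ : ℝ × ℝ, (0 : ℝ))) := by
    refine tendsto_integral_of_dominated_convergence (fun w => |ρ s w|)
      (fun N => ((hP N _).sub hs1).abs.aestronglyMeasurable) hs1.abs
      (fun N => ae_of_all _ fun w => ?_) (ae_of_all _ fun w => ?_)
    · by_cases hw : w ∈ Metric.ball (0 : ℝ × ℝ) N
      · simp [P, hw]
      · simp [P, hw]
    · refine tendsto_const_nhds.congr' ?_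
      obtain ⟨M, hM⟩ := exists_nat_gt ‖w‖
      filter_upwards [eventually_ge_atTop M] with N hN
      have : w ∈ Metric.ball (0 : ℝ × ℝ) N := by
        rw [mem_ball_zero_iff]
        exact hM.trans_le (by exact_mod_cast hN)
      simp only [P]
      rw [indicator_of_mem this]
      simp
  rw [integral_zero] at lim
  refine tendsto_iff_norm_sub_tendsto_zero.2 (squeeze_zero (fun _ => norm_nonneg _)
    (fun N => norm_convMul_sub_le hK hB (hP N _) hs1 _ _) ?_)
  have := (lim.const_mul B).mul_const ‖ρ s‖
  simpa using this

/-! ### Solutions: integrability and the weak formulation in `H¹` -/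

/-- `(G₁, G₂)` is the spatial gradient of the solution `ρ` of the regularized problem. -/
structure IsSolutionGradient (D ε : ℝ) (ρ₀ : ℝ × ℝ → ℝ) (ρ G₁ G₂ : ℝ → L2Plane) : Prop where
  memLp₁ : ∀ T > 0, MemLp G₁ 2 (volume.restrict (Ioc (0 : ℝ) T))
  memLp₂ : ∀ T > 0, MemLp G₂ 2 (volume.restrict (Ioc (0 : ℝ) T))
  weakGradient : ∀ᵐ t ∂(volume.restrict (Ioi (0 : ℝ))), HasWeakGradient (ρ t) (G₁ t) (G₂ t)
  weak_eq : ∀ φ : ℝ × ℝ → ℝ, IsTestFunction φ → ∀ t : ℝ, 0 ≤ t →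
      (∫ z, ρ t z * φ z) - ∫ z, ρ₀ z * φ z =
        -∫ s in (0 : ℝ)..t, ∫ z,
          ((D * G₁ s z - regForceX ε (ρ s) z * ρ s z) * partialX φ z +
            (D * G₂ s z - regForceY ε (ρ s) z * ρ s z) * partialY φ z)

theorem IsRegularizedSolution.exists_gradient {D ε : ℝ} {ρ₀ : ℝ × ℝ → ℝ} {ρ : ℝ → L2Plane}
    (h : IsRegularizedSolution D ε ρ₀ ρ) : ∃ G₁ G₂, IsSolutionGradient D ε ρ₀ ρ G₁ G₂ := by
  obtain ⟨G₁, G₂, h1, h2, h3⟩ := h.weak_eq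
  exact ⟨G₁, G₂, fun T hT => (h1 T hT).1, fun T hT => (h1 T hT).2, h2, h3⟩

theorem eLpNorm_one_le_of_tendsto {u : ℕ → L2Plane} {v : L2Plane} (h : Tendsto u atTop (𝓝 v))
    {B : ℝ≥0∞} (hB : ∀ n, eLpNorm (u n) 1 ≤ B) : eLpNorm v 1 ≤ B :=
  eLpNorm_le_of_tendstoInMeasure (Eventually.of_forall hB) (tendstoInMeasure_of_tendsto_Lp h)
    fun n => Lp.aestronglyMeasurable (u n)

/-- By lower semicontinuity of the `L¹` norm in `L²`, the bound in `L^∞(0, T; L¹)` holds at all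
times. -/
theorem IsRegularizedSolution.exists_L1_bound {D ε : ℝ} {ρ₀ : ℝ × ℝ → ℝ} {ρ : ℝ → L2Plane}
    (h : IsRegularizedSolution D ε ρ₀ ρ) {T : ℝ} (hT : 0 < T) :
    ∃ B : ℝ, 0 ≤ B ∧ ∀ t ∈ Icc 0 T, Integrable (ρ t) ∧ ∫ z, |ρ t z| ≤ B := by
  obtain ⟨B, hB⟩ := h.bounded_L1 T hT
  refine ⟨B, B.2, fun t ht => ?_⟩
  have hd : Dense {x : ℝ | x ∈ Ioc 0 T → eLpNorm (ρ x) 1 volume ≤ B} :=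
    Measure.dense_of_ae ((ae_restrict_iff' measurableSet_Ioc).1 hB)
  have hcl : t ∈ closure (Ioo 0 T ∩ {x : ℝ | x ∈ Ioc 0 T → eLpNorm (ρ x) 1 volume ≤ B}) := by
    have h1 := closure_mono (hd.open_subset_closure_inter (isOpen_Ioo (a := (0 : ℝ)) (b := T)))
    rw [closure_closure, closure_Ioo hT.ne] at h1
    exact h1 ht
  obtain ⟨x, hx, hxt⟩ := mem_closure_iff_seq_limit.1 hcl
  have hρx : Tendsto (fun n => ρ (x n)) atTop (𝓝 (ρ t)) := by
    refine (h.continuousOn t ht.1).tendsto.comp ?_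
    exact tendsto_nhdsWithin_iff.2 ⟨hxt, Eventually.of_forall fun n => (hx n).1.1.le⟩
  have hb : eLpNorm (ρ t) 1 volume ≤ B :=
    eLpNorm_one_le_of_tendsto hρx fun n => (hx n).2 (Ioo_subset_Ioc_self (hx n).1)
  have hm : MemLp (ρ t) 1 volume := ⟨Lp.aestronglyMeasurable _, hb.trans_lt ENNReal.coe_lt_top⟩
  have hi : Integrable (ρ t) := memLp_one_iff_integrable.1 hm
  refine ⟨hi, ?_⟩
  rw [eLpNorm_one_eq_lintegral_enorm, ← ofReal_integral_norm_eq_lintegral_enorm hi] at hb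
  rw [← ENNReal.ofReal_coe_nnreal] at hb
  exact (ENNReal.ofReal_le_ofReal_iff B.2).1 hb

theorem IsRegularizedSolution.integrable {D ε : ℝ} {ρ₀ : ℝ × ℝ → ℝ} {ρ : ℝ → L2Plane}
    (h : IsRegularizedSolution D ε ρ₀ ρ) {t : ℝ} (ht : 0 ≤ t) : Integrable (ρ t) := by
  obtain ⟨B, -, hB⟩ := h.exists_L1_bound (T := t + 1) (by linarith)
  exact (hB t ⟨ht, by linarith⟩).1

/-- The flux `D ∂ρ - F ρ` of a solution, with the force written as a convolution with `-K`. -/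
noncomputable def flux (D : ℝ) (K : ℝ × ℝ → ℝ) (ρ G : ℝ → L2Plane) (s : ℝ) : L2Plane :=
  D • G s + convMul K (ρ s) (ρ s)

theorem IsRegularizedSolution.memLp_flux {D ε : ℝ} {ρ₀ : ℝ × ℝ → ℝ} {ρ : ℝ → L2Plane}
    (h : IsRegularizedSolution D ε ρ₀ ρ) {K : ℝ × ℝ → ℝ} {B : ℝ} (hK : Continuous K)
    (hB : ∀ z, |K z| ≤ B) {G : ℝ → L2Plane} {T : ℝ} (hT : 0 < T)
    (hG : MemLp G 2 (volume.restrict (Ioc (0 : ℝ) T))) :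
    MemLp (flux D K ρ G) 2 (volume.restrict (Ioc (0 : ℝ) T)) := by
  obtain ⟨b, hb0, hb⟩ := h.exists_L1_bound hT
  have hB0 : 0 ≤ B := (abs_nonneg _).trans (hB 0)
  have hsub : Ioc 0 T ⊆ Icc 0 T := Ioc_subset_Icc_self
  obtain ⟨c, hc⟩ := isCompact_Icc.exists_bound_of_continuousOn
    (h.continuousOn.mono (Icc_subset_Ici_self : Icc 0 T ⊆ Ici 0))
  refine (hG.const_smul D).add ?_
  refine MemLp.of_bound (aestronglyMeasurable_convMul hK hB measurableSet_Ioc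
    (h.continuousOn.mono fun s hs => hs.1.le) fun s hs => (hb s (hsub hs)).1) (B * b * c) ?_
  filter_upwards [ae_restrict_mem measurableSet_Ioc] with s hs
  refine (norm_convMul_le hK hB (hb s (hsub hs)).1 _).trans ?_
  have := (hb s (hsub hs)).2
  have := hc s (hsub hs)
  gcongr

theorem inner_flux_testL2 {D : ℝ} {K f : ℝ × ℝ → ℝ} {B : ℝ} (hK : Continuous K)
    (hB : ∀ z, |K z| ≤ B) {u g : L2Plane} (hu : Integrable u) (hf : IsTestFunction f) :
    inner ℝ (D • g + convMul K u u) (testL2 hf) = ∫ z, (D * g z + kernelConv K u z * u z) * f z ∧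
    Integrable (fun z => (D * g z + kernelConv K u z * u z) * f z) := by
  have e : (D • g + convMul K u u : L2Plane) =ᵐ[volume]
      fun z => D * g z + kernelConv K u z * u z := by
    filter_upwards [Lp.coeFn_add (D • g) (convMul K u u), Lp.coeFn_smul D g,
      coeFn_convMul hK hB hu u] with z h1 h2 h3
    rw [h1, Pi.add_apply, h2, h3, Pi.smul_apply, smul_eq_mul]
  rw [inner_testL2]
  constructor
  · refine integral_congr_ae ?_
    filter_upwards [e] with z hz
    rw [hz]
  · refine ((Lp.memLp (D • g + convMul K u u)).integrable_mul (hf.memLp 2)).congr ?_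
    filter_upwards [e] with z hz
    rw [Pi.mul_apply, hz]

theorem weak_eq_testL2 {D ε : ℝ} (hε : 0 < ε) {ρ₀ : ℝ × ℝ → ℝ} {ρ G₁ G₂ : ℝ → L2Plane}
    (h : IsRegularizedSolution D ε ρ₀ ρ) (hG : IsSolutionGradient D ε ρ₀ ρ G₁ G₂)
    {φ : ℝ × ℝ → ℝ} (hφ : IsTestFunction φ) {t : ℝ} (ht : 0 ≤ t) :
    inner ℝ (ρ t - ρ 0) (testL2 hφ) =
      -((∫ s in (0 : ℝ)..t, inner ℝ (flux D (kernelX ε) ρ G₁ s) (testL2 hφ.partialX)) +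
        ∫ s in (0 : ℝ)..t, inner ℝ (flux D (kernelY ε) ρ G₂ s) (testL2 hφ.partialY)) := by
  have cX := (contDiff_kernelX ε).continuous
  have cY := (contDiff_kernelY ε).continuous
  have bX := abs_kernelX_le hε
  have bY := abs_kernelY_le hε
  have ii : ∀ {V : ℝ → L2Plane} (u : L2Plane), (∀ T > 0, MemLp V 2 (volume.restrict (Ioc 0 T))) →
      IntervalIntegrable (fun s => inner ℝ (V s) u) volume 0 t := by
    intro V u hV
    rw [intervalIntegrable_iff_integrableOn_Ioc_of_le ht]
    have h1 := (hV (t + 1) (by linarith)).integrable (by norm_num)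
    have h2 := h1.inner_const (𝕜 := ℝ) u
    exact h2.mono_measure (Measure.restrict_mono (Ioc_subset_Ioc le_rfl (by linarith)) le_rfl)
  rw [← intervalIntegral.integral_add
    (ii _ fun T hT => h.memLp_flux cX bX hT (hG.memLp₁ T hT))
    (ii _ fun T hT => h.memLp_flux cY bY hT (hG.memLp₂ T hT))]
  have e0 : ∫ z, ρ 0 z * φ z = ∫ z, ρ₀ z * φ z :=
    integral_congr_ae (h.initial.mono fun z hz => by simp only [hz])
  rw [inner_sub_left, inner_testL2, inner_testL2, e0, hG.weak_eq φ hφ t ht]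
  congr 1
  refine intervalIntegral.integral_congr_ae (ae_of_all _ fun s hs => ?_)
  rw [uIoc_of_le ht] at hs
  have hi := h.integrable hs.1.le
  have a1 := inner_flux_testL2 (D := D) cX bX (g := G₁ s) hi hφ.partialX
  have a2 := inner_flux_testL2 (D := D) cY bY (g := G₂ s) hi hφ.partialY
  unfold flux
  rw [a1.1, a2.1, ← integral_add a1.2 a2.2]
  refine integral_congr_ae (ae_of_all _ fun z => ?_)
  simp only [regForceX_eq, regForceY_eq]
  ring

/-- The weak formulation on `[r, s]`, for test functions in `H¹`. -/
theorem weak_eq_of_hasWeakGradient {D ε : ℝ} (hε : 0 < ε) {ρ₀ : ℝ × ℝ → ℝ} {ρ G₁ G₂ : ℝ → L2Plane}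
    (h : IsRegularizedSolution D ε ρ₀ ρ) (hG : IsSolutionGradient D ε ρ₀ ρ G₁ G₂)
    {u g₁ g₂ : L2Plane} (hu : HasWeakGradient u g₁ g₂) {r s : ℝ} (hr : 0 ≤ r) (hrs : r ≤ s) :
    inner ℝ (ρ s - ρ r) u =
      -((∫ q in r..s, inner ℝ (flux D (kernelX ε) ρ G₁ q) g₁) +
        ∫ q in r..s, inner ℝ (flux D (kernelY ε) ρ G₂ q) g₂) := by
  have hs : 0 ≤ s := hr.trans hrs
  have mX : ∀ T > 0, MemLp (flux D (kernelX ε) ρ G₁) 2 (volume.restrict (Ioc 0 T)) := fun T hT =>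
    h.memLp_flux (contDiff_kernelX ε).continuous (abs_kernelX_le hε) hT (hG.memLp₁ T hT)
  have mY : ∀ T > 0, MemLp (flux D (kernelY ε) ρ G₂) 2 (volume.restrict (Ioc 0 T)) := fun T hT =>
    h.memLp_flux (contDiff_kernelY ε).continuous (abs_kernelY_le hε) hT (hG.memLp₂ T hT)
  have ii : ∀ {V : ℝ → L2Plane}, (∀ T > 0, MemLp V 2 (volume.restrict (Ioc 0 T))) →
      ∀ t, 0 ≤ t → IntervalIntegrable V volume 0 t := by
    intro V hV t ht
    rw [intervalIntegrable_iff_integrableOn_Ioc_of_le ht]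
    have h1 := (hV (t + 1) (by linarith)).integrable (by norm_num)
    exact h1.mono_measure (Measure.restrict_mono (Ioc_subset_Ioc le_rfl (by linarith)) le_rfl)
  have iirs : ∀ {V : ℝ → L2Plane}, (∀ T > 0, MemLp V 2 (volume.restrict (Ioc 0 T))) →
      IntervalIntegrable V volume r s := fun hV => (ii hV r hr).symm.trans (ii hV s hs)
  have pull : ∀ {V : ℝ → L2Plane}, (∀ T > 0, MemLp V 2 (volume.restrict (Ioc 0 T))) →
      ∀ g, ∫ q in r..s, inner ℝ (V q) g = inner ℝ (∫ q in r..s, V q) g := by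
    intro V hV g
    rw [intervalIntegral.integral_of_le hrs, intervalIntegral.integral_of_le hrs,
      real_inner_comm, ← integral_inner (iirs hV).1]
    simp only [real_inner_comm]
  obtain ⟨φ, hφ, l0, l1, l2⟩ := hu.exists_testL2_seq
  have key : ∀ n, inner ℝ (ρ s - ρ r) (testL2 (hφ n)) =
      -(inner ℝ (∫ q in r..s, flux D (kernelX ε) ρ G₁ q) (testL2 (hφ n).partialX) +
        inner ℝ (∫ q in r..s, flux D (kernelY ε) ρ G₂ q) (testL2 (hφ n).partialY)) := by
    intro n
    have w1 := weak_eq_testL2 hε h hG (hφ n) hs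
    have w2 := weak_eq_testL2 hε h hG (hφ n) hr
    have e : ρ s - ρ r = (ρ s - ρ 0) - (ρ r - ρ 0) := by abel
    rw [e, inner_sub_left, w1, w2, ← pull mX, ← pull mY]
    have sub : ∀ {V : ℝ → L2Plane}, (∀ T > 0, MemLp V 2 (volume.restrict (Ioc 0 T))) →
        ∀ g, (∫ q in (0 : ℝ)..s, inner ℝ (V q) g) - ∫ q in (0 : ℝ)..r, inner ℝ (V q) g =
          ∫ q in r..s, inner ℝ (V q) g := by
      intro V hV g
      have j : ∀ t, 0 ≤ t → IntervalIntegrable (fun q => inner ℝ (V q) g) volume 0 t := by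
        intro t ht
        have := ii hV t ht
        rw [intervalIntegrable_iff_integrableOn_Ioc_of_le ht] at this ⊢
        exact Integrable.inner_const (𝕜 := ℝ) this g
      exact intervalIntegral.integral_interval_sub_left (j s hs) (j r hr)
    have s1 := sub mX (testL2 (hφ n).partialX)
    have s2 := sub mY (testL2 (hφ n).partialY)
    linarith
  rw [pull mX, pull mY]
  have t1 := (tendsto_const_nhds (x := ρ s - ρ r)).inner (𝕜 := ℝ) l0
  have t2 := (((tendsto_const_nhds (x := ∫ q in r..s, flux D (kernelX ε) ρ G₁ q)).inner (𝕜 := ℝ) l1).add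
    ((tendsto_const_nhds (x := ∫ q in r..s, flux D (kernelY ε) ρ G₂ q)).inner (𝕜 := ℝ) l2)).neg
  exact tendsto_nhds_unique t1 (t2.congr fun n => (key n).symm)

/-! ### Convex entropies -/

/-- The primitive of `h` vanishing at `0`. -/
noncomputable def prim (h : ℝ → ℝ) (s : ℝ) : ℝ := ∫ x in (0 : ℝ)..s, h x

/-- The entropy with second derivative `h`, vanishing to second order at `0`. -/
noncomputable def entropy (h : ℝ → ℝ) : ℝ → ℝ := prim (prim h)

/-- The Legendre-type transform `s H'(s) - H(s)` of the entropy `H`; its derivative is `s H''(s)`. -/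
noncomputable def entropyDual (h : ℝ → ℝ) (s : ℝ) : ℝ := s * prim h s - entropy h s

section Entropy

variable {h : ℝ → ℝ}

theorem prim_zero : prim h 0 = 0 := by simp [prim]

theorem hasDerivAt_prim (hc : Continuous h) (s : ℝ) : HasDerivAt (prim h) (h s) s :=
  intervalIntegral.integral_hasDerivAt_right (hc.intervalIntegrable _ _)
    (hc.stronglyMeasurableAtFilter _ _) hc.continuousAt

theorem continuous_prim (hc : Continuous h) : Continuous (prim h) :=
  continuous_iff_continuousAt.2 fun s => (hasDerivAt_prim hc s).continuousAt

theorem hasDerivAt_entropy (hc : Continuous h) (s : ℝ) : HasDerivAt (entropy h) (prim h s) s :=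
  hasDerivAt_prim (continuous_prim hc) s

theorem continuous_entropy (hc : Continuous h) : Continuous (entropy h) :=
  continuous_prim (continuous_prim hc)

theorem hasDerivAt_entropyDual (hc : Continuous h) (s : ℝ) :
    HasDerivAt (entropyDual h) (s * h s) s := by
  refine (((hasDerivAt_id s).mul (hasDerivAt_prim hc s)).sub
    (hasDerivAt_entropy hc s)).congr_deriv ?_
  simp

theorem entropyDual_zero : entropyDual h 0 = 0 := by simp [entropyDual, entropy, prim_zero]

theorem abs_prim_le {C : ℝ} (hC : ∀ s, |h s| ≤ C) (s : ℝ) : |prim h s| ≤ C * |s| := by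
  have := intervalIntegral.norm_integral_le_of_norm_le_const (a := 0) (b := s) (f := h) (C := C)
    fun x _ => hC x
  simpa [prim] using this

theorem monotone_prim (hc : Continuous h) (h0 : ∀ s, 0 ≤ h s) : Monotone (prim h) :=
  monotone_of_hasDerivAt_nonneg (fun s => hasDerivAt_prim hc s) h0

theorem entropy_sub_le (hc : Continuous h) (h0 : ∀ s, 0 ≤ h s) (a b : ℝ) :
    entropy h a - entropy h b ≤ prim h a * (a - b) := by
  have e : entropy h a - entropy h b = ∫ x in b..a, prim h x := by
    have ii : ∀ x y, IntervalIntegrable (prim h) volume x y :=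
      fun x y => (continuous_prim hc).intervalIntegrable x y
    have := intervalIntegral.integral_add_adjacent_intervals (ii 0 b) (ii b a)
    exact sub_eq_of_eq_add' this.symm
  have m := monotone_prim hc h0
  rw [e]
  rcases le_total b a with hab | hab
  · have := intervalIntegral.integral_mono_on (μ := volume) hab ((continuous_prim hc).intervalIntegrable b a)
      (intervalIntegrable_const (c := prim h a)) fun x hx => m hx.2
    rw [intervalIntegral.integral_const, smul_eq_mul] at this
    linarith
  · have := intervalIntegral.integral_mono_on (μ := volume) hab (intervalIntegrable_const (c := prim h a))
      ((continuous_prim hc).intervalIntegrable a b) fun x hx => m hx.1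
    rw [intervalIntegral.integral_const, smul_eq_mul] at this
    rw [intervalIntegral.integral_symm]
    linarith

theorem entropy_zero : entropy h 0 = 0 := prim_zero

theorem entropy_nonneg (hc : Continuous h) (h0 : ∀ s, 0 ≤ h s) (s : ℝ) : 0 ≤ entropy h s := by
  have := entropy_sub_le hc h0 0 s
  rw [entropy_zero, prim_zero] at this
  linarith

theorem entropyDual_nonneg (hc : Continuous h) (h0 : ∀ s, 0 ≤ h s) (s : ℝ) :
    0 ≤ entropyDual h s := by
  have := entropy_sub_le hc h0 s 0
  rw [entropy_zero] at this
  unfold entropyDual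
  linarith

theorem entropyDual_le (hc : Continuous h) (h0 : ∀ s, 0 ≤ h s) {C : ℝ} (hC : ∀ s, |h s| ≤ C)
    (s : ℝ) : entropyDual h s ≤ C * s ^ 2 := by
  have h1 := entropy_nonneg hc h0 s
  have h2 := abs_prim_le hC s
  have h3 : s * prim h s ≤ |s| * (C * |s|) := by
    refine (le_abs_self _).trans ?_
    rw [abs_mul]
    gcongr
  have h4 : |s| * |s| = s ^ 2 := by rw [← sq, sq_abs]
  have h5 : |s| * (C * |s|) = C * s ^ 2 := by rw [← h4]; ring
  unfold entropyDual
  linarith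

theorem entropy_le (hc : Continuous h) (h0 : ∀ s, 0 ≤ h s) {C : ℝ} (hC : ∀ s, |h s| ≤ C)
    (s : ℝ) : entropy h s ≤ C * s ^ 2 := by
  have h1 := entropyDual_nonneg hc h0 s
  have h2 := abs_prim_le hC s
  have h3 : s * prim h s ≤ |s| * (C * |s|) := by
    refine (le_abs_self _).trans ?_
    rw [abs_mul]
    gcongr
  have h4 : |s| * |s| = s ^ 2 := by rw [← sq, sq_abs]
  have h5 : |s| * (C * |s|) = C * s ^ 2 := by rw [← h4]; ring
  unfold entropyDual at h1
  linarith

theorem abs_entropy_sub_le (hc : Continuous h) (h0 : ∀ s, 0 ≤ h s) {C : ℝ} (hC : ∀ s, |h s| ≤ C)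
    (a b : ℝ) : |entropy h a - entropy h b| ≤ C * ((|a| + |b|) * |a - b|) := by
  have hC0 : 0 ≤ C := (abs_nonneg _).trans (hC 0)
  have key : ∀ a b : ℝ, entropy h a - entropy h b ≤ C * (|a| * |a - b|) := by
    intro a b
    refine (entropy_sub_le hc h0 a b).trans ((le_abs_self _).trans ?_)
    rw [abs_mul, ← mul_assoc]
    gcongr
    exact abs_prim_le hC a
  have h1 := key a b
  have h2 := key b a
  rw [abs_sub_comm b a] at h2
  have h3 : 0 ≤ C * (|a| * |a - b|) := by positivity
  have h4 : 0 ≤ C * (|b| * |a - b|) := by positivity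
  rw [abs_le]
  constructor <;> nlinarith

theorem integrable_comp_of_le_sq {f : ℝ → ℝ} (hf : Continuous f) {C : ℝ}
    (hC : ∀ s, |f s| ≤ C * s ^ 2) (u : L2Plane) : Integrable (fun z => f (u z)) := by
  refine ((Lp.memLp u).integrable_sq.const_mul C).mono'
    (hf.comp_aestronglyMeasurable (Lp.aestronglyMeasurable u)) (ae_of_all _ fun z => ?_)
  exact hC _

theorem continuous_entropyDual (hc : Continuous h) : Continuous (entropyDual h) :=
  continuous_iff_continuousAt.2 fun s => (hasDerivAt_entropyDual hc s).continuousAt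

theorem integrable_entropy (hc : Continuous h) (h0 : ∀ s, 0 ≤ h s) {C : ℝ} (hC : ∀ s, |h s| ≤ C)
    (u : L2Plane) : Integrable (fun z => entropy h (u z)) :=
  integrable_comp_of_le_sq (continuous_entropy hc) (C := C) (fun s => by
    rw [abs_of_nonneg (entropy_nonneg hc h0 s)]; exact entropy_le hc h0 hC s) u

theorem integrable_entropyDual (hc : Continuous h) (h0 : ∀ s, 0 ≤ h s) {C : ℝ}
    (hC : ∀ s, |h s| ≤ C) (u : L2Plane) : Integrable (fun z => entropyDual h (u z)) :=
  integrable_comp_of_le_sq (continuous_entropyDual hc) (C := C) (fun s => by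
    rw [abs_of_nonneg (entropyDual_nonneg hc h0 s)]; exact entropyDual_le hc h0 hC s) u

theorem continuous_integral_entropy (hc : Continuous h) (h0 : ∀ s, 0 ≤ h s) {C : ℝ}
    (hC : ∀ s, |h s| ≤ C) : Continuous fun u : L2Plane => ∫ z, entropy h (u z) := by
  rw [continuous_iff_continuousAt]
  intro v
  have bd : ∀ u : L2Plane, ‖(∫ z, entropy h (u z)) - ∫ z, entropy h (v z)‖ ≤
      C * ((‖u‖ + ‖v‖) * ‖u - v‖) := by
    intro u
    have hC0 : 0 ≤ C := (abs_nonneg _).trans (hC 0)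
    rw [← integral_sub (integrable_entropy hc h0 hC u) (integrable_entropy hc h0 hC v)]
    have hi := (l2_integrable_mul (absL2 u + absL2 v) (absL2 (u - v))).const_mul C
    have e : ∀ᵐ z, (absL2 u + absL2 v : L2Plane) z * absL2 (u - v) z =
        (|u z| + |v z|) * |u z - v z| := by
      filter_upwards [Lp.coeFn_add (absL2 u) (absL2 v), coeFn_absL2 u, coeFn_absL2 v,
        coeFn_absL2 (u - v), Lp.coeFn_sub u v] with z h1 h2 h3 h4 h5
      rw [h1, Pi.add_apply, h2, h3, h4, h5, Pi.sub_apply]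
    refine (norm_integral_le_of_norm_le hi ?_).trans ?_
    · filter_upwards [e] with z hz
      rw [hz]
      exact abs_entropy_sub_le hc h0 hC _ _
    · rw [integral_const_mul, ← l2_inner_eq]
      refine mul_le_mul_of_nonneg_left ((real_inner_le_norm _ _).trans ?_) hC0
      rw [norm_absL2]
      gcongr
      refine (norm_add_le _ _).trans ?_
      rw [norm_absL2, norm_absL2]
  refine tendsto_iff_norm_sub_tendsto_zero.2 (squeeze_zero (fun _ => norm_nonneg _) bd ?_)
  have : Continuous fun u : L2Plane => C * ((‖u‖ + ‖v‖) * ‖u - v‖) := by fun_prop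
  have := this.tendsto v
  simpa using this

end Entropy

/-! ### The energy inequality -/

/-- The integrand of the energy inequality for the entropy with second derivative `h`: minus the
dissipation plus the contribution of the drift. -/
noncomputable def energyRate (D ε : ℝ) (h : ℝ → ℝ) (u g₁ g₂ : L2Plane) : ℝ :=
  -D * (∫ z, h (u z) * (g₁ z ^ 2 + g₂ z ^ 2)) +
    4 * interaction ε (fun z => entropyDual h (u z)) u

theorem inner_add_convMul_nemMul {D : ℝ} {K : ℝ × ℝ → ℝ} {B : ℝ} (hK : Continuous K)
    (hB : ∀ z, |K z| ≤ B) {u : L2Plane} (g : L2Plane) (hu : Integrable u) (h η : ℝ →ᵇ ℝ)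
    (hη : ∀ s, η s = s * h s) :
    inner ℝ (D • g + convMul K u u) (nemMul h u g) =
      D * (∫ z, h (u z) * g z ^ 2) + ∫ z, nemMul η u g z * kernelConv K u z := by
  rw [inner_add_left, inner_smul_left, l2_inner_eq, l2_inner_eq]
  congr 1
  · simp only [conj_trivial]
    congr 1
    refine integral_congr_ae ?_
    filter_upwards [coeFn_nemMul h u g] with z hz
    rw [hz]; ring
  · refine integral_congr_ae ?_
    filter_upwards [coeFn_nemMul h u g, coeFn_nemMul η u g, coeFn_convMul hK hB hu u]
      with z h1 h2 h3
    rw [h1, h2, h3, hη]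
    ring

theorem integrable_mul_sq (h : ℝ →ᵇ ℝ) (u g : L2Plane) :
    Integrable (fun z => h (u z) * g z ^ 2) := by
  refine (l2_integrable_mul (nemMul h u g) g).congr ?_
  filter_upwards [coeFn_nemMul h u g] with z hz
  rw [hz]; ring

/-- The flux paired with `-h(u) ∇u = -∇H'(u)`; for the drift part `u h(u) ∇u = ∇Ψ(u)` is integrated
by parts against the force. -/
theorem neg_inner_flux_eq_energyRate {D ε : ℝ} (hε : 0 < ε) {u g₁ g₂ : L2Plane}
    (hg : HasWeakGradient u g₁ g₂) (hu : Integrable u) (h η : ℝ →ᵇ ℝ) (hη : ∀ s, η s = s * h s)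
    (h0 : ∀ s, 0 ≤ h s) :
    inner ℝ (-(D • g₁ + convMul (kernelX ε) u u)) (nemMul h u g₁) +
      inner ℝ (-(D • g₂ + convMul (kernelY ε) u u)) (nemMul h u g₂) =
      energyRate D ε h u g₁ g₂ := by
  have hc := h.continuous
  rw [inner_neg_left, inner_neg_left,
    inner_add_convMul_nemMul (contDiff_kernelX ε).continuous (abs_kernelX_le hε) g₁ hu h η hη,
    inner_add_convMul_nemMul (contDiff_kernelY ε).continuous (abs_kernelY_le hε) g₂ hu h η hη]
  have hΨ : ∀ s, HasDerivAt (entropyDual h) (η s) s := fun s => by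
    rw [hη]; exact hasDerivAt_entropyDual hc s
  have hw := hg.comp η hΨ entropyDual_zero
  have hi : Integrable (fun z => entropyDual h (u z)) :=
    integrable_entropyDual hc h0 (C := ‖h‖) (fun s => h.norm_coe_le_norm s) u
  have ee := (lipschitzWith_of_hasDerivAt η hΨ).coeFn_compLp entropyDual_zero u
  have iw : ∀ g : L2Plane, Integrable (nemMul η u g) := by
    intro g
    refine (l2_integrable_mul u (nemMul h u g)).congr ?_
    filter_upwards [coeFn_nemMul h u g, coeFn_nemMul η u g] with z h1 h2
    rw [h1, h2, hη]; ring
  have key := integral_mul_regForce hε (hw.congr_ae ee (ae_eq_refl _) (ae_eq_refl _)) hi (iw g₁)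
    (iw g₂) hu
  simp only [regForceX_eq, regForceY_eq, mul_neg, integral_neg] at key
  have e2 : ∫ z, h (u z) * (g₁ z ^ 2 + g₂ z ^ 2) =
      (∫ z, h (u z) * g₁ z ^ 2) + ∫ z, h (u z) * g₂ z ^ 2 := by
    rw [← integral_add (integrable_mul_sq h u g₁) (integrable_mul_sq h u g₂)]
    simp only [mul_add]
  unfold energyRate
  rw [e2]
  have key' : 4 * interaction ε (fun z => entropyDual h (u z)) u =
      -(∫ z, nemMul η u g₁ z * kernelConv (kernelX ε) u z) +
        -∫ z, nemMul η u g₂ z * kernelConv (kernelY ε) u z := key.symm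
  rw [key']
  ring

/-- **Energy inequality.** For a convex entropy `H` with compactly supported second derivative `h`,
the increment of `∫ H(ρ)` is at most the integral of `-D ∫ h(ρ) |∇ρ|² - ∫ Ψ(ρ) div F`, where
`Ψ = s H' - H` and `div F = -4 δ^(ε) * ρ`. -/
theorem energy_inequality {D ε : ℝ} (hε : 0 < ε) {ρ₀ : ℝ × ℝ → ℝ} {ρ G₁ G₂ : ℝ → L2Plane}
    (hρ : IsRegularizedSolution D ε ρ₀ ρ) (hG : IsSolutionGradient D ε ρ₀ ρ G₁ G₂)
    {h : ℝ → ℝ} (hc : Continuous h) (hs : HasCompactSupport h) (h0 : ∀ s, 0 ≤ h s)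
    {a b : ℝ} (ha : 0 ≤ a) (hab : a ≤ b) :
    IntegrableOn (fun s => energyRate D ε h (ρ s) (G₁ s) (G₂ s)) (Ioc a b) ∧
    (∫ z, entropy h (ρ b z)) - ∫ z, entropy h (ρ a z) ≤
      ∫ s in Ioc a b, energyRate D ε h (ρ s) (G₁ s) (G₂ s) := by
  rcases hab.eq_or_lt with rfl | hab
  · simp
  have hs' : HasCompactSupport fun s => s * h s := hs.mul_left
  let hb : ℝ →ᵇ ℝ := ofCompactSupport h hc hs
  let η : ℝ →ᵇ ℝ := ofCompactSupport (fun s => s * h s) (continuous_id.mul hc) hs'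
  have hη : ∀ s, η s = s * hb s := fun s => rfl
  have hb0 : 0 < b := ha.trans_lt hab
  have sub : Ioc a b ⊆ Ioc 0 b := Ioc_subset_Ioc ha le_rfl
  have mono : ∀ {V : ℝ → L2Plane}, MemLp V 2 (volume.restrict (Ioc 0 b)) →
      MemLp V 2 (volume.restrict (Ioc a b)) := fun hV =>
    hV.mono_measure (Measure.restrict_mono sub le_rfl)
  have mV₁ := (mono (hρ.memLp_flux (contDiff_kernelX ε).continuous (abs_kernelX_le hε) hb0
    (hG.memLp₁ b hb0))).neg
  have mV₂ := (mono (hρ.memLp_flux (contDiff_kernelY ε).continuous (abs_kernelY_le hε) hb0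
    (hG.memLp₂ b hb0))).neg
  have mρ : AEStronglyMeasurable ρ (volume.restrict (Ioc a b)) :=
    (hρ.continuousOn.mono fun s hs => (ha.trans_lt hs.1).le).aestronglyMeasurable measurableSet_Ioc
  have mW : ∀ {G : ℝ → L2Plane}, MemLp G 2 (volume.restrict (Ioc a b)) →
      MemLp (fun s => nemMul hb (ρ s) (G s)) 2 (volume.restrict (Ioc a b)) := fun {G} hG =>
    hG.of_le_mul (c := ‖hb‖) ((continuous_nemMul hb).comp_aestronglyMeasurable (mρ.prodMk hG.1))
      (ae_of_all _ fun s => norm_nemMul_le _ _ _)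
  have mW₁ := mW (mono (hG.memLp₁ b hb0))
  have mW₂ := mW (mono (hG.memLp₂ b hb0))
  have hwg : ∀ᵐ s ∂(volume.restrict (Ioc a b)), HasWeakGradient (ρ s) (G₁ s) (G₂ s) :=
    ae_restrict_of_ae_restrict_of_subset (fun s hs => ha.trans_lt hs.1) hG.weakGradient
  have hrate : ∀ᵐ s ∂(volume.restrict (Ioc a b)),
      inner ℝ (-flux D (kernelX ε) ρ G₁ s) (nemMul hb (ρ s) (G₁ s)) +
        inner ℝ (-flux D (kernelY ε) ρ G₂ s) (nemMul hb (ρ s) (G₂ s)) =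
      energyRate D ε h (ρ s) (G₁ s) (G₂ s) := by
    filter_upwards [hwg, ae_restrict_mem measurableSet_Ioc] with s h1 h2
    exact neg_inner_flux_eq_energyRate hε h1 (hρ.integrable (ha.trans h2.1.le)) hb η hη h0
  have hbC : ∀ s, |h s| ≤ ‖hb‖ := fun s => hb.norm_coe_le_norm s
  refine ⟨?_, ?_⟩
  · refine Integrable.congr ?_ hrate
    exact (integrable_inner_of_memLp mV₁ mW₁).add (integrable_inner_of_memLp mV₂ mW₂)
  rw [← integral_congr_ae hrate]
  refine increment_le_integral_inner (E := fun t => ∫ z, entropy h (ρ t z)) hab mV₁ mV₂ mW₁ mW₂ ?_ ?_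
  · exact (continuous_integral_entropy hc h0 hbC).comp_continuousOn
      (hρ.continuousOn.mono fun s hs => ha.trans hs.1)
  · filter_upwards [hwg, ae_restrict_mem measurableSet_Ioc] with s h1 h2 r hr
    have hΦ : ∀ x, HasDerivAt (prim h) (hb x) x := fun x => hasDerivAt_prim hc x
    have hw := h1.comp hb hΦ prim_zero
    have key := weak_eq_of_hasWeakGradient hε hρ hG hw (ha.trans hr.1) hr.2
    simp only [inner_neg_left, intervalIntegral.integral_neg]
    rw [← neg_add, ← key]
    have i1 := integrable_entropy hc h0 hbC (ρ s)
    have i2 := integrable_entropy hc h0 hbC (ρ r)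
    rw [← integral_sub i1 i2, l2_inner_eq]
    refine integral_mono_ae (i1.sub i2) (l2_integrable_mul _ _) ?_
    filter_upwards [(lipschitzWith_of_hasDerivAt hb hΦ).coeFn_compLp prim_zero (ρ s),
      Lp.coeFn_sub (ρ s) (ρ r)] with z h3 h4
    rw [h3, h4, Pi.sub_apply, Function.comp_apply, mul_comm]
    exact entropy_sub_le hc h0 _ _

/-! ### Comparison of entropies -/

section Comparison

variable {h g : ℝ → ℝ}

theorem prim_mono (hc : Continuous h) (gc : Continuous g) {s : ℝ} (hs : 0 ≤ s)
    (hle : ∀ x ∈ Icc 0 s, h x ≤ g x) : prim h s ≤ prim g s :=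
  intervalIntegral.integral_mono_on hs (hc.intervalIntegrable _ _) (gc.intervalIntegrable _ _) hle

theorem entropy_mono (hc : Continuous h) (gc : Continuous g) {s : ℝ} (hs : 0 ≤ s)
    (hle : ∀ x ∈ Icc 0 s, h x ≤ g x) : entropy h s ≤ entropy g s :=
  prim_mono (continuous_prim hc) (continuous_prim gc) hs fun _ hx =>
    prim_mono hc gc hx.1 fun y hy => hle y ⟨hy.1, hy.2.trans hx.2⟩

theorem prim_congr {s : ℝ} (hs : 0 ≤ s) (heq : ∀ x ∈ Icc 0 s, h x = g x) :
    prim h s = prim g s :=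
  intervalIntegral.integral_congr fun x hx => heq x (by rwa [uIcc_of_le hs] at hx)

theorem entropy_congr {s : ℝ} (hs : 0 ≤ s) (heq : ∀ x ∈ Icc 0 s, h x = g x) :
    entropy h s = entropy g s :=
  prim_congr hs fun _ hx => prim_congr hx.1 fun y hy => heq y ⟨hy.1, hy.2.trans hx.2⟩

theorem prim_pow (n : ℕ) (s : ℝ) : prim (fun x => x ^ n) s = s ^ (n + 1) / (n + 1) := by
  simp [prim]

theorem entropy_pow (n : ℕ) (s : ℝ) :
    entropy (fun x => x ^ n) s = s ^ (n + 2) / ((n + 1) * (n + 2)) := by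
  have e : prim (fun x : ℝ => x ^ n) = fun x => x ^ (n + 1) / ((n : ℝ) + 1) := by
    ext x; exact prim_pow n x
  rw [entropy, e, prim, intervalIntegral.integral_div]
  have := prim_pow (n + 1) s
  rw [prim] at this
  rw [this, div_div]
  push_cast
  congr 1
  ring

theorem monotoneOn_entropy (hc : Continuous h) (h0 : ∀ s, 0 ≤ h s) :
    MonotoneOn (entropy h) (Ici 0) := by
  refine monotoneOn_of_hasDerivWithinAt_nonneg (convex_Ici 0) (continuous_entropy hc).continuousOn
    (fun x _ => (hasDerivAt_entropy hc x).hasDerivWithinAt) fun x hx => ?_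
  rw [interior_Ici] at hx
  simpa [prim_zero] using monotone_prim hc h0 hx.le

theorem prim_comp_neg (s : ℝ) : prim (fun x => h (-x)) s = -prim h (-s) := by
  rw [prim, intervalIntegral.integral_comp_neg (fun x => h x), neg_zero,
    intervalIntegral.integral_symm]
  rfl

theorem entropy_comp_neg (s : ℝ) : entropy (fun x => h (-x)) s = entropy h (-s) := by
  have e : prim (fun x => h (-x)) = fun s => -prim h (-s) := funext prim_comp_neg
  rw [entropy, e]
  have := prim_comp_neg (h := prim h) s
  simp only [prim] at this ⊢
  rw [intervalIntegral.integral_neg, this, neg_neg]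
  rfl

theorem entropyDual_comp_neg (s : ℝ) : entropyDual (fun x => h (-x)) s = entropyDual h (-s) := by
  rw [entropyDual, entropyDual, entropy_comp_neg, prim_comp_neg]
  ring

/-- If the density `h` vanishes on the negative axis and grows at most like `s ^ n` along rays, then
`Ψ = s H' - H` is controlled by `(n + 1) H`. -/
theorem entropyDual_le_entropy (hc : Continuous h) (n : ℕ) (hneg : ∀ s ≤ 0, h s = 0)
    (hscale : ∀ l ∈ Icc (0 : ℝ) 1, ∀ s, 0 ≤ s → l ^ n * h s ≤ h (l * s)) (s : ℝ) :
    entropyDual h s ≤ (n + 1) * entropy h s := by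
  rcases le_total s 0 with hs | hs
  · have h1 : ∀ s ≤ 0, prim h s = 0 := fun s hs => by
      rw [prim, intervalIntegral.integral_congr (g := fun _ => 0), intervalIntegral.integral_zero]
      intro x hx
      rw [uIcc_of_ge hs] at hx
      exact hneg x hx.2
    have h2 : entropy h s = 0 := by
      rw [entropy, prim, intervalIntegral.integral_congr (g := fun _ => 0),
        intervalIntegral.integral_zero]
      intro x hx
      rw [uIcc_of_ge hs] at hx
      exact h1 x hx.2
    simp [entropyDual, h1 s hs, h2]
  · have key : ∀ s, 0 < s → s * h s ≤ (n + 1) * prim h s := by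
      intro s hs
      have h1 : prim (fun x => h s / s ^ n * x ^ n) s ≤ prim h s := by
        refine prim_mono (by fun_prop) hc hs.le fun x hx => ?_
        have := hscale (x / s) ⟨div_nonneg hx.1 hs.le, (div_le_one hs).2 hx.2⟩ s hs.le
        rw [div_mul_cancel₀ _ hs.ne', div_pow] at this
        calc h s / s ^ n * x ^ n = x ^ n / s ^ n * h s := by ring
          _ ≤ h x := this
      have h2 : prim (fun x => h s / s ^ n * x ^ n) s = s * h s / (n + 1) := by
        rw [prim, intervalIntegral.integral_const_mul]
        have := prim_pow n s
        rw [prim] at this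
        rw [this]
        field_simp
        ring
      rw [h2, div_le_iff₀ (by positivity)] at h1
      linarith
    have hm : MonotoneOn (fun s => (n + 1) * entropy h s - entropyDual h s) (Ici 0) := by
      refine monotoneOn_of_hasDerivWithinAt_nonneg
        (f' := fun s => (n + 1) * prim h s - s * h s) (convex_Ici 0) ?_
        (fun x _ => (((hasDerivAt_entropy hc x).const_mul ((n : ℝ) + 1)).sub
          (hasDerivAt_entropyDual hc x)).hasDerivWithinAt) fun x hx => ?_
      · exact ((continuous_const.mul (continuous_entropy hc)).sub
          (continuous_entropyDual hc)).continuousOn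
      · rw [interior_Ici] at hx
        exact sub_nonneg.2 (key x hx)
    have := hm (mem_Ici.2 le_rfl) (mem_Ici.2 hs) hs
    simp only [entropy_zero, entropyDual_zero, mul_zero, sub_zero] at this
    linarith

end Comparison

/-- The tent function on `[0, 2R]`, equal to the identity on `[0, R]`. -/
noncomputable def tent (R s : ℝ) : ℝ := max 0 (min s (2 * R - s))

theorem continuous_tent (R : ℝ) : Continuous (tent R) := by unfold tent; fun_prop

theorem tent_nonneg (R s : ℝ) : 0 ≤ tent R s := le_max_left _ _

theorem tent_of_nonpos {R s : ℝ} (hs : s ≤ 0) : tent R s = 0 :=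
  max_eq_left ((min_le_left _ _).trans hs)

theorem tent_le {R s : ℝ} (hs : 0 ≤ s) : tent R s ≤ s := max_le hs (min_le_left _ _)

theorem tent_eq {R s : ℝ} (hs : 0 ≤ s) (hR : s ≤ R) : tent R s = s := by
  rw [tent, min_eq_left (by linarith), max_eq_right hs]

theorem hasCompactSupport_tent (R : ℝ) : HasCompactSupport (tent R) := by
  refine HasCompactSupport.intro (isCompact_Icc (a := 0) (b := 2 * R)) fun s hs => ?_
  refine max_eq_left ?_
  rw [mem_Icc, not_and_or, not_le, not_le] at hs
  rcases hs with hs | hs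
  · exact (min_le_left _ _).trans hs.le
  · exact (min_le_right _ _).trans (by linarith)

theorem mul_tent_le {R l : ℝ} (hR : 0 ≤ R) (hl : l ∈ Icc (0 : ℝ) 1) (s : ℝ) :
    l * tent R s ≤ tent R (l * s) := by
  unfold tent
  rw [mul_max_of_nonneg _ _ hl.1, mul_zero, mul_min_of_nonneg _ _ hl.1]
  refine max_le_max le_rfl (min_le_min le_rfl ?_)
  nlinarith [hl.2, mul_nonneg (sub_nonneg.2 hl.2) hR]

/-- Powers of tents: densities of entropies behaving like `s ^ (n + 2)` on `[0, R]`. -/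
noncomputable def tentPow (R : ℝ) (n : ℕ) (s : ℝ) : ℝ := tent R s ^ (n + 1)

theorem continuous_tentPow (R : ℝ) (n : ℕ) : Continuous (tentPow R n) :=
  (continuous_tent R).pow _

theorem tentPow_nonneg (R : ℝ) (n : ℕ) (s : ℝ) : 0 ≤ tentPow R n s := pow_nonneg (tent_nonneg R s) _

theorem hasCompactSupport_tentPow (R : ℝ) (n : ℕ) : HasCompactSupport (tentPow R n) :=
  (hasCompactSupport_tent R).comp_left (g := fun x => x ^ (n + 1)) (by simp)

theorem entropyDual_tentPow_le {R : ℝ} (hR : 0 ≤ R) (n : ℕ) (s : ℝ) :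
    entropyDual (tentPow R n) s ≤ (n + 2) * entropy (tentPow R n) s := by
  have := entropyDual_le_entropy (continuous_tentPow R n) (n + 1)
    (fun s hs => by simp [tentPow, tent_of_nonpos hs]) (fun l hl s _ => by
      unfold tentPow
      rw [← mul_pow]
      exact pow_le_pow_left₀ (mul_nonneg hl.1 (tent_nonneg _ _)) (mul_tent_le hR hl s) _) s
  push_cast at this
  linarith

theorem entropy_tentPow_le (R : ℝ) (n : ℕ) {s : ℝ} (hs : 0 ≤ s) :
    entropy (tentPow R n) s ≤ s ^ (n + 3) / ((n + 2) * (n + 3)) := by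
  have := entropy_mono (continuous_tentPow R n) (continuous_pow (n + 1)) hs fun x hx =>
    pow_le_pow_left₀ (tent_nonneg R x) (tent_le hx.1) _
  refine this.trans (le_of_eq ?_)
  have := entropy_pow (n + 1) s
  push_cast at this
  rw [this]
  congr 1
  ring

theorem le_entropy_tentPow {R : ℝ} (n : ℕ) {s : ℝ} (hR : 0 ≤ R) (hs : R ≤ s) :
    R ^ (n + 3) / ((n + 2) * (n + 3)) ≤ entropy (tentPow R n) s := by
  have h1 := entropy_congr (h := tentPow R n) (g := fun x => x ^ (n + 1)) hR fun x hx => by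
    rw [tentPow, tent_eq hx.1 hx.2]
  have h2 := monotoneOn_entropy (continuous_tentPow R n) (tentPow_nonneg R n) (mem_Ici.2 hR)
    (mem_Ici.2 (hR.trans hs)) hs
  refine le_trans (le_of_eq ?_) h2
  have := entropy_pow (n + 1) R
  push_cast at this
  rw [h1, this]
  congr 1
  ring

/-! ### Grönwall's lemma and propagation of entropy bounds -/

theorem gronwall_integral {E : ℝ → ℝ} (hE : ContinuousOn E (Ici 0)) {C T : ℝ} (hC : 0 ≤ C)
    (h : ∀ t ∈ Icc 0 T, E t ≤ E 0 + C * ∫ s in (0 : ℝ)..t, E s) {t : ℝ} (ht : t ∈ Icc 0 T) :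
    E t ≤ E 0 * Real.exp (C * t) := by
  let e : ℝ → ℝ := fun s => E (max 0 s)
  have ec : Continuous e :=
    hE.comp_continuous (continuous_const.max continuous_id) fun s => mem_Ici.2 (le_max_left _ _)
  have ee : ∀ t, 0 ≤ t → ∫ s in (0 : ℝ)..t, E s = ∫ s in (0 : ℝ)..t, e s := by
    intro t ht
    refine intervalIntegral.integral_congr fun s hs => ?_
    rw [uIcc_of_le ht] at hs
    simp only [e]
    rw [max_eq_right hs.1]
  let U : ℝ → ℝ := fun t => (E 0 + C * ∫ s in (0 : ℝ)..t, e s) * Real.exp (-(C * t))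
  have dU : ∀ t, HasDerivAt U ((C * e t) * Real.exp (-(C * t)) +
      (E 0 + C * ∫ s in (0 : ℝ)..t, e s) * (Real.exp (-(C * t)) * (-(C * 1)))) t := by
    intro t
    have h1 : HasDerivAt (fun t => ∫ s in (0 : ℝ)..t, e s) (e t) t :=
      intervalIntegral.integral_hasDerivAt_right (ec.intervalIntegrable _ _)
        (ec.stronglyMeasurableAtFilter _ _) ec.continuousAt
    exact ((h1.const_mul C).const_add (E 0)).mul (((hasDerivAt_id t).const_mul C).neg.exp)
  have anti : AntitoneOn U (Icc 0 T) := by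
    refine antitoneOn_of_hasDerivWithinAt_nonpos (convex_Icc 0 T)
      (fun x _ => (dU x).continuousAt.continuousWithinAt)
      (fun x _ => (dU x).hasDerivWithinAt) fun x hx => ?_
    have hx' := interior_subset hx
    have h1 := h x hx'
    rw [ee x hx'.1] at h1
    have h2 : e x = E x := by simp only [e]; rw [max_eq_right hx'.1]
    rw [h2]
    have h3 : C * (E x - (E 0 + C * ∫ s in (0 : ℝ)..x, e s)) * Real.exp (-(C * x)) ≤ 0 :=
      mul_nonpos_of_nonpos_of_nonneg (mul_nonpos_of_nonneg_of_nonpos hC (by linarith))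
        (Real.exp_pos _).le
    linarith
  have h1 := anti ⟨le_rfl, ht.1.trans ht.2⟩ ht ht.1
  simp only [U, intervalIntegral.integral_same, mul_zero, add_zero, neg_zero, Real.exp_zero,
    mul_one] at h1
  have h2 := h t ht
  rw [ee t ht.1] at h2
  rw [Real.exp_neg, ← div_eq_mul_inv, div_le_iff₀ (Real.exp_pos _)] at h1
  linarith

section Propagation

variable {D ε : ℝ} {ρ₀ : ℝ × ℝ → ℝ} {ρ : ℝ → L2Plane}

theorem energyRate_le (hD : 0 ≤ D) {h : ℝ → ℝ} (h0 : ∀ s, 0 ≤ h s) (u g₁ g₂ : L2Plane) :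
    energyRate D ε h u g₁ g₂ ≤ 4 * interaction ε (fun z => entropyDual h (u z)) u := by
  have : 0 ≤ D * ∫ z, h (u z) * (g₁ z ^ 2 + g₂ z ^ 2) :=
    mul_nonneg hD (integral_nonneg fun z => mul_nonneg (h0 _) (by positivity))
  unfold energyRate
  linarith

theorem IsRegularizedSolution.continuousOn_integral_entropy (hρ : IsRegularizedSolution D ε ρ₀ ρ)
    {h : ℝ → ℝ} (hc : Continuous h) (hs : HasCompactSupport h) (h0 : ∀ s, 0 ≤ h s) :
    ContinuousOn (fun t => ∫ z, entropy h (ρ t z)) (Ici 0) := by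
  obtain ⟨C, hC⟩ := hc.bounded_above_of_compact_support hs
  exact (continuous_integral_entropy hc h0 (C := C) hC).comp_continuousOn hρ.continuousOn

/-- An entropy with `s H' - H ≤ K H` grows at most exponentially, at a rate proportional to `K`. -/
theorem integral_entropy_le_exp (hD : 0 ≤ D) (hε : 0 < ε) (hρ : IsRegularizedSolution D ε ρ₀ ρ)
    {h : ℝ → ℝ} (hc : Continuous h) (hs : HasCompactSupport h) (h0 : ∀ s, 0 ≤ h s)
    {K : ℝ} (hK : 0 ≤ K) (hdual : ∀ s, entropyDual h s ≤ K * entropy h s)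
    {B T : ℝ} (hB : 0 ≤ B) (hB1 : ∀ t ∈ Icc 0 T, ∫ z, |ρ t z| ≤ B) {t : ℝ} (ht : t ∈ Icc 0 T) :
    ∫ z, entropy h (ρ t z) ≤
      (∫ z, entropy h (ρ 0 z)) * Real.exp (4 * (deltaReg ε 0 ^ 2 * B * K) * t) := by
  obtain ⟨G₁, G₂, hG⟩ := hρ.exists_gradient
  obtain ⟨C, hC⟩ := hc.bounded_above_of_compact_support hs
  have cE := hρ.continuousOn_integral_entropy hc hs h0
  refine gronwall_integral cE (T := T) (by positivity) (fun t ht => ?_) ht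
  have key := energy_inequality hε hρ hG hc hs h0 le_rfl ht.1
  have h1 : ∫ s in Ioc 0 t, energyRate D ε h (ρ s) (G₁ s) (G₂ s) ≤
      ∫ s in Ioc 0 t, 4 * (deltaReg ε 0 ^ 2 * B * K) * ∫ z, entropy h (ρ s z) := by
    have ie : IntegrableOn (fun t => ∫ z, entropy h (ρ t z)) (Ioc 0 t) :=
      ((cE.mono Icc_subset_Ici_self).integrableOn_Icc).mono_set Ioc_subset_Icc_self
    refine setIntegral_mono_on key.1 (ie.const_mul _) measurableSet_Ioc fun s hs' => ?_
    have hsT : s ∈ Icc 0 T := ⟨hs'.1.le, hs'.2.trans ht.2⟩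
    have i1 := integrable_entropyDual hc h0 (C := C) hC (ρ s)
    have i2 := integrable_entropy hc h0 (C := C) hC (ρ s)
    have h2 := (le_abs_self _).trans (abs_interaction_le hε i1 (hρ.integrable hsT.1))
    have h3 : ∫ z, |entropyDual h (ρ s z)| ≤ K * ∫ z, entropy h (ρ s z) := by
      rw [← integral_const_mul]
      refine integral_mono i1.abs (i2.const_mul _) fun z => ?_
      simp only
      rw [abs_of_nonneg (entropyDual_nonneg hc h0 _)]
      exact hdual _
    have h4 : deltaReg ε 0 ^ 2 * (∫ z, |ρ s z|) * ∫ z, |entropyDual h (ρ s z)| ≤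
        deltaReg ε 0 ^ 2 * B * (K * ∫ z, entropy h (ρ s z)) :=
      mul_le_mul (mul_le_mul_of_nonneg_left (hB1 s hsT) (sq_nonneg _)) h3
        (integral_nonneg fun z => abs_nonneg _) (by positivity)
    have h5 := energyRate_le (ε := ε) hD h0 (ρ s) (G₁ s) (G₂ s)
    linarith
  rw [integral_const_mul] at h1
  rw [intervalIntegral.integral_of_le ht.1]
  linarith [key.2]

/-- Solutions with non-negative initial datum stay non-negative. -/
theorem IsRegularizedSolution.ae_nonneg (hD : 0 ≤ D) (hε : 0 < ε)
    (hρ : IsRegularizedSolution D ε ρ₀ ρ) (hρ₀ : ∀ᵐ z, 0 ≤ ρ₀ z) {t : ℝ} (ht : 0 ≤ t) :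
    ∀ᵐ z, 0 ≤ ρ t z := by
  let h : ℝ → ℝ := fun s => tentPow 1 0 (-s)
  have hc : Continuous h := (continuous_tentPow 1 0).comp continuous_neg
  have hs : HasCompactSupport h :=
    (hasCompactSupport_tentPow 1 0).comp_homeomorph (Homeomorph.neg ℝ)
  have h0 : ∀ s, 0 ≤ h s := fun s => tentPow_nonneg _ _ _
  obtain ⟨C, hC⟩ := hc.bounded_above_of_compact_support hs
  obtain ⟨B, hB, hB1⟩ := hρ.exists_L1_bound (T := t + 1) (by linarith)
  have key := integral_entropy_le_exp hD hε hρ hc hs h0 (K := 2) (by norm_num) (fun s => by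
    rw [entropyDual_comp_neg, entropy_comp_neg]
    have := entropyDual_tentPow_le (R := 1) zero_le_one 0 (-s)
    simpa using this) hB (fun s hs => (hB1 s hs).2) (t := t) ⟨ht, by linarith⟩
  have hE0 : ∫ z, entropy h (ρ 0 z) = 0 := by
    refine integral_eq_zero_of_ae ?_
    filter_upwards [hρ.initial, hρ₀] with z h1 h2
    rw [h1, Pi.zero_apply, entropy_comp_neg]
    refine le_antisymm ?_ (entropy_nonneg (continuous_tentPow 1 0) (tentPow_nonneg 1 0) _)
    have e : entropy (tentPow 1 0) (-ρ₀ z) ≤ 0 := by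
      have h3 := entropyDual_tentPow_le (R := 1) zero_le_one 0 (-ρ₀ z)
      have h4 := entropy_sub_le (continuous_tentPow 1 0) (tentPow_nonneg 1 0) (-ρ₀ z) 0
      have h5 : prim (tentPow 1 0) (-ρ₀ z) = 0 := by
        rw [prim, intervalIntegral.integral_congr (g := fun _ => 0),
          intervalIntegral.integral_zero]
        intro x hx
        rw [uIcc_of_ge (by linarith)] at hx
        simp [tentPow, tent_of_nonpos hx.2]
      rw [h5, entropy_zero] at h4
      linarith
    exact e
  rw [hE0, zero_mul] at key
  have hz := (integral_eq_zero_iff_of_nonneg (fun z => entropy_nonneg hc h0 _)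
    (integrable_entropy hc h0 (C := C) hC (ρ t))).1
    (le_antisymm key (integral_nonneg fun z => entropy_nonneg hc h0 _))
  filter_upwards [hz] with z hz
  by_contra hneg
  push Not at hneg
  rw [entropy_comp_neg, Pi.zero_apply] at hz
  set r := min (-ρ t z) 1
  have hr : 0 < r := lt_min (by linarith) one_pos
  have h1 := entropy_congr (h := tentPow 1 0) (g := fun x => x ^ 1) hr.le fun x hx => by
    rw [tentPow, tent_eq hx.1 (hx.2.trans (min_le_right _ _))]
  have h2 := monotoneOn_entropy (continuous_tentPow 1 0) (tentPow_nonneg 1 0) (mem_Ici.2 hr.le)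
    (mem_Ici.2 (hr.le.trans (min_le_left _ _))) (min_le_left (-ρ t z) 1)
  have h3 := entropy_pow 1 r
  rw [hz] at h2
  change entropy (tentPow 1 0) r ≤ 0 at h2
  rw [h1, h3] at h2
  have : 0 < r ^ (1 + 2) / (((1 : ℕ) + 1 : ℝ) * ((1 : ℕ) + 2)) := by positivity
  linarith

/-- Chebyshev's inequality along a sequence of powers. -/
theorem ae_lt_of_measureReal_mul_pow_le {f : ℝ × ℝ → ℝ} (hf : Integrable f) {k b C : ℝ}
    (hb : 0 ≤ b) (hbk : b < k) {m : ℕ → ℕ} (hm : Tendsto m atTop atTop)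
    (h : ∀ n, volume.real {z | k ≤ f z} * k ^ m n ≤ C * b ^ m n) : ∀ᵐ z, f z < k := by
  have hk : 0 < k := hb.trans_lt hbk
  have h0 : volume.real {z | k ≤ f z} ≤ 0 := by
    have lim : Tendsto (fun n => C * (b / k) ^ m n) atTop (𝓝 (C * 0)) :=
      ((tendsto_pow_atTop_nhds_zero_of_lt_one (div_nonneg hb hk.le)
        ((div_lt_one hk).2 hbk)).comp hm).const_mul C
    rw [mul_zero] at lim
    refine ge_of_tendsto' lim fun n => ?_
    rw [div_pow, ← mul_div_assoc, le_div_iff₀ (pow_pos hk _)]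
    exact h n
  have h1 : volume {z | k ≤ f z} = 0 := by
    have h2 := le_antisymm h0 measureReal_nonneg
    rwa [measureReal_eq_zero_iff (hf.measure_ge_lt_top hk).ne] at h2
  rw [ae_iff]
  simpa using h1

/-- On bounded time intervals the solution is bounded, with a bound that may depend on `ε`. -/
theorem IsRegularizedSolution.exists_ae_le (hD : 0 ≤ D) (hε : 0 < ε)
    (hρ : IsRegularizedSolution D ε ρ₀ ρ) (hρ₀ : ∀ᵐ z, 0 ≤ ρ₀ z) {A : ℝ} (hA : ∀ᵐ z, ρ₀ z ≤ A)
    (T : ℝ) : ∃ k : ℝ, 0 < k ∧ ∀ t ∈ Icc 0 T, ∀ᵐ z, ρ t z ≤ k := by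
  rcases lt_or_ge T 0 with hT | hT
  · exact ⟨1, one_pos, fun t ht => absurd (ht.1.trans ht.2) hT.not_ge⟩
  obtain ⟨B, hB, hB1⟩ := hρ.exists_L1_bound (T := T + 1) (by linarith)
  set Λ := 4 * (deltaReg ε 0 ^ 2 * B)
  have hΛ : 0 ≤ Λ := by positivity
  have hA' : ∀ᵐ z, ρ 0 z ≤ |A| := by
    filter_upwards [hA, hρ.initial] with z h1 h2
    rw [h2]; exact h1.trans (le_abs_self A)
  have hpos0 : ∀ᵐ z, 0 ≤ ρ 0 z := by
    filter_upwards [hρ₀, hρ.initial] with z h1 h2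
    rw [h2]; exact h1
  set b := |A| * Real.exp (Λ * T)
  have hb : 0 ≤ b := by positivity
  refine ⟨b + 1, by linarith, fun t ht => ?_⟩
  set k := b + 1
  have hk : 0 < k := by linarith
  have hi := hρ.integrable ht.1
  have hi0 := hρ.integrable (le_refl (0 : ℝ))
  refine (ae_lt_of_measureReal_mul_pow_le hi hb (lt_add_one b)
    (C := (∫ z, ρ 0 z) / k) (m := fun n => n + 2) (tendsto_add_atTop_nat 2) fun n => ?_).mono
    fun z hz => hz.le
  have hc := continuous_tentPow k n
  have h0 := tentPow_nonneg k n
  have hs := hasCompactSupport_tentPow k n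
  obtain ⟨C, hC⟩ := hc.bounded_above_of_compact_support hs
  have key := integral_entropy_le_exp hD hε hρ hc hs h0 (K := n + 2) (by positivity)
    (entropyDual_tentPow_le hk.le n) hB (T := T) (fun s hs =>
      (hB1 s ⟨hs.1, hs.2.trans (by linarith)⟩).2) ht
  set c : ℝ := ((n : ℝ) + 2) * (n + 3)
  have hc0 : 0 < c := by positivity
  have cheb := mul_meas_ge_le_integral_of_nonneg (ae_of_all _ fun z => entropy_nonneg hc h0 (ρ t z))
    (integrable_entropy hc h0 (C := C) hC (ρ t)) (k ^ (n + 3) / c)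
  have hmono : volume.real {z | k ≤ ρ t z} ≤
      volume.real {z | k ^ (n + 3) / c ≤ entropy (tentPow k n) (ρ t z)} := by
    refine measureReal_mono (fun z hz => le_entropy_tentPow n hk.le hz) ?_
    exact ((integrable_entropy hc h0 (C := C) hC (ρ t)).measure_ge_lt_top (by positivity)).ne
  have hE0 : ∫ z, entropy (tentPow k n) (ρ 0 z) ≤ |A| ^ (n + 2) / c * ∫ z, ρ 0 z := by
    rw [← integral_const_mul]
    refine integral_mono_ae (integrable_entropy hc h0 (C := C) hC (ρ 0)) (hi0.const_mul _) ?_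
    filter_upwards [hA', hpos0] with z h1 h2
    refine (entropy_tentPow_le k n h2).trans ?_
    rw [div_mul_eq_mul_div, pow_succ]
    refine div_le_div_of_nonneg_right ?_ hc0.le
    exact mul_le_mul_of_nonneg_right (pow_le_pow_left₀ h2 h1 _) h2
  have hexp : Real.exp (4 * (deltaReg ε 0 ^ 2 * B * (n + 2)) * t) ≤
      Real.exp (Λ * T) ^ (n + 2) := by
    rw [← Real.exp_nat_mul]
    refine Real.exp_le_exp.2 ?_
    have : Λ * t ≤ Λ * T := mul_le_mul_of_nonneg_left ht.2 hΛ
    have h3 : ((n + 2 : ℕ) : ℝ) * (Λ * t) ≤ ((n + 2 : ℕ) : ℝ) * (Λ * T) :=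
      mul_le_mul_of_nonneg_left this (by positivity)
    refine le_trans (le_of_eq ?_) h3
    simp only [Λ]
    push_cast
    ring
  have hint0 : 0 ≤ ∫ z, ρ 0 z := integral_nonneg_of_ae hpos0
  have h6 : volume.real {z | k ≤ ρ t z} * (k ^ (n + 3) / c) ≤
      |A| ^ (n + 2) / c * (∫ z, ρ 0 z) * Real.exp (Λ * T) ^ (n + 2) := by
    calc volume.real {z | k ≤ ρ t z} * (k ^ (n + 3) / c)
        ≤ k ^ (n + 3) / c * volume.real {z | k ^ (n + 3) / c ≤ entropy (tentPow k n) (ρ t z)} := by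
          rw [mul_comm]
          exact mul_le_mul_of_nonneg_left hmono (by positivity)
      _ ≤ _ := cheb.trans (key.trans (mul_le_mul hE0 hexp (Real.exp_pos _).le (by positivity)))
  have h7 : volume.real {z | k ≤ ρ t z} * k ^ (n + 2) * k ≤ (∫ z, ρ 0 z) * b ^ (n + 2) := by
    have h8 := mul_le_mul_of_nonneg_left h6 hc0.le
    calc volume.real {z | k ≤ ρ t z} * k ^ (n + 2) * k
        = c * (volume.real {z | k ≤ ρ t z} * (k ^ (n + 3) / c)) := by
          field_simp
          ring
      _ ≤ _ := h8
      _ = (∫ z, ρ 0 z) * b ^ (n + 2) := by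
        simp only [b, mul_pow]
        field_simp
  rw [div_mul_eq_mul_div, le_div_iff₀ hk]
  exact h7

end Propagation

/-! ### Test functions of linear growth and conservation of mass -/

/-- Smooth functions on the plane with linear growth and bounded first and second derivatives. -/
structure IsLinearGrowth (φ : ℝ × ℝ → ℝ) (C : ℝ) : Prop where
  contDiff : ContDiff ℝ ∞ φ
  bound : ∀ z, |φ z| ≤ C * (1 + ‖z‖)
  boundX : ∀ z, |partialX φ z| ≤ C
  boundY : ∀ z, |partialY φ z| ≤ C
  boundXX : ∀ z, |partialX (partialX φ) z| ≤ C
  boundYY : ∀ z, |partialY (partialY φ) z| ≤ C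

theorem isLinearGrowth_one : IsLinearGrowth (fun _ => 1) 1 := by
  have hX : partialX (fun _ : ℝ × ℝ => (1 : ℝ)) = fun _ => 0 := by ext; simp [partialX]
  have hY : partialY (fun _ : ℝ × ℝ => (1 : ℝ)) = fun _ => 0 := by ext; simp [partialY]
  refine ⟨contDiff_const, fun z => ?_, ?_, ?_, ?_, ?_⟩
  · have := norm_nonneg z
    simp [this]
  all_goals simp [hX, hY, partialX, partialY]

/-- The pairing of the right-hand side of the equation with `φ`, all derivatives of the diffusion
term being moved onto `φ`. -/
noncomputable def weakRate (D ε : ℝ) (φ : ℝ × ℝ → ℝ) (u : L2Plane) : ℝ :=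
  ∫ z, u z * (D * (partialX (partialX φ) z + partialY (partialY φ) z) +
    regForceX ε u z * partialX φ z + regForceY ε u z * partialY φ z)

theorem abs_regForceX_le {ε : ℝ} (hε : 0 < ε) {g : ℝ × ℝ → ℝ} (hg : Integrable g) (z : ℝ × ℝ) :
    |regForceX ε g z| ≤ 2 * deltaReg ε 0 * ∫ w, |g w| := by
  rw [regForceX_eq, abs_neg]
  exact abs_kernelConv_le (abs_kernelX_le hε) hg z

theorem abs_regForceY_le {ε : ℝ} (hε : 0 < ε) {g : ℝ × ℝ → ℝ} (hg : Integrable g) (z : ℝ × ℝ) :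
    |regForceY ε g z| ≤ 2 * deltaReg ε 0 * ∫ w, |g w| := by
  rw [regForceY_eq, abs_neg]
  exact abs_kernelConv_le (abs_kernelY_le hε) hg z

theorem continuous_regForceX {ε : ℝ} (hε : 0 < ε) {g : ℝ × ℝ → ℝ} (hg : Integrable g) :
    Continuous (regForceX ε g) := by
  rw [show regForceX ε g = fun z => -kernelConv (kernelX ε) g z from funext (regForceX_eq ε g)]
  exact (continuous_kernelConv (contDiff_kernelX ε).continuous (abs_kernelX_le hε) hg).neg

theorem continuous_regForceY {ε : ℝ} (hε : 0 < ε) {g : ℝ × ℝ → ℝ} (hg : Integrable g) :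
    Continuous (regForceY ε g) := by
  rw [show regForceY ε g = fun z => -kernelConv (kernelY ε) g z from funext (regForceY_eq ε g)]
  exact (continuous_kernelConv (contDiff_kernelY ε).continuous (abs_kernelY_le hε) hg).neg

theorem continuous_weakRate_integrand {D ε : ℝ} (hε : 0 < ε) {φ : ℝ × ℝ → ℝ}
    (hφ : ContDiff ℝ ∞ φ) {u : L2Plane} (hu : Integrable u) :
    Continuous fun z => D * (partialX (partialX φ) z + partialY (partialY φ) z) +
      regForceX ε u z * partialX φ z + regForceY ε u z * partialY φ z := by
  have h1 := continuous_regForceX hε hu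
  have h2 := continuous_regForceY hε hu
  have h3 := hφ.partialX.continuous
  have h4 := hφ.partialY.continuous
  have h5 := hφ.partialX.partialX.continuous
  have h6 := hφ.partialY.partialY.continuous
  fun_prop

theorem abs_weakRate_integrand_le {D ε : ℝ} (hε : 0 < ε) {φ : ℝ × ℝ → ℝ} {C : ℝ} {z : ℝ × ℝ}
    (h1 : |partialX φ z| ≤ C) (h2 : |partialY φ z| ≤ C) (h3 : |partialX (partialX φ) z| ≤ C)
    (h4 : |partialY (partialY φ) z| ≤ C) {u : L2Plane} (hu : Integrable u) {B : ℝ}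
    (hB : ∫ w, |u w| ≤ B) :
    |u z * (D * (partialX (partialX φ) z + partialY (partialY φ) z) +
      regForceX ε u z * partialX φ z + regForceY ε u z * partialY φ z)| ≤
      |u z| * (2 * |D| * C + 4 * deltaReg ε 0 * B * C) := by
  have hd := deltaReg_nonneg hε 0
  have f1 : |regForceX ε u z| ≤ 2 * deltaReg ε 0 * B := (abs_regForceX_le hε hu z).trans
    (mul_le_mul_of_nonneg_left hB (by positivity))
  have f2 : |regForceY ε u z| ≤ 2 * deltaReg ε 0 * B := (abs_regForceY_le hε hu z).trans
    (mul_le_mul_of_nonneg_left hB (by positivity))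
  rw [abs_mul]
  refine mul_le_mul_of_nonneg_left ?_ (abs_nonneg _)
  have g0 : |D * (partialX (partialX φ) z + partialY (partialY φ) z)| ≤ |D| * (C + C) := by
    rw [abs_mul]
    exact mul_le_mul_of_nonneg_left ((abs_add_le _ _).trans (add_le_add h3 h4)) (abs_nonneg _)
  have g1 : |regForceX ε u z * partialX φ z| ≤ 2 * deltaReg ε 0 * B * C := by
    rw [abs_mul]
    exact mul_le_mul f1 h1 (abs_nonneg _) ((abs_nonneg _).trans f1)
  have g2 : |regForceY ε u z * partialY φ z| ≤ 2 * deltaReg ε 0 * B * C := by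
    rw [abs_mul]
    exact mul_le_mul f2 h2 (abs_nonneg _) ((abs_nonneg _).trans f2)
  refine ((abs_add_le _ _).trans (add_le_add ((abs_add_le _ _).trans (add_le_add g0 g1)) g2)).trans
    (le_of_eq (by ring))

theorem cutoff_mul_eventuallyEq (φ : ℝ × ℝ → ℝ) (z : ℝ × ℝ) :
    ∀ᶠ n in atTop, (fun w => φ w * cutoff n w) =ᶠ[𝓝 z] φ := by
  filter_upwards [cutoff_eventually_one z] with n hn
  filter_upwards [hn] with w hw
  rw [hw, mul_one]

theorem IsLinearGrowth.exists_bound_mul_cutoff {φ : ℝ × ℝ → ℝ} {C : ℝ} (h : IsLinearGrowth φ C) :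
    ∃ C', 0 ≤ C' ∧ ∀ n z, |_root_.partialX (fun w => φ w * cutoff n w) z| ≤ C' ∧
      |_root_.partialY (fun w => φ w * cutoff n w) z| ≤ C' ∧
      |_root_.partialX (_root_.partialX (fun w => φ w * cutoff n w)) z| ≤ C' ∧
      |_root_.partialY (_root_.partialY (fun w => φ w * cutoff n w)) z| ≤ C' := by
  obtain ⟨K, hK, hb⟩ := exists_cutoff_bound
  have hC : 0 ≤ C := (abs_nonneg _).trans (h.boundX 0)
  have dφ : Differentiable ℝ φ := h.contDiff.differentiable (by simp)
  have dχ : ∀ n, Differentiable ℝ (cutoff n) := fun n => (cutoff_isTest n).1.differentiable (by simp)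
  have dφx : Differentiable ℝ (_root_.partialX φ) := h.contDiff.partialX.differentiable (by simp)
  have dφy : Differentiable ℝ (_root_.partialY φ) := h.contDiff.partialY.differentiable (by simp)
  have dχx : ∀ n, Differentiable ℝ (_root_.partialX (cutoff n)) := fun n =>
    (cutoff_isTest n).1.partialX.differentiable (by simp)
  have dχy : ∀ n, Differentiable ℝ (_root_.partialY (cutoff n)) := fun n =>
    (cutoff_isTest n).1.partialY.differentiable (by simp)
  have small : ∀ {x z}, x * (1 + ‖(z : ℝ × ℝ)‖) ≤ K → 0 ≤ x → x ≤ K := by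
    intro x z h1 h2
    have := norm_nonneg z
    nlinarith
  have big : ∀ {y} z, |y| * (1 + ‖(z : ℝ × ℝ)‖) ≤ K → |φ z * y| ≤ C * K := by
    intro y z h1
    rw [abs_mul]
    calc |φ z| * |y| ≤ C * (1 + ‖z‖) * |y| := mul_le_mul_of_nonneg_right (h.bound z) (abs_nonneg _)
      _ = C * (|y| * (1 + ‖z‖)) := by ring
      _ ≤ C * K := mul_le_mul_of_nonneg_left h1 hC
  have prod : ∀ {x y a b : ℝ}, |x| ≤ a → |y| ≤ b → |x * y| ≤ a * b := by
    intro x y a b h1 h2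
    rw [abs_mul]
    exact mul_le_mul h1 h2 (abs_nonneg _) ((abs_nonneg _).trans h1)
  refine ⟨C * K + C * K + C * K + C, by positivity, fun n z => ?_⟩
  obtain ⟨-, -, b1, b2, b3, b4⟩ := hb n z
  have hCK : 0 ≤ C * K := by positivity
  have c1 := abs_cutoff_le_one n z
  have s1 := small b1 (abs_nonneg _)
  have s2 := small b2 (abs_nonneg _)
  have eX : _root_.partialX (fun w => φ w * cutoff n w) = fun w =>
      φ w * _root_.partialX (cutoff n) w + _root_.partialX φ w * cutoff n w :=
    funext fun w => partialX_mul (dφ w) (dχ n w)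
  have eY : _root_.partialY (fun w => φ w * cutoff n w) = fun w =>
      φ w * _root_.partialY (cutoff n) w + _root_.partialY φ w * cutoff n w :=
    funext fun w => partialY_mul (dφ w) (dχ n w)
  have eXX : _root_.partialX (_root_.partialX (fun w => φ w * cutoff n w)) z =
      (φ z * _root_.partialX (_root_.partialX (cutoff n)) z +
        _root_.partialX φ z * _root_.partialX (cutoff n) z) +
      (_root_.partialX φ z * _root_.partialX (cutoff n) z +
        _root_.partialX (_root_.partialX φ) z * cutoff n z) := by
    rw [eX, ← partialX_mul (dφ z) (dχx n z), ← partialX_mul (dφx z) (dχ n z)]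
    unfold _root_.partialX
    rw [fderiv_fun_add]
    · rfl
    · exact (dφ z).mul (dχx n z)
    · exact (dφx z).mul (dχ n z)
  have eYY : _root_.partialY (_root_.partialY (fun w => φ w * cutoff n w)) z =
      (φ z * _root_.partialY (_root_.partialY (cutoff n)) z +
        _root_.partialY φ z * _root_.partialY (cutoff n) z) +
      (_root_.partialY φ z * _root_.partialY (cutoff n) z +
        _root_.partialY (_root_.partialY φ) z * cutoff n z) := by
    rw [eY, ← partialY_mul (dφ z) (dχy n z), ← partialY_mul (dφy z) (dχ n z)]
    unfold _root_.partialY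
    rw [fderiv_fun_add]
    · rfl
    · exact (dφ z).mul (dχy n z)
    · exact (dφy z).mul (dχ n z)
  refine ⟨?_, ?_, ?_, ?_⟩
  · rw [eX]
    have := (abs_add_le _ _).trans (add_le_add (big z b1) (prod (h.boundX z) c1))
    linarith
  · rw [eY]
    have := (abs_add_le _ _).trans (add_le_add (big z b2) (prod (h.boundY z) c1))
    linarith
  · rw [eXX]
    have := (abs_add_le _ _).trans (add_le_add
      ((abs_add_le _ _).trans (add_le_add (big z b3) (prod (h.boundX z) s1)))
      ((abs_add_le _ _).trans (add_le_add (prod (h.boundX z) s1) (prod (h.boundXX z) c1))))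
    linarith
  · rw [eYY]
    have := (abs_add_le _ _).trans (add_le_add
      ((abs_add_le _ _).trans (add_le_add (big z b4) (prod (h.boundY z) s2)))
      ((abs_add_le _ _).trans (add_le_add (prod (h.boundY z) s2) (prod (h.boundYY z) c1))))
    linarith

section VeryWeak

variable {D ε : ℝ} {ρ₀ : ℝ × ℝ → ℝ} {ρ : ℝ → L2Plane}

theorem neg_flux_eq_weakRate (hε : 0 < ε) {u g₁ g₂ : L2Plane} (hg : HasWeakGradient u g₁ g₂)
    (hu : Integrable u) {φ : ℝ × ℝ → ℝ} (hφ : IsTestFunction φ) :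
    -∫ z, ((D * g₁ z - regForceX ε u z * u z) * partialX φ z +
      (D * g₂ z - regForceY ε u z * u z) * partialY φ z) = weakRate D ε φ u := by
  have i1 : ∀ {g : L2Plane} {f : ℝ × ℝ → ℝ}, IsTestFunction f → Integrable (fun z => g z * f z) :=
    fun {g f} hf => (Lp.memLp g).integrable_mul (hf.memLp 2)
  have i2 : ∀ {F f : ℝ × ℝ → ℝ}, Continuous F → IsTestFunction f →
      Integrable (fun z => u z * (F z * f z)) := by
    intro F f hF hf
    obtain ⟨C, hC⟩ := (hF.mul hf.continuous).bounded_above_of_compact_support hf.2.mul_left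
    exact hu.mul_bdd (c := C) (hF.mul hf.continuous).aestronglyMeasurable (ae_of_all _ hC)
  have cX := continuous_regForceX hε hu
  have cY := continuous_regForceY hε hu
  have a1 := (i1 (g := g₁) hφ.partialX).const_mul D
  have a2 := (i1 (g := g₂) hφ.partialY).const_mul D
  have a3 := i2 cX hφ.partialX
  have a4 := i2 cY hφ.partialY
  have a5 := (i1 (g := u) hφ.partialX.partialX).const_mul D
  have a6 := (i1 (g := u) hφ.partialY.partialY).const_mul D
  have w1 := hg.weakX _ hφ.partialX
  have w2 := hg.weakY _ hφ.partialY
  have e1 : ∫ z, ((D * g₁ z - regForceX ε u z * u z) * partialX φ z +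
      (D * g₂ z - regForceY ε u z * u z) * partialY φ z) =
      ((D * (∫ z, g₁ z * partialX φ z) - ∫ z, u z * (regForceX ε u z * partialX φ z)) +
      (D * (∫ z, g₂ z * partialY φ z) - ∫ z, u z * (regForceY ε u z * partialY φ z))) := by
    rw [← integral_const_mul, ← integral_const_mul, ← integral_sub a1 a3, ← integral_sub a2 a4]
    refine Eq.trans (integral_congr_ae (ae_of_all _ fun z => ?_))
      (integral_add (a1.sub a3) (a2.sub a4))
    simp only
    ring
  have e2 : weakRate D ε φ u =
      ((D * (∫ z, u z * partialX (partialX φ) z) + ∫ z, u z * (regForceX ε u z * partialX φ z)) +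
      (D * (∫ z, u z * partialY (partialY φ) z) + ∫ z, u z * (regForceY ε u z * partialY φ z))) := by
    rw [← integral_const_mul, ← integral_const_mul, ← integral_add a5 a3, ← integral_add a6 a4]
    refine Eq.trans (integral_congr_ae (ae_of_all _ fun z => ?_))
      (integral_add (a5.add a3) (a6.add a4))
    simp only
    ring
  rw [e1, e2, w1, w2]
  ring

/-- The weak formulation tested against functions of linear growth, in the limit of compactly
supported truncations. -/
theorem IsRegularizedSolution.tendsto_integral_mul_cutoff (hε : 0 < ε)
    (hρ : IsRegularizedSolution D ε ρ₀ ρ) {φ : ℝ × ℝ → ℝ} {C : ℝ} (hφ : IsLinearGrowth φ C)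
    (hi₀ : Integrable (fun z => ρ₀ z * φ z)) {t : ℝ} (ht : 0 ≤ t) :
    Tendsto (fun n => ∫ z, ρ t z * (φ z * cutoff n z)) atTop
      (𝓝 ((∫ z, ρ₀ z * φ z) + ∫ s in (0 : ℝ)..t, weakRate D ε φ (ρ s))) := by
  obtain ⟨G₁, G₂, hG⟩ := hρ.exists_gradient
  obtain ⟨B, hB, hB1⟩ := hρ.exists_L1_bound (T := t + 1) (by linarith)
  obtain ⟨C', hC', hb⟩ := hφ.exists_bound_mul_cutoff
  have hd := deltaReg_nonneg hε 0
  set ψ : ℕ → ℝ × ℝ → ℝ := fun n z => φ z * cutoff n z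
  have hψ : ∀ n, IsTestFunction (ψ n) := fun n => (cutoff_isTest n).mul_contDiff hφ.contDiff
  set c := 2 * |D| * C' + 4 * deltaReg ε 0 * B * C'
  have hwg : ∀ᵐ s ∂volume, s ∈ Ioc 0 t → HasWeakGradient (ρ s) (G₁ s) (G₂ s) := by
    rw [← ae_restrict_iff' measurableSet_Ioc]
    exact ae_restrict_of_ae_restrict_of_subset (fun s hs => hs.1) hG.weakGradient
  have hrate : ∀ n, ∀ᵐ s ∂volume, s ∈ Ioc 0 t → -∫ z,
      ((D * G₁ s z - regForceX ε (ρ s) z * ρ s z) * partialX (ψ n) z +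
        (D * G₂ s z - regForceY ε (ρ s) z * ρ s z) * partialY (ψ n) z) =
      weakRate D ε (ψ n) (ρ s) := by
    intro n
    filter_upwards [hwg] with s hs hst
    exact neg_flux_eq_weakRate hε (hs hst) (hρ.integrable hst.1.le) (hψ n)
  have key : ∀ n, ∫ z, ρ t z * ψ n z =
      (∫ z, ρ₀ z * ψ n z) + ∫ s in (0 : ℝ)..t, weakRate D ε (ψ n) (ρ s) := by
    intro n
    have h1 := hG.weak_eq (ψ n) (hψ n) t ht
    rw [← intervalIntegral.integral_neg, intervalIntegral.integral_congr_ae (g := fun s =>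
      weakRate D ε (ψ n) (ρ s))] at h1
    · linarith
    · filter_upwards [hrate n] with s hs hst
      rw [uIoc_of_le ht] at hst
      exact hs hst
  have lim0 : Tendsto (fun n => ∫ z, ρ₀ z * ψ n z) atTop (𝓝 (∫ z, ρ₀ z * φ z)) := by
    refine tendsto_integral_of_dominated_convergence (fun z => |ρ₀ z * φ z|) (fun n => ?_) hi₀.abs
      (fun n => ae_of_all _ fun z => ?_) (ae_of_all _ fun z => ?_)
    · refine (hi₀.aestronglyMeasurable.mul
        (cutoff_isTest n).continuous.aestronglyMeasurable).congr (ae_of_all _ fun z => ?_)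
      simp only [ψ, Pi.mul_apply]
      ring
    · simp only [ψ]
      rw [← mul_assoc, norm_mul, Real.norm_eq_abs, Real.norm_eq_abs]
      exact mul_le_of_le_one_right (abs_nonneg _) (abs_cutoff_le_one n z)
    · simp only [ψ]
      have := ((cutoff_tendsto z).const_mul (φ z)).const_mul (ρ₀ z)
      simpa using this
  have limI : ∀ s ∈ Ioc 0 t, Tendsto (fun n => weakRate D ε (ψ n) (ρ s)) atTop
      (𝓝 (weakRate D ε φ (ρ s))) := by
    intro s hs
    have hs' : s ∈ Icc 0 (t + 1) := ⟨hs.1.le, by linarith [hs.2]⟩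
    have hi := (hB1 s hs').1
    refine tendsto_integral_of_dominated_convergence (fun z => |ρ s z| * c) (fun n => ?_)
      (hi.abs.mul_const c) (fun n => ae_of_all _ fun z => ?_) (ae_of_all _ fun z => ?_)
    · exact (Lp.aestronglyMeasurable (ρ s)).mul
        (continuous_weakRate_integrand hε (hψ n).1 hi).aestronglyMeasurable
    · obtain ⟨h1, h2, h3, h4⟩ := hb n z
      exact abs_weakRate_integrand_le hε h1 h2 h3 h4 hi (hB1 s hs').2
    · refine tendsto_const_nhds.congr' ?_
      filter_upwards [cutoff_mul_eventuallyEq φ z] with n hn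
      have h1 := hn.partialX_eq
      have h2 := hn.partialY_eq
      simp only [ψ]
      rw [h1.eq_of_nhds, h2.eq_of_nhds, h1.partialX_eq.eq_of_nhds, h2.partialY_eq.eq_of_nhds]
  have lim1 : Tendsto (fun n => ∫ s in (0 : ℝ)..t, weakRate D ε (ψ n) (ρ s)) atTop
      (𝓝 (∫ s in (0 : ℝ)..t, weakRate D ε φ (ρ s))) := by
    refine intervalIntegral.tendsto_integral_filter_of_dominated_convergence (fun _ => B * c)
      (Eventually.of_forall fun n => ?_) (Eventually.of_forall fun n => ae_of_all _ fun s hs => ?_)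
      intervalIntegrable_const (ae_of_all _ fun s hs => ?_)
    · rw [uIoc_of_le ht]
      have mX := hρ.memLp_flux (contDiff_kernelX ε).continuous (abs_kernelX_le hε)
        (T := t + 1) (by linarith) (hG.memLp₁ (t + 1) (by linarith))
      have mY := hρ.memLp_flux (contDiff_kernelY ε).continuous (abs_kernelY_le hε)
        (T := t + 1) (by linarith) (hG.memLp₂ (t + 1) (by linarith))
      have m := ((mX.1.inner (𝕜 := ℝ) (aestronglyMeasurable_const
        (b := testL2 (hψ n).partialX))).add (mY.1.inner (𝕜 := ℝ) (aestronglyMeasurable_const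
        (b := testL2 (hψ n).partialY)))).neg
      refine (m.mono_measure (Measure.restrict_mono
        (Ioc_subset_Ioc_right (by linarith : t ≤ t + 1)) le_rfl)).congr ?_
      filter_upwards [(ae_restrict_iff' measurableSet_Ioc).2 (hrate n),
        ae_restrict_mem measurableSet_Ioc] with s hs hst
      rw [← hs]
      have hi := hρ.integrable hst.1.le
      have a1 := inner_flux_testL2 (D := D) (contDiff_kernelX ε).continuous (abs_kernelX_le hε)
        (g := G₁ s) hi (hψ n).partialX
      have a2 := inner_flux_testL2 (D := D) (contDiff_kernelY ε).continuous (abs_kernelY_le hε)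
        (g := G₂ s) hi (hψ n).partialY
      simp only [Pi.neg_apply, Pi.add_apply]
      unfold flux
      rw [a1.1, a2.1, ← integral_add a1.2 a2.2]
      congr 1
      refine integral_congr_ae (ae_of_all _ fun z => ?_)
      simp only [regForceX_eq, regForceY_eq]
      ring
    · rw [uIoc_of_le ht] at hs
      have hs' : s ∈ Icc 0 (t + 1) := ⟨hs.1.le, by linarith [hs.2]⟩
      have hi := (hB1 s hs').1
      refine (norm_integral_le_of_norm_le (hi.abs.mul_const c) (ae_of_all _ fun z => ?_)).trans ?_
      · obtain ⟨h1, h2, h3, h4⟩ := hb n z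
        exact abs_weakRate_integrand_le hε h1 h2 h3 h4 hi (hB1 s hs').2
      · rw [integral_mul_const]
        exact mul_le_mul_of_nonneg_right (hB1 s hs').2 (by positivity)
    · rw [uIoc_of_le ht] at hs
      exact limI s hs
  exact (lim0.add lim1).congr fun n => (key n).symm

theorem IsRegularizedSolution.integrable_initial (hρ : IsRegularizedSolution D ε ρ₀ ρ) :
    Integrable ρ₀ := (hρ.integrable le_rfl).congr hρ.initial

/-- Conservation of mass. -/
theorem IsRegularizedSolution.integral_eq (hε : 0 < ε) (hρ : IsRegularizedSolution D ε ρ₀ ρ)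
    {t : ℝ} (ht : 0 ≤ t) : ∫ z, ρ t z = ∫ z, ρ₀ z := by
  have hX : partialX (fun _ : ℝ × ℝ => (1 : ℝ)) = fun _ => 0 := by ext; simp [partialX]
  have hY : partialY (fun _ : ℝ × ℝ => (1 : ℝ)) = fun _ => 0 := by ext; simp [partialY]
  have hX0 : partialX (fun _ : ℝ × ℝ => (0 : ℝ)) = fun _ => 0 := by ext; simp [partialX]
  have hY0 : partialY (fun _ : ℝ × ℝ => (0 : ℝ)) = fun _ => 0 := by ext; simp [partialY]
  have h1 := hρ.tendsto_integral_mul_cutoff hε isLinearGrowth_one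
    (by simpa using hρ.integrable_initial) ht
  have hr : ∀ s, weakRate D ε (fun _ => 1) (ρ s) = 0 := fun s => by
    simp [weakRate, hX, hY, hX0, hY0]
  simp only [hr, intervalIntegral.integral_zero, add_zero, mul_one, one_mul] at h1
  refine tendsto_nhds_unique ?_ h1
  have hi := hρ.integrable ht
  refine tendsto_integral_of_dominated_convergence (fun z => |ρ t z|) (fun n => ?_) hi.abs
    (fun n => ae_of_all _ fun z => ?_) (ae_of_all _ fun z => ?_)
  · exact hi.aestronglyMeasurable.mul (cutoff_isTest n).continuous.aestronglyMeasurable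
  · rw [norm_mul]
    exact mul_le_of_le_one_right (abs_nonneg _) (abs_cutoff_le_one n z)
  · simpa using (cutoff_tendsto z).const_mul (ρ t z)

end VeryWeak

/-! ### Densities of the `L^p` entropies -/

theorem sub_le_sub_of_hasDerivAt_le {f g f' g' : ℝ → ℝ} {a b : ℝ} (hab : a ≤ b)
    (hf : Continuous f) (hg : Continuous g) (hf' : ∀ x ∈ Ioo a b, HasDerivAt f (f' x) x)
    (hg' : ∀ x ∈ Ioo a b, HasDerivAt g (g' x) x) (hle : ∀ x ∈ Ioo a b, f' x ≤ g' x) :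
    f b - f a ≤ g b - g a := by
  have hm : MonotoneOn (fun x => g x - f x) (Icc a b) := by
    refine monotoneOn_of_hasDerivWithinAt_nonneg (f' := fun x => g' x - f' x) (convex_Icc a b)
      (hg.sub hf).continuousOn (fun x hx => ?_) fun x hx => ?_
    · rw [interior_Icc] at hx
      exact ((hg' x hx).sub (hf' x hx)).hasDerivWithinAt
    · rw [interior_Icc] at hx
      exact sub_nonneg.2 (hle x hx)
  have := hm (left_mem_Icc.2 hab) (right_mem_Icc.2 hab) hab
  simp only at this
  linarith

/-- A continuous cutoff on the line, equal to `1` on `[-R, R]`. -/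
noncomputable def plateau (R s : ℝ) : ℝ := max 0 (min 1 (R + 1 - |s|))

theorem continuous_plateau (R : ℝ) : Continuous (plateau R) := by unfold plateau; fun_prop

theorem plateau_nonneg (R s : ℝ) : 0 ≤ plateau R s := le_max_left _ _

theorem plateau_eq_one {R s : ℝ} (hs : |s| ≤ R) : plateau R s = 1 := by
  rw [plateau, min_eq_left (by linarith), max_eq_right zero_le_one]

theorem hasCompactSupport_plateau (R : ℝ) : HasCompactSupport (plateau R) := by
  refine HasCompactSupport.intro (isCompact_Icc (a := -(R + 1)) (b := R + 1)) fun s hs => ?_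
  refine max_eq_left ((min_le_right _ _).trans ?_)
  rw [mem_Icc, ← abs_le, not_le] at hs
  linarith

/-- The derivative of a regularization of `s ^ (p / 2)` on `[0, R]`: it equals
`(p / 2) s ^ (p / 2 - 1)` on `[η, R]` and is smaller on `[0, η]`. -/
noncomputable def powDensity (p η R s : ℝ) : ℝ :=
  p / 2 * max s η ^ (p / 2 - 1) * (min (max s 0) η / η) ^ (p / 2) * plateau R s

section PowDensity

variable {p η R : ℝ}

theorem continuous_powDensity (hp : 1 ≤ p) (hη : 0 < η) : Continuous (powDensity p η R) := by
  have h1 : Continuous fun s : ℝ => max s η ^ (p / 2 - 1) :=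
    (continuous_id.max continuous_const).rpow_const fun s =>
      Or.inl (hη.trans_le (le_max_right _ _)).ne'
  have h2 : Continuous fun s : ℝ => (min (max s 0) η / η) ^ (p / 2) :=
    (((continuous_id.max continuous_const).min continuous_const).div_const η).rpow_const
      fun s => Or.inr (by positivity)
  exact ((continuous_const.mul h1).mul h2).mul (continuous_plateau R)

theorem hasCompactSupport_powDensity : HasCompactSupport (powDensity p η R) :=
  (hasCompactSupport_plateau R).mul_left

theorem powDensity_nonneg (hp : 1 ≤ p) (hη : 0 < η) (s : ℝ) : 0 ≤ powDensity p η R s := by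
  have h1 : 0 ≤ max s η := hη.le.trans (le_max_right _ _)
  have h2 : 0 ≤ min (max s 0) η / η := div_nonneg (le_min (le_max_right _ _) hη.le) hη.le
  have h3 := plateau_nonneg R s
  unfold powDensity
  positivity

theorem powDensity_le (hp : 1 ≤ p) (hη : 0 < η) {s : ℝ} (hs : 0 < s) (hsR : s ≤ R) :
    powDensity p η R s ≤ p / 2 * s ^ (p / 2 - 1) := by
  rw [powDensity, plateau_eq_one (by rwa [abs_of_pos hs]), mul_one, mul_assoc, max_eq_left hs.le]
  refine mul_le_mul_of_nonneg_left ?_ (by positivity)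
  rcases le_total s η with h | h
  · rw [max_eq_right h, min_eq_left h, Real.div_rpow hs.le hη.le, Real.rpow_sub_one hη.ne',
      Real.rpow_sub_one hs.ne']
    have : 0 < η ^ (p / 2) := Real.rpow_pos_of_pos hη _
    have h2 : 0 < s ^ (p / 2) := Real.rpow_pos_of_pos hs _
    calc η ^ (p / 2) / η * (s ^ (p / 2) / η ^ (p / 2)) = s ^ (p / 2) / η := by field_simp
      _ ≤ s ^ (p / 2) / s := div_le_div_of_nonneg_left h2.le hs h
  · rw [max_eq_left h, min_eq_right h, div_self hη.ne', Real.one_rpow, mul_one]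

theorem powDensity_eq (hη : 0 < η) {s : ℝ} (hs : η ≤ s) (hsR : s ≤ R) :
    powDensity p η R s = p / 2 * s ^ (p / 2 - 1) := by
  have h0 := hη.le.trans hs
  rw [powDensity, plateau_eq_one (by rwa [abs_of_nonneg h0]), mul_one, max_eq_left h0,
    max_eq_left hs, min_eq_right hs, div_self hη.ne', Real.one_rpow, mul_one]

theorem prim_powDensity_nonneg (hp : 1 ≤ p) (hη : 0 < η) {s : ℝ} (hs : 0 ≤ s) :
    0 ≤ prim (powDensity p η R) s := by
  have := monotone_prim (continuous_powDensity (R := R) hp hη) (powDensity_nonneg hp hη) hs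
  rwa [prim_zero] at this

theorem prim_powDensity_le (hp : 1 ≤ p) (hη : 0 < η) {s : ℝ} (hs : s ∈ Icc 0 R) :
    prim (powDensity p η R) s ≤ s ^ (p / 2) := by
  have hc := continuous_powDensity (R := R) hp hη
  have := sub_le_sub_of_hasDerivAt_le hs.1 (continuous_prim hc)
    (Real.continuous_rpow_const (q := p / 2) (by positivity))
    (fun x _ => hasDerivAt_prim hc x)
    (fun x hx => Real.hasDerivAt_rpow_const (p := p / 2) (Or.inl hx.1.ne'))
    fun x hx => powDensity_le hp hη hx.1 (hx.2.le.trans hs.2)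
  rwa [prim_zero, Real.zero_rpow (by positivity), sub_zero, sub_zero] at this

theorem rpow_le_prim_powDensity_add (hp : 1 ≤ p) (hη : 0 < η) {s : ℝ} (hs : s ∈ Icc 0 R) :
    s ^ (p / 2) ≤ prim (powDensity p η R) s + η ^ (p / 2) := by
  have hc := continuous_powDensity (R := R) hp hη
  rcases le_total s η with h | h
  · have h1 := prim_powDensity_nonneg (R := R) hp hη hs.1
    have h2 := Real.rpow_le_rpow hs.1 h (z := p / 2) (by positivity)
    linarith
  · have := sub_le_sub_of_hasDerivAt_le h (Real.continuous_rpow_const (q := p / 2) (by positivity))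
      (continuous_prim hc)
      (fun x hx => Real.hasDerivAt_rpow_const (p := p / 2) (Or.inl (hη.trans hx.1).ne'))
      (fun x _ => hasDerivAt_prim hc x)
      fun x hx => (powDensity_eq hη hx.1.le (hx.2.le.trans hs.2)).ge
    have h1 := prim_powDensity_nonneg (R := R) hp hη hη.le
    linarith

/-- The density of the regularized `L^p` entropy. -/
noncomputable def lpDensity (p η R s : ℝ) : ℝ := 4 * (p - 1) / p * powDensity p η R s ^ 2

theorem continuous_lpDensity (hp : 1 ≤ p) (hη : 0 < η) : Continuous (lpDensity p η R) :=
  continuous_const.mul ((continuous_powDensity hp hη).pow 2)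

theorem hasCompactSupport_lpDensity : HasCompactSupport (lpDensity p η R) :=
  (hasCompactSupport_powDensity.comp_left (g := fun x => x ^ 2) (by simp)).mul_left

theorem lpDensity_nonneg (hp : 1 ≤ p) (s : ℝ) : 0 ≤ lpDensity p η R s :=
  mul_nonneg (div_nonneg (by linarith) (by linarith)) (sq_nonneg _)

theorem sq_rpow_half_sub_one (p : ℝ) {s : ℝ} (hs : 0 < s) :
    (s ^ (p / 2 - 1)) ^ 2 = s ^ (p - 2) := by
  rw [← Real.rpow_natCast, ← Real.rpow_mul hs.le]
  congr 1
  push_cast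
  ring

theorem lpDensity_le (hp : 1 ≤ p) (hη : 0 < η) {s : ℝ} (hs : 0 < s) (hsR : s ≤ R) :
    lpDensity p η R s ≤ p * ((p - 1) * s ^ (p - 1 - 1)) := by
  have h1 := pow_le_pow_left₀ (powDensity_nonneg hp hη s) (powDensity_le hp hη hs hsR) 2
  rw [mul_pow, sq_rpow_half_sub_one p hs] at h1
  have h2 : 0 ≤ 4 * (p - 1) / p := div_nonneg (by linarith) (by linarith)
  refine (mul_le_mul_of_nonneg_left h1 h2).trans (le_of_eq ?_)
  have hp0 : p ≠ 0 := by positivity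
  rw [show p - 1 - 1 = p - 2 by ring]
  field_simp
  ring

theorem lpDensity_eq (hp : 1 ≤ p) (hη : 0 < η) {s : ℝ} (hs : η ≤ s) (hsR : s ≤ R) :
    lpDensity p η R s = p * ((p - 1) * s ^ (p - 1 - 1)) := by
  rw [lpDensity, powDensity_eq hη hs hsR, mul_pow, sq_rpow_half_sub_one p (hη.trans_le hs)]
  have hp0 : p ≠ 0 := by positivity
  rw [show p - 1 - 1 = p - 2 by ring]
  field_simp
  ring_nf

theorem prim_lpDensity_le (hp : 1 < p) (hη : 0 < η) {s : ℝ} (hs : s ∈ Icc 0 R) :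
    prim (lpDensity p η R) s ≤ p * s ^ (p - 1) := by
  have hc := continuous_lpDensity (R := R) hp.le hη
  have := sub_le_sub_of_hasDerivAt_le hs.1 (continuous_prim hc)
    (continuous_const.mul (Real.continuous_rpow_const (q := p - 1) (by linarith)))
    (fun x _ => hasDerivAt_prim hc x)
    (fun x hx => (Real.hasDerivAt_rpow_const (p := p - 1) (Or.inl hx.1.ne')).const_mul p)
    fun x hx => lpDensity_le hp.le hη hx.1 (hx.2.le.trans hs.2)
  simp only [Pi.mul_apply] at this
  rwa [prim_zero, Real.zero_rpow (by linarith), mul_zero, sub_zero, sub_zero] at this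

theorem le_prim_lpDensity_add (hp : 1 < p) (hη : 0 < η) {s : ℝ} (hs : s ∈ Icc 0 R) :
    p * s ^ (p - 1) ≤ prim (lpDensity p η R) s + p * η ^ (p - 1) := by
  have hc := continuous_lpDensity (R := R) hp.le hη
  have hnn : ∀ s, 0 ≤ s → 0 ≤ prim (lpDensity p η R) s := fun s hs => by
    have := monotone_prim hc (lpDensity_nonneg hp.le) hs
    rwa [prim_zero] at this
  rcases le_total s η with h | h
  · have h1 := hnn s hs.1
    have h2 := mul_le_mul_of_nonneg_left (Real.rpow_le_rpow hs.1 h (z := p - 1) (by linarith))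
      (show 0 ≤ p by linarith)
    linarith
  · have := sub_le_sub_of_hasDerivAt_le h
      (continuous_const.mul (Real.continuous_rpow_const (q := p - 1) (by linarith)))
      (continuous_prim hc)
      (fun x hx => (Real.hasDerivAt_rpow_const (p := p - 1)
        (Or.inl (hη.trans hx.1).ne')).const_mul p)
      (fun x _ => hasDerivAt_prim hc x)
      fun x hx => (lpDensity_eq hp.le hη hx.1.le (hx.2.le.trans hs.2)).ge
    have h1 := hnn η hη.le
    simp only [Pi.mul_apply] at this
    linarith

theorem entropy_lpDensity_le (hp : 1 < p) (hη : 0 < η) {s : ℝ} (hs : s ∈ Icc 0 R) :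
    entropy (lpDensity p η R) s ≤ s ^ p := by
  have hc := continuous_lpDensity (R := R) hp.le hη
  have := sub_le_sub_of_hasDerivAt_le hs.1 (continuous_entropy hc)
    (Real.continuous_rpow_const (q := p) (by linarith))
    (fun x _ => hasDerivAt_entropy hc x)
    (fun x hx => Real.hasDerivAt_rpow_const (p := p) (Or.inl hx.1.ne'))
    fun x hx => prim_lpDensity_le hp hη ⟨hx.1.le, hx.2.le.trans hs.2⟩
  rwa [entropy_zero, Real.zero_rpow (by linarith), sub_zero, sub_zero] at this

theorem le_entropy_lpDensity_add (hp : 1 < p) (hη : 0 < η) {s : ℝ} (hs : s ∈ Icc 0 R) :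
    s ^ p ≤ entropy (lpDensity p η R) s + p * η ^ (p - 1) * s := by
  have hc := continuous_lpDensity (R := R) hp.le hη
  have := sub_le_sub_of_hasDerivAt_le hs.1
    (Real.continuous_rpow_const (q := p) (by linarith))
    ((continuous_entropy hc).add (continuous_const.mul continuous_id))
    (fun x hx => Real.hasDerivAt_rpow_const (p := p) (Or.inl hx.1.ne'))
    (fun x _ => (hasDerivAt_entropy hc x).add ((hasDerivAt_id x).const_mul (p * η ^ (p - 1))))
    fun x hx => by
      rw [mul_one]
      exact le_prim_lpDensity_add hp hη ⟨hx.1.le, hx.2.le.trans hs.2⟩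
  simpa [entropy_zero, Real.zero_rpow (show p ≠ 0 by linarith)] using this

theorem entropyDual_lpDensity_le (hp : 1 < p) (hη : 0 < η) {s : ℝ} (hs : s ∈ Icc 0 R) :
    entropyDual (lpDensity p η R) s ≤ (p - 1) * s ^ p := by
  have hc := continuous_lpDensity (R := R) hp.le hη
  have := sub_le_sub_of_hasDerivAt_le hs.1 (continuous_entropyDual hc)
    (continuous_const.mul (Real.continuous_rpow_const (q := p) (by linarith)))
    (fun x _ => hasDerivAt_entropyDual hc x)
    (fun x hx => (Real.hasDerivAt_rpow_const (p := p) (Or.inl hx.1.ne')).const_mul (p - 1))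
    fun x hx => by
      have h1 := mul_le_mul_of_nonneg_left (lpDensity_le hp.le hη hx.1 (hx.2.le.trans hs.2)) hx.1.le
      refine h1.trans (le_of_eq ?_)
      rw [Real.rpow_sub_one hx.1.ne' (p - 1)]
      have := hx.1.ne'
      field_simp
  simp only [Pi.mul_apply] at this
  rwa [entropyDual_zero, Real.zero_rpow (by linarith), mul_zero, sub_zero, sub_zero] at this

/-- The error made by replacing `s ^ (p / 2)` with its regularization. -/
theorem rpow_add_one_le (hp : 1 ≤ p) (hη : 0 < η) {s : ℝ} (hs : s ∈ Icc 0 R) :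
    s ^ (p + 1) ≤ (prim (powDensity p η R) s ^ (2 / p)) ^ (p + 1) +
      2 * (p + 1) / p * (R ^ (p / 2) * η ^ (p / 2)) * s := by
  have hp0 : 0 < p := by linarith
  set w := prim (powDensity p η R) s
  set q := 2 * (p + 1) / p
  have hq : 2 ≤ q := by
    rw [le_div_iff₀ hp0]; linarith
  have hw0 : 0 ≤ w := prim_powDensity_nonneg hp hη hs.1
  have hwy : w ≤ s ^ (p / 2) := prim_powDensity_le hp hη hs
  have hyw : s ^ (p / 2) ≤ w + η ^ (p / 2) := rpow_le_prim_powDensity_add hp hη hs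
  set y := s ^ (p / 2)
  have hy0 : 0 ≤ y := hw0.trans hwy
  have key := sub_le_sub_of_hasDerivAt_le hwy (Real.continuous_rpow_const (q := q) (by linarith))
    (continuous_const.mul continuous_id)
    (fun x hx => Real.hasDerivAt_rpow_const (p := q) (Or.inl (hw0.trans_lt hx.1).ne'))
    (fun x _ => (hasDerivAt_id x).const_mul (q * y ^ (q - 1)))
    fun x hx => by
      rw [mul_one]
      exact mul_le_mul_of_nonneg_left (Real.rpow_le_rpow (hw0.trans hx.1.le) hx.2.le (by linarith))
        (by linarith)
  have e1 : y ^ q = s ^ (p + 1) := by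
    rw [← Real.rpow_mul hs.1]
    congr 1
    simp only [q]
    field_simp
  have e2 : (w ^ (2 / p)) ^ (p + 1) = w ^ q := by
    rw [← Real.rpow_mul hw0]
    congr 1
    simp only [q]
    ring
  have e3 : y ^ (q - 1) ≤ R ^ (p / 2) * s := by
    have : y ^ (q - 1) = s ^ (p / 2) * s := by
      rw [← Real.rpow_mul hs.1, ← Real.rpow_add_one' hs.1 (by positivity)]
      congr 1
      simp only [q]
      field_simp
      ring
    rw [this]
    exact mul_le_mul_of_nonneg_right (Real.rpow_le_rpow hs.1 hs.2 (by positivity)) hs.1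
  have hη' : 0 ≤ η ^ (p / 2) := (Real.rpow_pos_of_pos hη _).le
  have e4 : q * y ^ (q - 1) * (y - w) ≤ q * (R ^ (p / 2) * s) * η ^ (p / 2) := by
    refine mul_le_mul (mul_le_mul_of_nonneg_left e3 (by linarith)) (by linarith) (by linarith) ?_
    have : 0 ≤ y ^ (q - 1) := Real.rpow_nonneg hy0 _
    exact mul_nonneg (by linarith) (this.trans e3)
  rw [e2, ← e1]
  simp only [Pi.mul_apply, id] at key
  linarith

end PowDensity

/-! ### Monotonicity of the `L^p` norms -/

theorem integral_mul_kernelDelta_snd {ε : ℝ} (hε : 0 < ε) {f : ℝ × ℝ → ℝ} (hf : Integrable f) :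
    Integrable (fun p : (ℝ × ℝ) × (ℝ × ℝ) => f p.2 * kernelDelta ε (p.1 - p.2)) ∧
    ∫ p : (ℝ × ℝ) × (ℝ × ℝ), f p.2 * kernelDelta ε (p.1 - p.2) = ∫ z, f z := by
  have hi : Integrable (fun p : (ℝ × ℝ) × (ℝ × ℝ) => f p.2 * kernelDelta ε (p.1 - p.2)) :=
    hf.convolution_integrand (ContinuousLinearMap.mul ℝ ℝ) (integrable_kernelDelta hε)
  refine ⟨hi, ?_⟩
  rw [Measure.volume_eq_prod, integral_prod_symm _ hi]
  refine integral_congr_ae (ae_of_all _ fun w => ?_)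
  simp only
  rw [integral_const_mul, integral_sub_right_eq_self (fun z => kernelDelta ε z),
    integral_kernelDelta hε, mul_one]

theorem integral_mul_kernelDelta_fst {ε : ℝ} (hε : 0 < ε) {f : ℝ × ℝ → ℝ} (hf : Integrable f) :
    Integrable (fun p : (ℝ × ℝ) × (ℝ × ℝ) => f p.1 * kernelDelta ε (p.1 - p.2)) ∧
    ∫ p : (ℝ × ℝ) × (ℝ × ℝ), f p.1 * kernelDelta ε (p.1 - p.2) = ∫ z, f z := by
  obtain ⟨h1, h2⟩ := integral_mul_kernelDelta_snd hε hf
  have e : (fun p : (ℝ × ℝ) × (ℝ × ℝ) => f p.1 * kernelDelta ε (p.1 - p.2)) =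
      (fun p : (ℝ × ℝ) × (ℝ × ℝ) => f p.2 * kernelDelta ε (p.1 - p.2)) ∘ Prod.swap := by
    ext p
    simp only [Function.comp_apply, Prod.fst_swap, Prod.snd_swap]
    rw [← kernelDelta_neg ε (p.1 - p.2), neg_sub]
  rw [e]
  refine ⟨h1.swap, ?_⟩
  rw [← h2]
  exact integral_prod_swap (μ := (volume : Measure (ℝ × ℝ))) (ν := (volume : Measure (ℝ × ℝ)))
    (fun p : (ℝ × ℝ) × (ℝ × ℝ) => f p.2 * kernelDelta ε (p.1 - p.2))

/-- Since `δ^(ε)` has integral one, Young's inequality gives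
`∫ u ^ p (δ^(ε) * u) ≤ ∫ u ^ (p + 1)`. -/
theorem interaction_le {ε : ℝ} (hε : 0 < ε) {p c : ℝ} (hp : 0 < p) (hc : 0 ≤ c)
    {v u : ℝ × ℝ → ℝ} (hv : Integrable v) (hu : Integrable u)
    (hup : Integrable (fun z => u z ^ (p + 1))) (hu0 : ∀ᵐ z, 0 ≤ u z)
    (hvu : ∀ᵐ z, v z ≤ c * u z ^ p) :
    interaction ε v u ≤ c * ∫ z, u z ^ (p + 1) := by
  obtain ⟨i1, e1⟩ := integral_mul_kernelDelta_fst hε hup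
  obtain ⟨i2, e2⟩ := integral_mul_kernelDelta_snd hε hup
  have hp1 : p + 1 ≠ 0 := by positivity
  have e3 : c * ∫ z, u z ^ (p + 1) =
      ∫ q : (ℝ × ℝ) × (ℝ × ℝ), c * (p / (p + 1) * (u q.1 ^ (p + 1) * kernelDelta ε (q.1 - q.2)) +
        1 / (p + 1) * (u q.2 ^ (p + 1) * kernelDelta ε (q.1 - q.2))) := by
    rw [integral_const_mul, integral_add (i1.const_mul _) (i2.const_mul _), integral_const_mul,
      integral_const_mul, e1, e2]
    field_simp
  rw [e3]
  refine integral_mono_ae (integrable_interaction hε hv hu)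
    (((i1.const_mul _).add (i2.const_mul _)).const_mul c) ?_
  rw [Measure.volume_eq_prod]
  filter_upwards [Measure.quasiMeasurePreserving_fst.ae hu0,
    Measure.quasiMeasurePreserving_snd.ae hu0, Measure.quasiMeasurePreserving_fst.ae hvu]
    with q h1 h2 h3
  have hk := kernelDelta_nonneg hε (q.1 - q.2)
  have young := Real.geom_mean_le_arith_mean2_weighted (w₁ := p / (p + 1)) (w₂ := 1 / (p + 1))
    (by positivity) (by positivity) (Real.rpow_nonneg h1 (p + 1)) (Real.rpow_nonneg h2 (p + 1))
    (by field_simp)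
  rw [← Real.rpow_mul h1, ← Real.rpow_mul h2, mul_div_cancel₀ _ hp1, mul_one_div_cancel hp1,
    Real.rpow_one] at young
  have h4 : v q.1 * u q.2 ≤ c * (u q.1 ^ p * u q.2) := by
    rw [← mul_assoc]
    exact mul_le_mul_of_nonneg_right h3 h2
  have h5 := mul_le_mul_of_nonneg_right (h4.trans (mul_le_mul_of_nonneg_left young hc)) hk
  refine h5.trans (le_of_eq ?_)
  ring

/-- The chain rule for a primitive of `ψ`, with the resulting Dirichlet energy. -/
theorem exists_hasWeakGradient_prim {ψ : ℝ → ℝ} (hc : Continuous ψ) (hs : HasCompactSupport ψ)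
    {u g₁ g₂ : L2Plane} (hu : HasWeakGradient u g₁ g₂) :
    ∃ w v₁ v₂ : L2Plane, (∀ᵐ z, w z = prim ψ (u z)) ∧ HasWeakGradient w v₁ v₂ ∧
      ∫ z, ψ (u z) ^ 2 * (g₁ z ^ 2 + g₂ z ^ 2) = ‖v₁‖ ^ 2 + ‖v₂‖ ^ 2 := by
  let ψb : ℝ →ᵇ ℝ := ofCompactSupport ψ hc hs
  have hΦ : ∀ s, HasDerivAt (prim ψ) (ψb s) s := fun s => hasDerivAt_prim hc s
  refine ⟨_, nemMul ψb u g₁, nemMul ψb u g₂,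
    (lipschitzWith_of_hasDerivAt ψb hΦ).coeFn_compLp prim_zero u, hu.comp ψb hΦ prim_zero, ?_⟩
  rw [l2_norm_sq_eq, l2_norm_sq_eq, ← integral_add (Lp.memLp _).integrable_sq
    (Lp.memLp _).integrable_sq]
  refine integral_congr_ae ?_
  filter_upwards [coeFn_nemMul ψb u g₁, coeFn_nemMul ψb u g₂] with z h1 h2
  rw [h1, h2]
  have : ψb (u z) = ψ (u z) := rfl
  rw [this]
  ring

theorem integral_le_gnsConst {p : ℝ} (hp : 1 ≤ p) {ξ : ℝ × ℝ → ℝ} {u g₁ g₂ : L2Plane}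
    (hξ0 : ∀ᵐ z, 0 ≤ ξ z) (hξ : Integrable ξ) (hξp : Integrable (fun z => ξ z ^ (p + 1)))
    (hu : HasWeakGradient u g₁ g₂) (huξ : ∀ᵐ z, u z = ξ z ^ (p / 2)) :
    ∫ z, ξ z ^ (p + 1) ≤ gnsConst p * (∫ z, ξ z) * (‖g₁‖ ^ 2 + ‖g₂‖ ^ 2) := by
  have h1 := lintegral_le_gnsConst hp hξ0 hξ hu huξ
  rw [← ofReal_integral_eq_lintegral_ofReal hξp (hξ0.mono fun z hz => Real.rpow_nonneg hz _)] at h1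
  refine (ENNReal.ofReal_le_ofReal_iff ?_).1 h1
  have := gnsConst_nonneg hp
  have := integral_nonneg_of_ae hξ0
  positivity

theorem integrable_rpow_of_le {f : ℝ × ℝ → ℝ} (hf : Integrable f) (hf0 : ∀ᵐ z, 0 ≤ f z) {R : ℝ}
    (hfR : ∀ᵐ z, f z ≤ R) {p : ℝ} (hp : 1 ≤ p) : Integrable (fun z => f z ^ p) := by
  refine (hf.const_mul (R ^ (p - 1))).mono'
    ((Real.continuous_rpow_const (by linarith)).comp_aestronglyMeasurable hf.aestronglyMeasurable) ?_
  filter_upwards [hf0, hfR] with z h1 h2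
  rw [Real.norm_of_nonneg (Real.rpow_nonneg h1 _)]
  calc f z ^ p = f z ^ (p - 1) * f z := by
        rw [← Real.rpow_add_one' h1 (by linarith)]
        congr 1
        ring
    _ ≤ R ^ (p - 1) * f z :=
        mul_le_mul_of_nonneg_right (Real.rpow_le_rpow h1 h2 (by linarith)) h1

/-- The rate of change of the regularized `L^p` entropy: the Gagliardo-Nirenberg-Sobolev inequality
absorbs the drift into the dissipation, up to an error vanishing with the regularization. -/
theorem energyRate_lpDensity_le {D ε p η R : ℝ} (hε : 0 < ε) (hp : 1 < p) (hη : 0 < η)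
    {u g₁ g₂ : L2Plane} (hu : HasWeakGradient u g₁ g₂) (hi : Integrable u)
    (hu0 : ∀ᵐ z, 0 ≤ u z) (huR : ∀ᵐ z, u z ≤ R) (hD : p * gnsConst p * (∫ z, u z) ≤ D) :
    energyRate D ε (lpDensity p η R) u g₁ g₂ ≤
      4 * (p - 1) * (2 * (p + 1) / p * (R ^ (p / 2) * η ^ (p / 2)) * ∫ z, u z) := by
  have hp1 := hp.le
  have hcψ := continuous_powDensity (R := R) hp1 hη
  obtain ⟨w, v₁, v₂, hw, hv, hd⟩ :=
    exists_hasWeakGradient_prim hcψ hasCompactSupport_powDensity hu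
  set d := ‖v₁‖ ^ 2 + ‖v₂‖ ^ 2
  have hd0 : 0 ≤ d := by positivity
  have hC := gnsConst_nonneg hp1
  set M := ∫ z, u z
  have hM : 0 ≤ M := integral_nonneg_of_ae hu0
  have hmem : ∀ᵐ z, u z ∈ Icc 0 R := by filter_upwards [hu0, huR] with z h1 h2 using ⟨h1, h2⟩
  -- dissipation
  have e1 : ∫ z, lpDensity p η R (u z) * (g₁ z ^ 2 + g₂ z ^ 2) = 4 * (p - 1) / p * d := by
    rw [← hd, ← integral_const_mul]
    simp only [lpDensity, mul_assoc]
  -- drift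
  have hup := integrable_rpow_of_le hi hu0 huR (p := p + 1) (by linarith)
  obtain ⟨B, hB⟩ := (continuous_lpDensity (R := R) hp1 hη).bounded_above_of_compact_support
    hasCompactSupport_lpDensity
  have e2 := interaction_le hε (p := p) (c := p - 1) (by linarith) (by linarith)
    (integrable_entropyDual (continuous_lpDensity (R := R) hp1 hη) (lpDensity_nonneg hp1) hB u)
    hi hup hu0 (hmem.mono fun z hz => entropyDual_lpDensity_le hp hη hz)
  -- the Gagliardo-Nirenberg-Sobolev inequality for the regularization of `u`
  set ξ : ℝ × ℝ → ℝ := fun z => prim (powDensity p η R) (u z) ^ (2 / p)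
  have hξ0 : ∀ᵐ z, 0 ≤ ξ z := hmem.mono fun z hz =>
    Real.rpow_nonneg (prim_powDensity_nonneg hp1 hη hz.1) _
  have hξu : ∀ᵐ z, ξ z ≤ u z := hmem.mono fun z hz => by
    have h1 := Real.rpow_le_rpow (prim_powDensity_nonneg (R := R) hp1 hη hz.1)
      (prim_powDensity_le hp1 hη hz) (z := 2 / p) (by positivity)
    rw [← Real.rpow_mul hz.1, show p / 2 * (2 / p) = 1 by field_simp, Real.rpow_one] at h1
    exact h1
  have hξm : AEStronglyMeasurable ξ := by
    have hc : Continuous fun s => prim (powDensity p η R) s ^ (2 / p) :=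
      (continuous_prim hcψ).rpow_const fun s => Or.inr (by positivity)
    exact hc.comp_aestronglyMeasurable (Lp.aestronglyMeasurable u)
  have hξi : Integrable ξ := by
    refine hi.mono' hξm ?_
    filter_upwards [hξ0, hξu] with z h1 h2
    rwa [Real.norm_of_nonneg h1]
  have hξR : ∀ᵐ z, ξ z ≤ R := by filter_upwards [hξu, huR] with z h1 h2 using h1.trans h2
  have hξp := integrable_rpow_of_le hξi hξ0 hξR (p := p + 1) (by linarith)
  have e3 := integral_le_gnsConst hp1 hξ0 hξi hξp hv (by
    filter_upwards [hw, hmem] with z h1 h2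
    rw [h1, ← Real.rpow_mul (prim_powDensity_nonneg hp1 hη h2.1),
      show 2 / p * (p / 2) = 1 by field_simp, Real.rpow_one])
  have e4 : ∫ z, ξ z ≤ M := integral_mono_ae hξi hi hξu
  have e5 : ∫ z, ξ z ^ (p + 1) ≤ gnsConst p * M * d :=
    e3.trans (mul_le_mul_of_nonneg_right (mul_le_mul_of_nonneg_left e4 hC) hd0)
  have e6 : ∫ z, u z ^ (p + 1) ≤ (∫ z, ξ z ^ (p + 1)) +
      2 * (p + 1) / p * (R ^ (p / 2) * η ^ (p / 2)) * M := by
    rw [← integral_const_mul, ← integral_add hξp (hi.const_mul _)]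
    refine integral_mono_ae hup (hξp.add (hi.const_mul _)) ?_
    exact hmem.mono fun z hz => rpow_add_one_le hp1 hη hz
  have e7 : 4 * (p - 1) * (gnsConst p * M * d) ≤ D * (4 * (p - 1) / p * d) := by
    have h1 : p * gnsConst p * M * (4 * (p - 1) / p * d) ≤ D * (4 * (p - 1) / p * d) := by
      refine mul_le_mul_of_nonneg_right hD ?_
      have : 0 ≤ 4 * (p - 1) / p := div_nonneg (by linarith) (by linarith)
      positivity
    refine le_trans (le_of_eq ?_) h1
    field_simp
  have e8 : 4 * (p - 1) * (∫ z, u z ^ (p + 1)) ≤ 4 * (p - 1) * (gnsConst p * M * d +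
      2 * (p + 1) / p * (R ^ (p / 2) * η ^ (p / 2)) * M) :=
    mul_le_mul_of_nonneg_left (e6.trans (by linarith)) (by linarith)
  unfold energyRate
  rw [e1]
  linarith

section LpNorm

variable {D ε : ℝ} {ρ₀ : ℝ × ℝ → ℝ} {ρ : ℝ → L2Plane}

theorem IsRegularizedSolution.integrable_rpow (hD : 0 ≤ D) (hε : 0 < ε)
    (hρ : IsRegularizedSolution D ε ρ₀ ρ) (hρ₀ : ∀ᵐ z, 0 ≤ ρ₀ z) {A : ℝ} (hA : ∀ᵐ z, ρ₀ z ≤ A)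
    {p : ℝ} (hp : 1 ≤ p) {t : ℝ} (ht : 0 ≤ t) : Integrable (fun z => ρ t z ^ p) := by
  obtain ⟨k, -, hk⟩ := hρ.exists_ae_le hD hε hρ₀ hA t
  exact integrable_rpow_of_le (hρ.integrable ht) (hρ.ae_nonneg hD hε hρ₀ ht) (hk t ⟨ht, le_rfl⟩) hp

/-- The `L^p` norm of a solution of small mass does not increase. -/
theorem IsRegularizedSolution.integral_rpow_le (hD : 0 ≤ D) (hε : 0 < ε)
    (hρ : IsRegularizedSolution D ε ρ₀ ρ) (hρ₀ : ∀ᵐ z, 0 ≤ ρ₀ z) {A : ℝ} (hA : ∀ᵐ z, ρ₀ z ≤ A)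
    {p : ℝ} (hp : 1 < p) (hDp : p * gnsConst p * (∫ z, ρ₀ z) ≤ D) {t : ℝ} (ht : 0 ≤ t) :
    ∫ z, ρ t z ^ p ≤ ∫ z, ρ₀ z ^ p := by
  obtain ⟨G₁, G₂, hG⟩ := hρ.exists_gradient
  obtain ⟨R, hR, hk⟩ := hρ.exists_ae_le hD hε hρ₀ hA t
  have hp1 := hp.le
  set M := ∫ z, ρ₀ z
  have hmem : ∀ s ∈ Icc 0 t, ∀ᵐ z, ρ s z ∈ Icc 0 R := fun s hs => by
    filter_upwards [hρ.ae_nonneg hD hε hρ₀ hs.1, hk s hs] with z h1 h2 using ⟨h1, h2⟩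
  have ht' : t ∈ Icc 0 t := ⟨ht, le_rfl⟩
  have h0' : (0 : ℝ) ∈ Icc 0 t := ⟨le_rfl, ht⟩
  have e0 : ∫ z, ρ₀ z ^ p = ∫ z, ρ 0 z ^ p :=
    integral_congr_ae (hρ.initial.mono fun z hz => by simp only [hz])
  rw [e0]
  have ip : ∀ s ∈ Icc 0 t, Integrable (fun z => ρ s z ^ p) := fun s hs =>
    hρ.integrable_rpow hD hε hρ₀ hA hp1 hs.1
  set c := 4 * (p - 1) * (2 * (p + 1) / p * R ^ (p / 2) * M) * t
  have key : ∀ η > 0, ∫ z, ρ t z ^ p ≤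
      (∫ z, ρ 0 z ^ p) + (c * η ^ (p / 2) + p * M * η ^ (p - 1)) := by
    intro η hη
    have hc := continuous_lpDensity (R := R) hp1 hη
    have hs := hasCompactSupport_lpDensity (p := p) (η := η) (R := R)
    have h0 := lpDensity_nonneg (η := η) (R := R) hp1
    obtain ⟨B, hB⟩ := hc.bounded_above_of_compact_support hs
    have ie := fun s => integrable_entropy hc h0 hB (ρ s)
    obtain ⟨h1, h2⟩ := energy_inequality hε hρ hG hc hs h0 le_rfl ht
    have h3 : ∫ s in Ioc 0 t, energyRate D ε (lpDensity p η R) (ρ s) (G₁ s) (G₂ s) ≤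
        ∫ s in Ioc 0 t, 4 * (p - 1) * (2 * (p + 1) / p * (R ^ (p / 2) * η ^ (p / 2)) * M) := by
      refine setIntegral_mono_ae_restrict h1 (integrable_const _) ?_
      filter_upwards [ae_restrict_of_ae_restrict_of_subset (fun s hs => hs.1) hG.weakGradient,
        ae_restrict_mem measurableSet_Ioc] with s hs hst
      have hst' : s ∈ Icc 0 t := ⟨hst.1.le, hst.2⟩
      have hM := hρ.integral_eq hε hst.1.le
      have := energyRate_lpDensity_le (D := D) hε hp hη hs (hρ.integrable hst.1.le)
        (hρ.ae_nonneg hD hε hρ₀ hst.1.le) (hk s hst') (by rwa [hM])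
      rwa [hM] at this
    rw [setIntegral_const, smul_eq_mul, measureReal_def, Real.volume_Ioc, sub_zero,
      ENNReal.toReal_ofReal ht] at h3
    have h4 : ∫ z, ρ t z ^ p ≤ (∫ z, entropy (lpDensity p η R) (ρ t z)) + p * η ^ (p - 1) * M := by
      rw [show M = ∫ z, ρ t z from (hρ.integral_eq hε ht).symm, ← integral_const_mul,
        ← integral_add (ie t) ((hρ.integrable ht).const_mul _)]
      refine integral_mono_ae (ip t ht') ((ie t).add ((hρ.integrable ht).const_mul _)) ?_
      exact (hmem t ht').mono fun z hz => le_entropy_lpDensity_add hp hη hz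
    have h5 : ∫ z, entropy (lpDensity p η R) (ρ 0 z) ≤ ∫ z, ρ 0 z ^ p :=
      integral_mono_ae (ie 0) (ip 0 h0')
        ((hmem 0 h0').mono fun z hz => entropy_lpDensity_le hp hη hz)
    have h6 : c * η ^ (p / 2) =
        t * (4 * (p - 1) * (2 * (p + 1) / p * (R ^ (p / 2) * η ^ (p / 2)) * M)) := by
      simp only [c]; ring
    linarith
  have lim : Tendsto (fun η : ℝ => (∫ z, ρ 0 z ^ p) + (c * η ^ (p / 2) + p * M * η ^ (p - 1)))
      (𝓝[>] 0) (𝓝 ((∫ z, ρ 0 z ^ p) + (c * 0 ^ (p / 2) + p * M * 0 ^ (p - 1)))) := by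
    have h1 := (Real.continuous_rpow_const (q := p / 2) (by positivity)).tendsto 0
    have h2 := (Real.continuous_rpow_const (q := p - 1) (by linarith)).tendsto 0
    exact (((h1.const_mul c).add (h2.const_mul (p * M))).const_add _).mono_left nhdsWithin_le_nhds
  rw [Real.zero_rpow (by positivity), Real.zero_rpow (by linarith), mul_zero, mul_zero, add_zero,
    add_zero] at lim
  exact ge_of_tendsto lim (eventually_mem_nhdsWithin.mono fun η hη => key η hη)

end LpNorm

/-! ### Uniform boundedness by iteration over dyadic powers -/

theorem sq_integral_mul_le {f g : ℝ × ℝ → ℝ} (hf : MemLp f 2) (hg : MemLp g 2) :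
    (∫ z, f z * g z) ^ 2 ≤ (∫ z, f z ^ 2) * ∫ z, g z ^ 2 := by
  rw [← toLp_norm_sq_eq hf, ← toLp_norm_sq_eq hg, ← mul_pow, ← sq_abs]
  have h : ∫ z, f z * g z = inner ℝ (hf.toLp f) (hg.toLp g) := by
    rw [l2_inner_toLp]
    refine integral_congr_ae ?_
    filter_upwards [hf.coeFn_toLp] with z hz
    rw [hz]
  rw [h]
  exact pow_le_pow_left₀ (abs_nonneg _) (abs_real_inner_le_norm _ _) 2

theorem integrable_pow_of_le {f : ℝ × ℝ → ℝ} (hf : Integrable f) (hf0 : ∀ᵐ z, 0 ≤ f z) {R : ℝ}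
    (hfR : ∀ᵐ z, f z ≤ R) {n : ℕ} (hn : n ≠ 0) : Integrable (fun z => f z ^ n) := by
  have := integrable_rpow_of_le hf hf0 hfR (p := n) (by exact_mod_cast Nat.one_le_iff_ne_zero.2 hn)
  simpa only [Real.rpow_natCast] using this

/-- The derivative of `s ^ (n + 1)` on `[0, R]`, cut off to have compact support. -/
noncomputable def natDensity (n : ℕ) (R s : ℝ) : ℝ := (n + 1) * max s 0 ^ n * plateau R s

section NatDensity

variable {n : ℕ} {R : ℝ}

theorem continuous_natDensity : Continuous (natDensity n R) :=
  (continuous_const.mul ((continuous_id.max continuous_const).pow n)).mul (continuous_plateau R)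

theorem hasCompactSupport_natDensity : HasCompactSupport (natDensity n R) :=
  (hasCompactSupport_plateau R).mul_left

theorem natDensity_eq {s : ℝ} (hs : s ∈ Icc 0 R) : natDensity n R s = (n + 1) * s ^ n := by
  rw [natDensity, plateau_eq_one (by rw [abs_of_nonneg hs.1]; exact hs.2), max_eq_left hs.1, mul_one]

theorem prim_const_mul (c : ℝ) (h : ℝ → ℝ) : prim (fun x => c * h x) = fun s => c * prim h s := by
  ext s
  simp [prim]

theorem prim_natDensity {s : ℝ} (hs : s ∈ Icc 0 R) : prim (natDensity n R) s = s ^ (n + 1) := by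
  rw [prim_congr (g := fun x => ((n : ℝ) + 1) * x ^ n) hs.1
    fun x hx => natDensity_eq ⟨hx.1, hx.2.trans hs.2⟩, prim_const_mul]
  simp only [prim_pow]
  field_simp

/-- The density of the entropy `s ^ (2 n + 2)` on `[0, R]`. -/
noncomputable def evenDensity (n : ℕ) (R s : ℝ) : ℝ :=
  2 * (2 * n + 1) / (n + 1) * natDensity n R s ^ 2

theorem continuous_evenDensity : Continuous (evenDensity n R) :=
  continuous_const.mul (continuous_natDensity.pow 2)

theorem hasCompactSupport_evenDensity : HasCompactSupport (evenDensity n R) :=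
  (hasCompactSupport_natDensity.comp_left (g := fun x => x ^ 2) (by simp)).mul_left

theorem evenDensity_nonneg (s : ℝ) : 0 ≤ evenDensity n R s := by
  unfold evenDensity
  positivity

theorem evenDensity_eq {s : ℝ} (hs : s ∈ Icc 0 R) :
    evenDensity n R s = (2 * (2 * n + 1) * (n + 1)) * s ^ (2 * n) := by
  rw [evenDensity, natDensity_eq hs]
  field_simp
  ring

theorem prim_evenDensity {s : ℝ} (hs : s ∈ Icc 0 R) :
    prim (evenDensity n R) s = (2 * n + 2) * s ^ (2 * n + 1) := by
  rw [prim_congr (g := fun x => (2 * (2 * n + 1) * (n + 1) : ℝ) * x ^ (2 * n)) hs.1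
    fun x hx => evenDensity_eq ⟨hx.1, hx.2.trans hs.2⟩, prim_const_mul]
  simp only [prim_pow]
  push_cast
  field_simp

theorem entropy_evenDensity {s : ℝ} (hs : s ∈ Icc 0 R) :
    entropy (evenDensity n R) s = s ^ (2 * n + 2) := by
  rw [entropy, prim_congr (g := fun x => (2 * n + 2 : ℝ) * x ^ (2 * n + 1)) hs.1
    fun x hx => prim_evenDensity ⟨hx.1, hx.2.trans hs.2⟩, prim_const_mul]
  simp only [prim_pow]
  push_cast
  field_simp
  ring

theorem entropyDual_evenDensity {s : ℝ} (hs : s ∈ Icc 0 R) :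
    entropyDual (evenDensity n R) s = (2 * n + 1) * s ^ (2 * n + 2) := by
  rw [entropyDual, prim_evenDensity hs, entropy_evenDensity hs]
  ring

end NatDensity

/-- If `∫ u ^ (2 n + 2)` is large compared with `(∫ u ^ (n + 1)) ^ 2`, then the dissipation of the
entropy `u ^ (2 n + 2)` dominates the drift. -/
theorem energyRate_evenDensity_nonpos {D ε R : ℝ} (hD : 0 < D) (hε : 0 < ε) {n : ℕ}
    {u g₁ g₂ : L2Plane} (hu : HasWeakGradient u g₁ g₂) (hi : Integrable u)
    (hu0 : ∀ᵐ z, 0 ≤ u z) (huR : ∀ᵐ z, u z ≤ R) {S Z : ℝ} (hS : ∫ z, u z ^ 2 ≤ S)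
    (hZ : ∫ z, u z ^ (n + 1) ≤ Z)
    (hy : 4 * (n + 1) ^ 2 * S * gnsConst 1 * gnsConst 2 * Z ^ 2 ≤
      D ^ 2 * ∫ z, u z ^ (2 * n + 2)) :
    energyRate D ε (evenDensity n R) u g₁ g₂ ≤ 0 := by
  obtain ⟨w, v₁, v₂, hw, hv, hd⟩ :=
    exists_hasWeakGradient_prim (continuous_natDensity (n := n) (R := R))
      hasCompactSupport_natDensity hu
  set d := ‖v₁‖ ^ 2 + ‖v₂‖ ^ 2
  have hd0 : 0 ≤ d := by positivity
  have hmem : ∀ᵐ z, u z ∈ Icc 0 R := by filter_upwards [hu0, huR] with z h1 h2 using ⟨h1, h2⟩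
  have ip : ∀ {m : ℕ}, m ≠ 0 → Integrable (fun z => u z ^ m) :=
    fun hm => integrable_pow_of_le hi hu0 huR hm
  have nn : ∀ m : ℕ, 0 ≤ ∫ z, u z ^ m := fun m =>
    integral_nonneg_of_ae (hu0.mono fun z hz => pow_nonneg hz m)
  have hC1 := gnsConst_nonneg (le_refl (1 : ℝ))
  have hC2 := gnsConst_nonneg (one_le_two (α := ℝ))
  have hw' : ∀ᵐ z, w z = u z ^ (n + 1) := by
    filter_upwards [hw, hmem] with z h1 h2
    rw [h1, prim_natDensity h2]
  have e1 : ∫ z, evenDensity n R (u z) * (g₁ z ^ 2 + g₂ z ^ 2) =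
      2 * (2 * n + 1) / (n + 1) * d := by
    rw [← hd, ← integral_const_mul]
    simp only [evenDensity, mul_assoc]
  obtain ⟨B, hB⟩ := (continuous_evenDensity (n := n) (R := R)).bounded_above_of_compact_support
    hasCompactSupport_evenDensity
  have e2 : interaction ε (fun z => entropyDual (evenDensity n R) (u z)) u ≤
      (2 * n + 1) * ∫ z, u z ^ (2 * n + 3) := by
    have h1 := interaction_le hε (p := (2 * n + 2 : ℕ)) (c := 2 * n + 1) (by positivity)
      (by positivity) (integrable_entropyDual (continuous_evenDensity (n := n) (R := R))
        evenDensity_nonneg hB u) hi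
      (integrable_rpow_of_le hi hu0 huR (by push_cast; linarith [Nat.cast_nonneg (α := ℝ) n])) hu0
      (hmem.mono fun z hz => by rw [Real.rpow_natCast]; exact (entropyDual_evenDensity hz).le)
    have h2 : (((2 * n + 2 : ℕ) : ℝ) + 1) = ((2 * n + 3 : ℕ) : ℝ) := by push_cast; ring
    rw [h2] at h1
    simpa only [Real.rpow_natCast] using h1
  set X := ∫ z, u z ^ (2 * n + 3)
  set y := ∫ z, u z ^ (2 * n + 2)
  have hX0 : 0 ≤ X := nn _
  have hy0 : 0 ≤ y := nn _
  have mem : ∀ m : ℕ, m ≠ 0 → MemLp (fun z => u z ^ m) 2 := fun m hm => by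
    refine (memLp_two_iff_integrable_sq ((continuous_pow m).comp_aestronglyMeasurable
      (Lp.aestronglyMeasurable u))).2 ?_
    have := ip (m := m * 2) (by simpa using hm)
    simpa only [pow_mul] using this
  have a1 : ∫ z, u z ^ (4 * n + 4) ≤ gnsConst 1 * y * d := by
    have h1 := integral_le_gnsConst (p := 1) le_rfl (ξ := fun z => u z ^ (2 * n + 2))
      (hu0.mono fun z hz => pow_nonneg hz _) (ip (by simp)) (by
        have := ip (m := 4 * n + 4) (by simp)
        refine this.congr (ae_of_all _ fun z => ?_)
        simp only
        rw [one_add_one_eq_two, Real.rpow_two]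
        ring) hv (by
        filter_upwards [hw', hu0] with z h1 h2
        rw [h1, ← Real.sqrt_eq_rpow, show u z ^ (2 * n + 2) = (u z ^ (n + 1)) ^ 2 by ring,
          Real.sqrt_sq (pow_nonneg h2 _)])
    refine le_trans (le_of_eq (integral_congr_ae (ae_of_all _ fun z => ?_))) h1
    simp only
    rw [one_add_one_eq_two, Real.rpow_two]
    ring
  have a2 : ∫ z, u z ^ (3 * n + 3) ≤ gnsConst 2 * (∫ z, u z ^ (n + 1)) * d := by
    have h1 := integral_le_gnsConst (p := 2) one_le_two (ξ := fun z => u z ^ (n + 1))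
      (hu0.mono fun z hz => pow_nonneg hz _) (ip (by simp)) (by
        have := ip (m := 3 * n + 3) (by simp)
        refine this.congr (ae_of_all _ fun z => ?_)
        simp only
        rw [show (2 : ℝ) + 1 = (3 : ℕ) by norm_num, Real.rpow_natCast]
        ring) hv (by
        filter_upwards [hw'] with z h1
        rw [h1, div_self two_ne_zero, Real.rpow_one])
    refine le_trans (le_of_eq (integral_congr_ae (ae_of_all _ fun z => ?_))) h1
    simp only
    rw [show (2 : ℝ) + 1 = (3 : ℕ) by norm_num, Real.rpow_natCast]
    ring
  have b1 : X ^ 2 ≤ S * (gnsConst 1 * y * d) := by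
    have h1 := sq_integral_mul_le (mem 1 one_ne_zero) (mem (2 * n + 2) (by simp))
    have h2 : ∫ z, u z ^ 1 * u z ^ (2 * n + 2) = X :=
      integral_congr_ae (ae_of_all _ fun z => by simp only; ring)
    have h3 : ∫ z, (u z ^ (2 * n + 2)) ^ 2 = ∫ z, u z ^ (4 * n + 4) :=
      integral_congr_ae (ae_of_all _ fun z => by simp only; ring)
    simp only [pow_one] at h1 h2
    rw [h2, h3] at h1
    exact h1.trans (mul_le_mul hS a1 (nn _) ((nn 2).trans hS))
  have b2 : y ^ 2 ≤ gnsConst 2 * Z ^ 2 * d := by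
    -- `u ^ (2 n + 2)` is the geometric mean of `u ^ (n + 1)` and `u ^ (3 n + 3)`
    have sq : ∀ m : ℕ, ∀ᵐ z, (Real.sqrt (u z) ^ m) ^ 2 = u z ^ m := fun m => by
      filter_upwards [hu0] with z hz
      rw [← pow_mul, mul_comm, pow_mul, Real.sq_sqrt hz]
    have ms : ∀ m : ℕ, m ≠ 0 → MemLp (fun z => Real.sqrt (u z) ^ m) 2 := fun m hm =>
      (memLp_two_iff_integrable_sq (((Real.continuous_sqrt).pow m).comp_aestronglyMeasurable
        (Lp.aestronglyMeasurable u))).2 ((ip hm).congr ((sq m).mono fun z hz => hz.symm))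
    have h1 := sq_integral_mul_le (ms (n + 1) (by simp)) (ms (3 * n + 3) (by simp))
    have h2 : ∫ z, Real.sqrt (u z) ^ (n + 1) * Real.sqrt (u z) ^ (3 * n + 3) = y := by
      refine integral_congr_ae ?_
      filter_upwards [hu0] with z hz
      rw [← pow_add, show n + 1 + (3 * n + 3) = 2 * (2 * n + 2) by ring, pow_mul, Real.sq_sqrt hz]
    rw [h2, integral_congr_ae (sq (n + 1)), integral_congr_ae (sq (3 * n + 3))] at h1
    have hZ0 := (nn (n + 1)).trans hZ
    have h5 : gnsConst 2 * (∫ z, u z ^ (n + 1)) * d ≤ gnsConst 2 * Z * d :=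
      mul_le_mul_of_nonneg_right (mul_le_mul_of_nonneg_left hZ hC2) hd0
    calc y ^ 2 ≤ _ := h1
      _ ≤ Z * (gnsConst 2 * Z * d) := mul_le_mul hZ (a2.trans h5) (nn _) hZ0
      _ = _ := by ring
  have fin : 2 * (n + 1) * X ≤ D * d := by
    have hS0 := (nn 2).trans hS
    have hn : (0 : ℝ) ≤ n := Nat.cast_nonneg n
    have hCZ : 0 ≤ gnsConst 2 * Z ^ 2 := by positivity
    rcases hCZ.eq_or_lt with h | h
    · rw [← h, zero_mul] at b2
      have hy' : y = 0 := by nlinarith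
      rw [hy', mul_zero, zero_mul, mul_zero] at b1
      have hX' : X = 0 := by nlinarith
      rw [hX', mul_zero]
      positivity
    · have h1 : 4 * (n + 1) ^ 2 * S * gnsConst 1 * y ≤ D ^ 2 * d := by
        have h2 : (4 * (n + 1) ^ 2 * S * gnsConst 1 * y) * (gnsConst 2 * Z ^ 2) ≤
            (D ^ 2 * d) * (gnsConst 2 * Z ^ 2) := by
          calc (4 * (n + 1) ^ 2 * S * gnsConst 1 * y) * (gnsConst 2 * Z ^ 2)
              = (4 * (n + 1) ^ 2 * S * gnsConst 1 * gnsConst 2 * Z ^ 2) * y := by ring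
            _ ≤ (D ^ 2 * y) * y := mul_le_mul_of_nonneg_right hy hy0
            _ = D ^ 2 * y ^ 2 := by ring
            _ ≤ D ^ 2 * (gnsConst 2 * Z ^ 2 * d) := mul_le_mul_of_nonneg_left b2 (by positivity)
            _ = _ := by ring
        exact le_of_mul_le_mul_right h2 h
      refine abs_le_of_sq_le_sq' ?_ (by positivity) |>.2
      calc (2 * (n + 1) * X) ^ 2 = 4 * (n + 1) ^ 2 * X ^ 2 := by ring
        _ ≤ 4 * (n + 1) ^ 2 * (S * (gnsConst 1 * y * d)) :=
          mul_le_mul_of_nonneg_left b1 (by positivity)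
        _ = (4 * (n + 1) ^ 2 * S * gnsConst 1 * y) * d := by ring
        _ ≤ (D ^ 2 * d) * d := mul_le_mul_of_nonneg_right h1 hd0
        _ = (D * d) ^ 2 := by ring
  have fin2 : 4 * ((2 * n + 1) * X) ≤ D * (2 * (2 * n + 1) / (n + 1) * d) := by
    have h1 : 2 * (2 * n + 1) / (n + 1) * (2 * (n + 1) * X) ≤ 2 * (2 * n + 1) / (n + 1) * (D * d) :=
      mul_le_mul_of_nonneg_left fin (by positivity)
    refine le_trans (le_of_eq ?_) (h1.trans (le_of_eq ?_))
    · field_simp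
      ring
    · ring
  unfold energyRate
  rw [e1]
  linarith

/-- A continuous function that does not increase while above the level `N` stays below it. -/
theorem le_of_not_increasing_above {y : ℝ → ℝ} {N t : ℝ} (ht : 0 ≤ t)
    (hy : ContinuousOn y (Icc 0 t)) (h0 : y 0 ≤ N)
    (h : ∀ a, 0 ≤ a → a ≤ t → (∀ s ∈ Ioc a t, N ≤ y s) → y t ≤ y a) : y t ≤ N := by
  have hK : IsCompact (Icc 0 t ∩ y ⁻¹' Iic N) :=
    isCompact_Icc.of_isClosed_subset (hy.preimage_isClosed_of_isClosed isClosed_Icc isClosed_Iic)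
      inter_subset_left
  obtain ⟨a, ⟨ha, haN⟩, hmax⟩ := hK.exists_isGreatest ⟨0, ⟨le_rfl, ht⟩, h0⟩
  refine (h a ha.1 ha.2 fun s hs => ?_).trans haN
  by_contra! hlt
  exact hs.1.not_ge (hmax ⟨⟨ha.1.trans hs.1.le, hs.2⟩, hlt.le⟩)

section Boundedness

variable {D ε : ℝ} {ρ₀ : ℝ × ℝ → ℝ} {ρ : ℝ → L2Plane}

/-- One step of the iteration, from the power `n + 1` to the power `2 n + 2`. -/
theorem IsRegularizedSolution.integral_pow_le (hD : 0 < D) (hε : 0 < ε)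
    (hρ : IsRegularizedSolution D ε ρ₀ ρ) (hρ₀ : ∀ᵐ z, 0 ≤ ρ₀ z) {A : ℝ} (hA : ∀ᵐ z, ρ₀ z ≤ A)
    {n : ℕ} {S Z N : ℝ} (hS : ∀ t, 0 ≤ t → ∫ z, ρ t z ^ 2 ≤ S)
    (hZ : ∀ t, 0 ≤ t → ∫ z, ρ t z ^ (n + 1) ≤ Z) (h0 : ∫ z, ρ₀ z ^ (2 * n + 2) ≤ N)
    (hN : 4 * (n + 1) ^ 2 * S * gnsConst 1 * gnsConst 2 * Z ^ 2 ≤ D ^ 2 * N) {t : ℝ}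
    (ht : 0 ≤ t) : ∫ z, ρ t z ^ (2 * n + 2) ≤ N := by
  obtain ⟨G₁, G₂, hG⟩ := hρ.exists_gradient
  obtain ⟨R, hR, hk⟩ := hρ.exists_ae_le hD.le hε hρ₀ hA t
  have ey : ∀ s ∈ Icc 0 t, ∫ z, entropy (evenDensity n R) (ρ s z) = ∫ z, ρ s z ^ (2 * n + 2) :=
    fun s hs => by
      refine integral_congr_ae ?_
      filter_upwards [hρ.ae_nonneg hD.le hε hρ₀ hs.1, hk s hs] with z h1 h2
      exact entropy_evenDensity ⟨h1, h2⟩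
  have h0' : (0 : ℝ) ∈ Icc 0 t := ⟨le_rfl, ht⟩
  rw [← ey t ⟨ht, le_rfl⟩]
  refine le_of_not_increasing_above (y := fun s => ∫ z, entropy (evenDensity n R) (ρ s z)) ht
    ((hρ.continuousOn_integral_entropy continuous_evenDensity hasCompactSupport_evenDensity
      evenDensity_nonneg).mono Icc_subset_Ici_self) ?_ fun a ha hat hab => ?_
  · rw [ey 0 h0']
    refine le_trans (le_of_eq (integral_congr_ae ?_)) h0
    filter_upwards [hρ.initial] with z hz
    rw [hz]
  · obtain ⟨-, h2⟩ := energy_inequality hε hρ hG (continuous_evenDensity (n := n) (R := R))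
      hasCompactSupport_evenDensity evenDensity_nonneg ha hat
    have h3 : ∫ s in Ioc a t, energyRate D ε (evenDensity n R) (ρ s) (G₁ s) (G₂ s) ≤ 0 := by
      refine integral_nonpos_of_ae ?_
      filter_upwards [ae_restrict_of_ae_restrict_of_subset (fun s hs => ha.trans_lt hs.1)
        hG.weakGradient, ae_restrict_mem measurableSet_Ioc] with s hs hst
      have hs0 : 0 ≤ s := ha.trans hst.1.le
      have h4 := hab s hst
      rw [ey s ⟨hs0, hst.2⟩] at h4
      exact energyRate_evenDensity_nonpos hD hε hs (hρ.integrable hs0)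
        (hρ.ae_nonneg hD.le hε hρ₀ hs0) (hk s ⟨hs0, hst.2⟩) (hS s hs0) (hZ s hs0)
        (hN.trans (mul_le_mul_of_nonneg_left h4 (by positivity)))
    linarith

theorem integral_pow_le_of_le {f : ℝ × ℝ → ℝ} (hf : Integrable f) (hf0 : ∀ᵐ z, 0 ≤ f z) {A : ℝ}
    (hA0 : 0 ≤ A) (hfA : ∀ᵐ z, f z ≤ A) (hf1 : ∫ z, f z ≤ A) (n : ℕ) :
    ∫ z, f z ^ (n + 1) ≤ A ^ (n + 1) := by
  calc ∫ z, f z ^ (n + 1) ≤ ∫ z, A ^ n * f z := by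
        refine integral_mono_ae (integrable_pow_of_le hf hf0 hfA (by simp)) (hf.const_mul _) ?_
        filter_upwards [hf0, hfA] with z h1 h2
        rw [pow_succ]
        exact mul_le_mul_of_nonneg_right (pow_le_pow_left₀ h1 h2 n) h1
    _ = A ^ n * ∫ z, f z := integral_const_mul _ _
    _ ≤ A ^ n * A := mul_le_mul_of_nonneg_left hf1 (by positivity)
    _ = A ^ (n + 1) := (pow_succ A n).symm

/-- The dyadic iteration. The constants are chosen so that the bounds on the powers `2 ^ (k + 1)`
reproduce themselves. -/
theorem IsRegularizedSolution.integral_two_pow_le (hD : 0 < D) (hε : 0 < ε)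
    (hρ : IsRegularizedSolution D ε ρ₀ ρ) (hρ₀ : ∀ᵐ z, 0 ≤ ρ₀ z) {A Γ : ℝ} (hA1 : 1 ≤ A)
    (hA : ∀ᵐ z, ρ₀ z ≤ A) (hA' : ∫ z, ρ₀ z ≤ A) (h2 : ∀ t, 0 ≤ t → ∫ z, ρ t z ^ 2 ≤ A ^ 2)
    (hΓ1 : 1 ≤ Γ) (hΓ : A ^ 2 * gnsConst 1 * gnsConst 2 ≤ D ^ 2 * Γ) (k : ℕ) :
    ∀ t, 0 ≤ t → ∫ z, ρ t z ^ (2 ^ (k + 1)) ≤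
      (64 * A * Γ) ^ (2 ^ (k + 1)) / (Γ * 4 ^ (k + 3)) := by
  have hA0 : 0 < A := by linarith
  have hΓ0 : 0 < Γ := by linarith
  induction k with
  | zero =>
    intro t ht
    refine (h2 t ht).trans ?_
    rw [le_div_iff₀ (by positivity)]
    have : A ^ 2 * Γ * 64 ≤ A ^ 2 * Γ * (4096 * Γ) :=
      mul_le_mul_of_nonneg_left (by linarith) (by positivity)
    norm_num
    linarith
  | succ k ih =>
    intro t ht
    obtain ⟨n, hn⟩ : ∃ n, 2 ^ (k + 1) = n + 1 := ⟨2 ^ (k + 1) - 1, by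
      have := Nat.one_le_two_pow (n := k + 1); omega⟩
    have hn2 : 2 ^ (k + 1 + 1) = 2 * n + 2 := by rw [pow_succ, hn]; ring
    have hnR : (n : ℝ) + 1 = 2 ^ (k + 1) := by exact_mod_cast hn.symm
    rw [hn2]
    rw [hn] at ih
    refine hρ.integral_pow_le hD hε hρ₀ hA h2 ih ?_ ?_ ht
    · refine (integral_pow_le_of_le hρ.integrable_initial hρ₀ hA0.le hA hA' (2 * n + 1)).trans ?_
      rw [show 64 * A * Γ = A * (64 * Γ) by ring, mul_pow, show 2 * n + 1 + 1 = 2 * n + 2 by ring,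
        mul_div_assoc]
      refine le_mul_of_one_le_right (by positivity) ((one_le_div (by positivity)).2 ?_)
      have hle : k + 2 ≤ 2 * n + 2 := by rw [← hn2]; exact (Nat.lt_two_pow_self).le
      calc Γ * 4 ^ (k + 1 + 3) ≤ Γ ^ (k + 2) * 64 ^ (k + 2) := by
            refine mul_le_mul (le_self_pow₀ hΓ1 (by simp)) ?_ (by positivity) (by positivity)
            rw [show (64 : ℝ) = 4 ^ 3 by norm_num, ← pow_mul]
            exact pow_le_pow_right₀ (by norm_num) (by omega)
        _ = (64 * Γ) ^ (k + 2) := by rw [mul_pow, mul_comm]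
        _ ≤ (64 * Γ) ^ (2 * n + 2) := pow_le_pow_right₀ (by linarith) hle
    · set P := (64 * A * Γ) ^ (n + 1)
      have hP : (64 * A * Γ) ^ (2 * n + 2) = P ^ 2 := by simp only [P]; ring
      rw [hP, hnR]
      have e4 : ((2 : ℝ) ^ (k + 1)) ^ 2 = 4 ^ (k + 1) := by
        rw [← pow_mul, mul_comm, pow_mul]; norm_num
      rw [e4]
      calc 4 * 4 ^ (k + 1) * A ^ 2 * gnsConst 1 * gnsConst 2 * (P / (Γ * 4 ^ (k + 3))) ^ 2
          = (A ^ 2 * gnsConst 1 * gnsConst 2) *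
              (4 * 4 ^ (k + 1) * (P / (Γ * 4 ^ (k + 3))) ^ 2) := by ring
        _ ≤ (D ^ 2 * Γ) * (4 * 4 ^ (k + 1) * (P / (Γ * 4 ^ (k + 3))) ^ 2) :=
          mul_le_mul_of_nonneg_right hΓ (by positivity)
        _ = D ^ 2 * (P ^ 2 / (Γ * 4 ^ (k + 1 + 3))) := by
          field_simp
          ring

/-- The uniform bound obtained by letting the power tend to infinity. -/
theorem IsRegularizedSolution.ae_le (hD : 0 < D) (hε : 0 < ε)
    (hρ : IsRegularizedSolution D ε ρ₀ ρ) (hρ₀ : ∀ᵐ z, 0 ≤ ρ₀ z) {A Γ : ℝ} (hA1 : 1 ≤ A)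
    (hA : ∀ᵐ z, ρ₀ z ≤ A) (hA' : ∫ z, ρ₀ z ≤ A) (h2 : ∀ t, 0 ≤ t → ∫ z, ρ t z ^ 2 ≤ A ^ 2)
    (hΓ1 : 1 ≤ Γ) (hΓ : A ^ 2 * gnsConst 1 * gnsConst 2 ≤ D ^ 2 * Γ) {t : ℝ} (ht : 0 ≤ t) :
    ∀ᵐ z, ρ t z ≤ 128 * A * Γ := by
  have hA0 : 0 < A := by linarith
  have hΓ0 : 0 < Γ := by linarith
  have hi := hρ.integrable ht
  obtain ⟨R, hR, hk⟩ := hρ.exists_ae_le hD.le hε hρ₀ hA t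
  have hB : 0 < 64 * A * Γ := by positivity
  refine (ae_lt_of_measureReal_mul_pow_le hi hB.le (k := 128 * A * Γ) (by nlinarith)
    (C := 1) (m := fun k => 2 ^ (k + 1)) ?_ fun k => ?_).mono fun z hz => hz.le
  · exact (tendsto_pow_atTop_atTop_of_one_lt one_lt_two).comp (tendsto_add_atTop_nat 1)
  have ip := integrable_pow_of_le hi (hρ.ae_nonneg hD.le hε hρ₀ ht) (hk t ⟨ht, le_rfl⟩)
    (n := 2 ^ (k + 1)) (by positivity)
  have hpos : 0 < 128 * A * Γ := by positivity
  have cheb := mul_meas_ge_le_integral_of_nonneg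
    ((hρ.ae_nonneg hD.le hε hρ₀ ht).mono fun z hz => pow_nonneg hz (2 ^ (k + 1))) ip
    ((128 * A * Γ) ^ 2 ^ (k + 1))
  have hmono : volume.real {z | 128 * A * Γ ≤ ρ t z} ≤
      volume.real {z | (128 * A * Γ) ^ 2 ^ (k + 1) ≤ ρ t z ^ 2 ^ (k + 1)} :=
    measureReal_mono (fun z hz => pow_le_pow_left₀ hpos.le hz _)
      (ip.measure_ge_lt_top (by positivity)).ne
  have h3 := hρ.integral_two_pow_le hD hε hρ₀ hA1 hA hA' h2 hΓ1 hΓ k t ht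
  have h4 : (64 * A * Γ) ^ (2 ^ (k + 1)) / (Γ * 4 ^ (k + 3)) ≤ (64 * A * Γ) ^ (2 ^ (k + 1)) :=
    div_le_self (by positivity) (one_le_mul_of_one_le_of_one_le hΓ1 (one_le_pow₀ (by norm_num)))
  calc volume.real {z | 128 * A * Γ ≤ ρ t z} * (128 * A * Γ) ^ 2 ^ (k + 1)
      ≤ (128 * A * Γ) ^ 2 ^ (k + 1) *
          volume.real {z | (128 * A * Γ) ^ 2 ^ (k + 1) ≤ ρ t z ^ 2 ^ (k + 1)} := by
        rw [mul_comm]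
        exact mul_le_mul_of_nonneg_left hmono (by positivity)
    _ ≤ 1 * (64 * A * Γ) ^ 2 ^ (k + 1) := by
        rw [one_mul]
        exact cheb.trans (h3.trans h4)

end Boundedness

/-! ### Second moments -/

/-- A convex approximation of `x ^ 2` from below with bounded derivative. -/
noncomputable def softSq (R x : ℝ) : ℝ := 2 * R * (Real.sqrt (R ^ 2 + x ^ 2) - R)

/-- The derivative of `softSq R`. -/
noncomputable def softSqDeriv (R x : ℝ) : ℝ := 2 * R * (x / Real.sqrt (R ^ 2 + x ^ 2))

/-- The second derivative of `softSq R`. -/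
noncomputable def softSqDeriv₂ (R x : ℝ) : ℝ := 2 * (R / Real.sqrt (R ^ 2 + x ^ 2)) ^ 3

section SoftSq

variable {R : ℝ}

theorem le_sqrt_sq_add (R x : ℝ) : R ≤ Real.sqrt (R ^ 2 + x ^ 2) :=
  Real.le_sqrt_of_sq_le (by nlinarith [sq_nonneg x])

theorem abs_le_sqrt_sq_add (R x : ℝ) : |x| ≤ Real.sqrt (R ^ 2 + x ^ 2) :=
  Real.abs_le_sqrt (by nlinarith [sq_nonneg R])

theorem sqrt_sq_add_le (hR : 0 < R) (x : ℝ) : Real.sqrt (R ^ 2 + x ^ 2) ≤ R + |x| := by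
  refine Real.sqrt_le_iff.2 ⟨by positivity, ?_⟩
  nlinarith [sq_abs x, abs_nonneg x]

theorem sq_sqrt_sq_add (R x : ℝ) : Real.sqrt (R ^ 2 + x ^ 2) ^ 2 = R ^ 2 + x ^ 2 :=
  Real.sq_sqrt (by positivity)

theorem hasDerivAt_sqrt_sq_add (hR : 0 < R) (x : ℝ) :
    HasDerivAt (fun x => Real.sqrt (R ^ 2 + x ^ 2)) (x / Real.sqrt (R ^ 2 + x ^ 2)) x := by
  have h1 : HasDerivAt (fun x => R ^ 2 + x ^ 2) (2 * x) x := by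
    simpa using (hasDerivAt_pow 2 x).const_add (R ^ 2)
  refine (h1.sqrt (by positivity)).congr_deriv ?_
  rw [mul_div_mul_left _ _ two_ne_zero]

theorem hasDerivAt_softSq (hR : 0 < R) (x : ℝ) : HasDerivAt (softSq R) (softSqDeriv R x) x :=
  ((hasDerivAt_sqrt_sq_add hR x).sub_const R).const_mul (2 * R)

theorem hasDerivAt_softSqDeriv (hR : 0 < R) (x : ℝ) :
    HasDerivAt (softSqDeriv R) (softSqDeriv₂ R x) x := by
  have hq : Real.sqrt (R ^ 2 + x ^ 2) ≠ 0 := (hR.trans_le (le_sqrt_sq_add R x)).ne'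
  refine (((hasDerivAt_id x).div (hasDerivAt_sqrt_sq_add hR x) hq).const_mul (2 * R)).congr_deriv ?_
  have h2 := sq_sqrt_sq_add R x
  simp only [id, softSqDeriv₂]
  set q := Real.sqrt (R ^ 2 + x ^ 2)
  field_simp
  rw [h2]
  ring

theorem contDiff_softSq (hR : 0 < R) : ContDiff ℝ ∞ (softSq R) := by
  have : ContDiff ℝ ∞ fun x : ℝ => Real.sqrt (R ^ 2 + x ^ 2) :=
    (contDiff_const.add (contDiff_id.pow 2)).sqrt fun x => by positivity
  exact contDiff_const.mul (this.sub contDiff_const)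

theorem softSq_nonneg (hR : 0 < R) (x : ℝ) : 0 ≤ softSq R x :=
  mul_nonneg (by positivity) (sub_nonneg.2 (le_sqrt_sq_add R x))

theorem softSq_le_sq (R x : ℝ) : softSq R x ≤ x ^ 2 := by
  have h1 := le_sqrt_sq_add R x
  have h2 := sq_sqrt_sq_add R x
  unfold softSq
  nlinarith

theorem softSq_le_abs (hR : 0 < R) (x : ℝ) : softSq R x ≤ 2 * R * |x| :=
  mul_le_mul_of_nonneg_left (by linarith [sqrt_sq_add_le hR x]) (by positivity)

theorem abs_softSqDeriv_le (hR : 0 < R) (x : ℝ) : |softSqDeriv R x| ≤ 2 * R := by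
  have hq := hR.trans_le (le_sqrt_sq_add R x)
  rw [softSqDeriv, abs_mul, abs_div, abs_of_pos hq, abs_of_pos (by positivity : 0 < 2 * R)]
  exact mul_le_of_le_one_right (by positivity) ((div_le_one hq).2 (abs_le_sqrt_sq_add R x))

theorem softSqDeriv₂_nonneg (hR : 0 < R) (x : ℝ) : 0 ≤ softSqDeriv₂ R x := by
  unfold softSqDeriv₂
  positivity

theorem softSqDeriv₂_le (hR : 0 < R) (x : ℝ) : softSqDeriv₂ R x ≤ 2 := by
  have h1 := le_sqrt_sq_add R x
  have hq := hR.trans_le h1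
  have h2 : (R / Real.sqrt (R ^ 2 + x ^ 2)) ^ 3 ≤ 1 :=
    pow_le_one₀ (by positivity) ((div_le_one hq).2 h1)
  unfold softSqDeriv₂
  linarith

theorem monotone_softSqDeriv (hR : 0 < R) : Monotone (softSqDeriv R) :=
  monotone_of_hasDerivAt_nonneg (fun x => hasDerivAt_softSqDeriv hR x)
    fun x => softSqDeriv₂_nonneg hR x

theorem tendsto_softSq (x : ℝ) :
    Tendsto (fun n : ℕ => softSq ((n : ℝ) + 1) x) atTop (𝓝 (x ^ 2)) := by
  have bd : ∀ n : ℕ, |softSq ((n : ℝ) + 1) x - x ^ 2| ≤ x ^ 2 * |x| * (1 / ((n : ℝ) + 1)) := by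
    intro n
    have hR : (0 : ℝ) < n + 1 := by positivity
    set R : ℝ := n + 1
    rw [abs_sub_comm, abs_of_nonneg (sub_nonneg.2 (softSq_le_sq R x))]
    have h1 := le_sqrt_sq_add R x
    have h2 := sq_sqrt_sq_add R x
    have h3 := sqrt_sq_add_le hR x
    have e : x ^ 2 - softSq R x = (Real.sqrt (R ^ 2 + x ^ 2) - R) ^ 2 := by
      unfold softSq
      linear_combination -h2
    rw [e, mul_one_div, le_div_iff₀ hR]
    set q := Real.sqrt (R ^ 2 + x ^ 2)
    calc (q - R) ^ 2 * R = (q - R) * ((q - R) * R) := by ring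
      _ ≤ |x| * x ^ 2 := by
        refine mul_le_mul (by linarith) ?_ (mul_nonneg (by linarith) hR.le) (abs_nonneg _)
        nlinarith
      _ = x ^ 2 * |x| := mul_comm _ _
  refine tendsto_iff_norm_sub_tendsto_zero.2 (squeeze_zero (fun _ => norm_nonneg _) bd ?_)
  simpa using (tendsto_one_div_add_atTop_nhds_zero_nat (𝕜 := ℝ)).const_mul (x ^ 2 * |x|)

end SoftSq

theorem partial_separated {a b a' b' : ℝ → ℝ} (ha : ∀ x, HasDerivAt a (a' x) x)
    (hb : ∀ x, HasDerivAt b (b' x) x) :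
    (partialX (fun z : ℝ × ℝ => a z.1 + b z.2) = fun z => a' z.1) ∧
    partialY (fun z : ℝ × ℝ => a z.1 + b z.2) = fun z => b' z.2 := by
  have key : ∀ z : ℝ × ℝ, HasFDerivAt (fun z : ℝ × ℝ => a z.1 + b z.2)
      (a' z.1 • ContinuousLinearMap.fst ℝ ℝ ℝ + b' z.2 • ContinuousLinearMap.snd ℝ ℝ ℝ) z :=
    fun z => ((ha z.1).comp_hasFDerivAt z hasFDerivAt_fst).add
      ((hb z.2).comp_hasFDerivAt z hasFDerivAt_snd)
  constructor
  · ext z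
    rw [partialX, (key z).fderiv]
    simp
  · ext z
    rw [partialY, (key z).fderiv]
    simp

/-- The approximation of `x ^ 2 + y ^ 2` used as a test function. -/
noncomputable def softNormSq (R : ℝ) (z : ℝ × ℝ) : ℝ := softSq R z.1 + softSq R z.2

section SoftNormSq

variable {R : ℝ}

theorem partialX_softNormSq (hR : 0 < R) :
    partialX (softNormSq R) = fun z => softSqDeriv R z.1 :=
  (partial_separated (hasDerivAt_softSq hR) (hasDerivAt_softSq hR)).1

theorem partialY_softNormSq (hR : 0 < R) :
    partialY (softNormSq R) = fun z => softSqDeriv R z.2 :=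
  (partial_separated (hasDerivAt_softSq hR) (hasDerivAt_softSq hR)).2

theorem partialXX_softNormSq (hR : 0 < R) :
    partialX (partialX (softNormSq R)) = fun z => softSqDeriv₂ R z.1 := by
  have := (partial_separated (hasDerivAt_softSqDeriv hR) fun x => hasDerivAt_const x (0 : ℝ)).1
  rw [partialX_softNormSq hR]
  simpa using this

theorem partialYY_softNormSq (hR : 0 < R) :
    partialY (partialY (softNormSq R)) = fun z => softSqDeriv₂ R z.2 := by
  have := (partial_separated (fun x => hasDerivAt_const x (0 : ℝ)) (hasDerivAt_softSqDeriv hR)).2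
  rw [partialY_softNormSq hR]
  simpa using this

theorem softNormSq_nonneg (hR : 0 < R) (z : ℝ × ℝ) : 0 ≤ softNormSq R z :=
  add_nonneg (softSq_nonneg hR _) (softSq_nonneg hR _)

theorem isLinearGrowth_softNormSq (hR : 0 < R) : IsLinearGrowth (softNormSq R) (4 * R + 2) := by
  refine ⟨((contDiff_softSq hR).comp contDiff_fst).add ((contDiff_softSq hR).comp contDiff_snd),
    fun z => ?_, fun z => ?_, fun z => ?_, fun z => ?_, fun z => ?_⟩
  · rw [abs_of_nonneg (softNormSq_nonneg hR z)]
    have h1 : |z.1| ≤ ‖z‖ := norm_fst_le z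
    have h2 : |z.2| ≤ ‖z‖ := norm_snd_le z
    have h3 := softSq_le_abs hR z.1
    have h4 := softSq_le_abs hR z.2
    have h5 := mul_le_mul_of_nonneg_left h1 (show 0 ≤ 2 * R by positivity)
    have h6 := mul_le_mul_of_nonneg_left h2 (show 0 ≤ 2 * R by positivity)
    have h7 := norm_nonneg z
    unfold softNormSq
    linarith
  · rw [partialX_softNormSq hR]
    linarith [abs_softSqDeriv_le hR z.1]
  · rw [partialY_softNormSq hR]
    linarith [abs_softSqDeriv_le hR z.2]
  · rw [partialXX_softNormSq hR, abs_of_nonneg (softSqDeriv₂_nonneg hR _)]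
    linarith [softSqDeriv₂_le hR z.1]
  · rw [partialYY_softNormSq hR, abs_of_nonneg (softSqDeriv₂_nonneg hR _)]
    linarith [softSqDeriv₂_le hR z.2]

end SoftNormSq

/-- Symmetrization: an odd kernel with the sign of the increments of `f` gives a non-negative
double integral. -/
theorem integral_mul_kernelConv_nonneg {K f u : ℝ × ℝ → ℝ} {B : ℝ} (hK : Continuous K)
    (hB : ∀ z, |K z| ≤ B) (hodd : ∀ z, K (-z) = -K z) (hu : Integrable u) (hu0 : ∀ᵐ z, 0 ≤ u z)
    (huf : Integrable (fun z => u z * f z)) (hf : ∀ z w, 0 ≤ (f z - f w) * K (z - w)) :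
    0 ≤ ∫ z, u z * f z * kernelConv K u z := by
  have i1 := integrable_prod_kernel hK hB huf hu
  have e1 := integral_mul_kernelConv hK hB huf hu
  rw [e1]
  have i2 := i1.swap
  have e2 := integral_prod_swap (μ := (volume : Measure (ℝ × ℝ))) (ν := (volume : Measure (ℝ × ℝ)))
    (fun p : (ℝ × ℝ) × (ℝ × ℝ) => u p.1 * f p.1 * u p.2 * K (p.1 - p.2))
  rw [← Measure.volume_eq_prod] at e2
  have h : 0 ≤ (∫ p : (ℝ × ℝ) × (ℝ × ℝ), u p.1 * f p.1 * u p.2 * K (p.1 - p.2)) +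
      ∫ p : (ℝ × ℝ) × (ℝ × ℝ), u p.swap.1 * f p.swap.1 * u p.swap.2 * K (p.swap.1 - p.swap.2) := by
    refine le_of_le_of_eq (integral_nonneg_of_ae ?_) (integral_add i1 i2)
    rw [Measure.volume_eq_prod]
    filter_upwards [Measure.quasiMeasurePreserving_fst.ae hu0,
      Measure.quasiMeasurePreserving_snd.ae hu0] with p h1 h2
    have h3 : K (p.2 - p.1) = -K (p.1 - p.2) := by rw [← hodd, neg_sub]
    have h4 := mul_nonneg (mul_nonneg h1 h2) (hf p.1 p.2)
    simp only [Pi.zero_apply, Prod.fst_swap, Prod.snd_swap, h3]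
    refine h4.trans (le_of_eq ?_)
    ring
  rw [e2] at h
  linarith

theorem sgnReg_mul_nonneg {ε : ℝ} (hε : 0 < ε) {f : ℝ → ℝ} (hf : Monotone f) (x y : ℝ) :
    0 ≤ (f x - f y) * sgnReg ε (x - y) := by
  rcases le_total x y with h | h
  · refine mul_nonneg_of_nonpos_of_nonpos (sub_nonpos.2 (hf h)) ?_
    rw [← neg_sub, sgnReg_neg]
    exact neg_nonpos.2 (sgnReg_nonneg hε (sub_nonneg.2 h))
  · exact mul_nonneg (sub_nonneg.2 (hf h)) (sgnReg_nonneg hε (sub_nonneg.2 h))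

theorem weakRate_softNormSq_le {D ε R : ℝ} (hD : 0 ≤ D) (hε : 0 < ε) (hR : 0 < R) {u : L2Plane}
    (hu : Integrable u) (hu0 : ∀ᵐ z, 0 ≤ u z) :
    weakRate D ε (softNormSq R) u ≤ 4 * D * ∫ z, u z := by
  have cd : Continuous (softSqDeriv R) := continuous_iff_continuousAt.2 fun x =>
    (hasDerivAt_softSqDeriv hR x).continuousAt
  have i1 : Integrable (fun z => u z * softSqDeriv R z.1) :=
    hu.mul_bdd (c := 2 * R) (cd.comp continuous_fst).aestronglyMeasurable
      (ae_of_all _ fun z => abs_softSqDeriv_le hR z.1)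
  have i2 : Integrable (fun z => u z * softSqDeriv R z.2) :=
    hu.mul_bdd (c := 2 * R) (cd.comp continuous_snd).aestronglyMeasurable
      (ae_of_all _ fun z => abs_softSqDeriv_le hR z.2)
  have hK := (contDiff_kernelX ε).continuous
  have hK' := (contDiff_kernelY ε).continuous
  have s1 := integral_mul_kernelConv_nonneg hK (abs_kernelX_le hε)
    (fun z => by simp [kernelX, sgnReg_neg, deltaReg_neg]) hu hu0 i1 fun z w => by
      rw [kernelX, ← mul_assoc]
      exact mul_nonneg (sgnReg_mul_nonneg hε (monotone_softSqDeriv hR) z.1 w.1)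
        (deltaReg_nonneg hε _)
  have s2 := integral_mul_kernelConv_nonneg hK' (abs_kernelY_le hε)
    (fun z => by simp [kernelY, sgnReg_neg, deltaReg_neg]) hu hu0 i2 fun z w => by
      rw [kernelY, ← mul_assoc]
      exact mul_nonneg (sgnReg_mul_nonneg hε (monotone_softSqDeriv hR) z.2 w.2)
        (deltaReg_nonneg hε _)
  have j1 : Integrable (fun z => u z * softSqDeriv R z.1 * kernelConv (kernelX ε) u z) :=
    i1.mul_bdd (continuous_kernelConv hK (abs_kernelX_le hε) hu).aestronglyMeasurable
      (ae_of_all _ fun z => abs_kernelConv_le (abs_kernelX_le hε) hu z)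
  have j2 : Integrable (fun z => u z * softSqDeriv R z.2 * kernelConv (kernelY ε) u z) :=
    i2.mul_bdd (continuous_kernelConv hK' (abs_kernelY_le hε) hu).aestronglyMeasurable
      (ae_of_all _ fun z => abs_kernelConv_le (abs_kernelY_le hε) hu z)
  have c2 : Continuous (softSqDeriv₂ R) := by
    unfold softSqDeriv₂
    refine continuous_const.mul ((continuous_const.div ?_ fun x =>
      (hR.trans_le (le_sqrt_sq_add R x)).ne').pow 3)
    fun_prop
  have j3 : Integrable (fun z => u z * (D * (softSqDeriv₂ R z.1 + softSqDeriv₂ R z.2))) := by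
    refine hu.mul_bdd (c := D * 4) ?_ (ae_of_all _ fun z => ?_)
    · exact (continuous_const.mul ((c2.comp continuous_fst).add
        (c2.comp continuous_snd))).aestronglyMeasurable
    · have h1 := softSqDeriv₂_nonneg hR z.1
      have h2 := softSqDeriv₂_nonneg hR z.2
      rw [Real.norm_of_nonneg (by positivity)]
      exact mul_le_mul_of_nonneg_left (by linarith [softSqDeriv₂_le hR z.1, softSqDeriv₂_le hR z.2])
        hD
  have e : weakRate D ε (softNormSq R) u =
      (∫ z, u z * (D * (softSqDeriv₂ R z.1 + softSqDeriv₂ R z.2))) -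
      (∫ z, u z * softSqDeriv R z.1 * kernelConv (kernelX ε) u z) -
      ∫ z, u z * softSqDeriv R z.2 * kernelConv (kernelY ε) u z := by
    rw [← integral_sub j3 j1]
    refine Eq.trans (integral_congr_ae (ae_of_all _ fun z => ?_)) (integral_sub (j3.sub j1) j2)
    simp only [regForceX_eq, regForceY_eq]
    rw [partialXX_softNormSq hR, partialYY_softNormSq hR, partialX_softNormSq hR,
      partialY_softNormSq hR]
    ring
  have h3 : ∫ z, u z * (D * (softSqDeriv₂ R z.1 + softSqDeriv₂ R z.2)) ≤ 4 * D * ∫ z, u z := by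
    rw [← integral_const_mul]
    refine integral_mono_ae j3 (hu.const_mul _) ?_
    filter_upwards [hu0] with z hz
    have h4 : D * (softSqDeriv₂ R z.1 + softSqDeriv₂ R z.2) ≤ D * 4 :=
      mul_le_mul_of_nonneg_left (by linarith [softSqDeriv₂_le hR z.1, softSqDeriv₂_le hR z.2]) hD
    have h5 := mul_le_mul_of_nonneg_left h4 hz
    linarith
  rw [e]
  linarith

/-- Fatou's lemma for non-negative integrable functions whose integrals converge. -/
theorem lintegral_ofReal_le_of_tendsto {f : ℕ → ℝ × ℝ → ℝ} {g : ℝ × ℝ → ℝ} {L : ℝ}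
    (hf : ∀ n, Integrable (f n)) (hf0 : ∀ n, ∀ᵐ z, 0 ≤ f n z)
    (hfg : ∀ᵐ z, Tendsto (fun n => f n z) atTop (𝓝 (g z)))
    (hL : Tendsto (fun n => ∫ z, f n z) atTop (𝓝 L)) :
    ∫⁻ z, ENNReal.ofReal (g z) ≤ ENNReal.ofReal L := by
  calc ∫⁻ z, ENNReal.ofReal (g z)
      = ∫⁻ z, liminf (fun n => ENNReal.ofReal (f n z)) atTop :=
        lintegral_congr_ae (hfg.mono fun z hz =>
          ((ENNReal.continuous_ofReal.tendsto _).comp hz).liminf_eq.symm)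
    _ ≤ liminf (fun n => ∫⁻ z, ENNReal.ofReal (f n z)) atTop :=
        lintegral_liminf_le' fun n => (hf n).aestronglyMeasurable.aemeasurable.ennreal_ofReal
    _ = ENNReal.ofReal L := by
        refine Tendsto.liminf_eq ?_
        simp_rw [← fun n => ofReal_integral_eq_lintegral_ofReal (hf n) (hf0 n)]
        exact (ENNReal.continuous_ofReal.tendsto _).comp hL

/-- The second moment grows at most linearly, at rate `4 D` times the mass. -/
theorem IsRegularizedSolution.lintegral_sq_mul_le {D ε : ℝ} {ρ₀ : ℝ × ℝ → ℝ} {ρ : ℝ → L2Plane}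
    (hD : 0 ≤ D) (hε : 0 < ε) (hρ : IsRegularizedSolution D ε ρ₀ ρ) (hρ₀ : ∀ᵐ z, 0 ≤ ρ₀ z)
    (hm : Integrable (fun z => (z.1 ^ 2 + z.2 ^ 2) * ρ₀ z)) {t : ℝ} (ht : 0 ≤ t) :
    ∫⁻ z, ENNReal.ofReal ((z.1 ^ 2 + z.2 ^ 2) * ρ t z) ≤
      ENNReal.ofReal ((∫ z, (z.1 ^ 2 + z.2 ^ 2) * ρ₀ z) + 4 * D * (∫ z, ρ₀ z) * t) := by
  have pos := hρ.ae_nonneg hD hε hρ₀ ht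
  have step : ∀ R : ℝ, 0 < R → ∫⁻ z, ENNReal.ofReal (ρ t z * softNormSq R z) ≤
      ENNReal.ofReal ((∫ z, (z.1 ^ 2 + z.2 ^ 2) * ρ₀ z) + 4 * D * (∫ z, ρ₀ z) * t) := by
    intro R hR
    have hg := isLinearGrowth_softNormSq hR
    have hle : ∀ᵐ z, ρ₀ z * softNormSq R z ≤ (z.1 ^ 2 + z.2 ^ 2) * ρ₀ z := by
      filter_upwards [hρ₀] with z hz
      rw [mul_comm]
      exact mul_le_mul_of_nonneg_right (add_le_add (softSq_le_sq R _) (softSq_le_sq R _)) hz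
    have hi₀ : Integrable (fun z => ρ₀ z * softNormSq R z) := by
      refine hm.mono' (hρ.integrable_initial.aestronglyMeasurable.mul
        hg.contDiff.continuous.aestronglyMeasurable) ?_
      filter_upwards [hle, hρ₀] with z h1 h2
      rwa [Real.norm_of_nonneg (mul_nonneg h2 (softNormSq_nonneg hR z))]
    have lim := hρ.tendsto_integral_mul_cutoff hε hg hi₀ ht
    refine (lintegral_ofReal_le_of_tendsto (fun n => ?_) (fun n => ?_) (ae_of_all _ fun z => ?_)
      lim).trans (ENNReal.ofReal_le_ofReal (add_le_add (integral_mono_ae hi₀ hm hle) ?_))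
    · exact (Lp.memLp (ρ t)).integrable_mul
        (((cutoff_isTest n).mul_contDiff hg.contDiff).memLp 2)
    · filter_upwards [pos] with z hz
      exact mul_nonneg hz (mul_nonneg (softNormSq_nonneg hR z) (cutoff_nonneg n z))
    · simpa using ((cutoff_tendsto z).const_mul (softNormSq R z)).const_mul (ρ t z)
    · have hM : 0 ≤ ∫ z, ρ₀ z := integral_nonneg_of_ae hρ₀
      rw [intervalIntegral.integral_of_le ht]
      by_cases hint : IntegrableOn (fun s => weakRate D ε (softNormSq R) (ρ s)) (Ioc 0 t)
      · have h1 : ∫ s in Ioc 0 t, weakRate D ε (softNormSq R) (ρ s) ≤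
            ∫ s in Ioc 0 t, 4 * D * (∫ z, ρ₀ z) := by
          refine setIntegral_mono_on hint (integrable_const _) measurableSet_Ioc fun s hs => ?_
          rw [← hρ.integral_eq hε hs.1.le]
          exact weakRate_softNormSq_le hD hε hR (hρ.integrable hs.1.le)
            (hρ.ae_nonneg hD hε hρ₀ hs.1.le)
        rw [setIntegral_const, smul_eq_mul, measureReal_def, Real.volume_Ioc, sub_zero,
          ENNReal.toReal_ofReal ht] at h1
        linarith
      · rw [integral_undef hint]
        positivity
  refine lintegral_le_of_ae_tendsto
    (f := fun (n : ℕ) z => ENNReal.ofReal (ρ t z * softNormSq ((n : ℝ) + 1) z)) (fun n => ?_)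
    (ae_of_all _ fun z => ?_) fun n => step _ (by positivity)
  · exact ((Lp.aestronglyMeasurable (ρ t)).mul (isLinearGrowth_softNormSq
      (by positivity)).contDiff.continuous.aestronglyMeasurable).aemeasurable.ennreal_ofReal
  · refine (ENNReal.continuous_ofReal.tendsto _).comp ?_
    rw [mul_comm]
    exact ((tendsto_softSq z.1).add (tendsto_softSq z.2)).const_mul (ρ t z)

/-! ### Norms of non-negative functions and the conclusion -/

theorem eLpNorm_ofReal_eq {f : ℝ × ℝ → ℝ} (hf : AEStronglyMeasurable f) (hf0 : ∀ᵐ z, 0 ≤ f z)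
    {p : ℝ} (hp : 1 ≤ p) (hfp : Integrable (fun z => f z ^ p)) :
    eLpNorm f (ENNReal.ofReal p) volume = ENNReal.ofReal ((∫ z, f z ^ p) ^ p⁻¹) := by
  have hp0 : ENNReal.ofReal p ≠ 0 := by simpa using (by linarith : 0 < p)
  have e : ∀ᵐ z, ‖f z‖ ^ p = f z ^ p := hf0.mono fun z hz => by rw [Real.norm_of_nonneg hz]
  have ep : (ENNReal.ofReal p).toReal = p := ENNReal.toReal_ofReal (by linarith)
  have hm : MemLp f (ENNReal.ofReal p) := by
    refine (integrable_norm_rpow_iff hf hp0 ENNReal.ofReal_ne_top).1 ?_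
    rw [ep]
    exact hfp.congr (e.mono fun z hz => hz.symm)
  rw [hm.eLpNorm_eq_integral_rpow_norm hp0 ENNReal.ofReal_ne_top, ep, integral_congr_ae e]

theorem eLpNorm_one_eq_ofReal {f : ℝ × ℝ → ℝ} (hf : Integrable f) (hf0 : ∀ᵐ z, 0 ≤ f z) :
    eLpNorm f 1 volume = ENNReal.ofReal (∫ z, f z) := by
  rw [eLpNorm_one_eq_lintegral_enorm, ← ofReal_integral_norm_eq_lintegral_enorm hf]
  congr 1
  exact integral_congr_ae (hf0.mono fun z hz => Real.norm_of_nonneg hz)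

theorem proposition2p2 (D M₀ : ℝ) (hD : 0 < D)
    (ρ₀ : ℝ → ℝ × ℝ → ℝ) (ρ : ℝ → ℝ → L2Plane)
    (hρ₀_nonneg : ∀ ε > 0, ∀ᵐ z, 0 ≤ ρ₀ ε z)
    (hρ₀_mem : ∀ ε > 0, MemLp (ρ₀ ε) 1 ∧ MemLp (ρ₀ ε) ∞)
    (hρ₀_bdd : ∃ A : ℝ≥0, ∀ ε > 0, eLpNorm (ρ₀ ε) 1 volume ≤ A ∧ eLpNorm (ρ₀ ε) ∞ volume ≤ A)
    (hM₀ : ∀ ε > 0, ∫ z, ρ₀ ε z ≤ M₀)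
    (hρ : ∀ ε > 0, IsRegularizedSolution D ε (ρ₀ ε) (ρ ε)) :
    -- i) conservation of mass
    (∀ ε > 0, ∀ t : ℝ, 0 ≤ t →
      Integrable (ρ ε t : ℝ × ℝ → ℝ) ∧ ∫ z, ρ ε t z = ∫ z, ρ₀ ε z) ∧
    -- ii) `L^p` bounds
    (∀ p : ℝ, 1 ≤ p → p * gnsConst p * M₀ < D →
      (∃ K : ℝ≥0, ∀ ε > 0, ∀ t : ℝ, 0 ≤ t →
        eLpNorm (ρ ε t : ℝ × ℝ → ℝ) (ENNReal.ofReal p) volume ≤ K) ∧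
      ∀ ε > 0, ∀ t : ℝ, 0 ≤ t →
        eLpNorm (ρ ε t : ℝ × ℝ → ℝ) (ENNReal.ofReal p) volume ≤
          eLpNorm (ρ₀ ε) (ENNReal.ofReal p) volume) ∧
    -- iii) `L²` and `L^∞` bounds
    (2 * gnsConst 2 * M₀ < D →
      ∃ K : ℝ≥0, ∀ ε > 0, ∀ t : ℝ, 0 ≤ t →
        eLpNorm (ρ ε t : ℝ × ℝ → ℝ) 2 volume ≤ K ∧
        eLpNorm (ρ ε t : ℝ × ℝ → ℝ) ∞ volume ≤ K) ∧
    -- iv) second moments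
    ((∃ K : ℝ≥0, ∀ ε > 0,
        eLpNorm (fun z : ℝ × ℝ => (z.1 ^ 2 + z.2 ^ 2) * ρ₀ ε z) 1 volume ≤ K) →
      ∀ T > 0, ∃ K : ℝ≥0, ∀ ε > 0, ∀ t ∈ Icc (0 : ℝ) T,
        eLpNorm (fun z : ℝ × ℝ => (z.1 ^ 2 + z.2 ^ 2) * ρ ε t z) 1 volume ≤ K) := by
  obtain ⟨A, hA⟩ := hρ₀_bdd
  set a : ℝ := max A 1
  have ha1 : 1 ≤ a := le_max_right _ _
  have ha0 : 0 ≤ a := by linarith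
  have i₀ : ∀ ε > 0, Integrable (ρ₀ ε) := fun ε hε => memLp_one_iff_integrable.1 (hρ₀_mem ε hε).1
  have hsup : ∀ ε > 0, ∀ᵐ z, ρ₀ ε z ≤ a := fun ε hε => by
    have h1 := (hA ε hε).2
    rw [eLpNorm_exponent_top] at h1
    filter_upwards [ae_le_eLpNormEssSup (f := ρ₀ ε) (μ := volume)] with z hz
    have h2 := hz.trans h1
    rw [enorm_le_coe, ← NNReal.coe_le_coe, coe_nnnorm] at h2
    exact (le_abs_self _).trans (h2.trans (le_max_left _ _))
  have hint : ∀ ε > 0, ∫ z, ρ₀ ε z ≤ a := fun ε hε => by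
    have h1 := (hA ε hε).1
    rw [eLpNorm_one_eq_ofReal (i₀ ε hε) (hρ₀_nonneg ε hε), ← ENNReal.ofReal_coe_nnreal,
      ENNReal.ofReal_le_ofReal_iff (NNReal.coe_nonneg A)] at h1
    exact h1.trans (le_max_left _ _)
  have pos : ∀ ε > 0, ∀ t, 0 ≤ t → ∀ᵐ z, 0 ≤ ρ ε t z := fun ε hε t ht =>
    (hρ ε hε).ae_nonneg hD.le hε (hρ₀_nonneg ε hε) ht
  have small : ∀ p : ℝ, 1 ≤ p → p * gnsConst p * M₀ < D → ∀ ε > 0,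
      p * gnsConst p * (∫ z, ρ₀ ε z) ≤ D := fun p hp h ε hε => by
    have := gnsConst_nonneg hp
    exact (mul_le_mul_of_nonneg_left (hM₀ ε hε) (by positivity)).trans h.le
  have hmass : ∀ ε > 0, ∀ t, 0 ≤ t → ∫ z, ρ ε t z = ∫ z, ρ₀ ε z := fun ε hε t ht =>
    (hρ ε hε).integral_eq hε ht
  have hpow : ∀ p : ℝ, 1 ≤ p → p * gnsConst p * M₀ < D → ∀ ε > 0, ∀ t, 0 ≤ t →
      ∫ z, ρ ε t z ^ p ≤ ∫ z, ρ₀ ε z ^ p := fun p hp h ε hε t ht => by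
    rcases hp.eq_or_lt with rfl | hp'
    · simpa only [Real.rpow_one] using (hmass ε hε t ht).le
    · exact (hρ ε hε).integral_rpow_le hD.le hε (hρ₀_nonneg ε hε) (hsup ε hε) hp'
        (small p hp h ε hε) ht
  have ip₀ : ∀ p : ℝ, 1 ≤ p → ∀ ε > 0, Integrable (fun z => ρ₀ ε z ^ p) := fun p hp ε hε =>
    integrable_rpow_of_le (i₀ ε hε) (hρ₀_nonneg ε hε) (hsup ε hε) hp
  have hpow₀ : ∀ p : ℝ, 1 ≤ p → ∀ ε > 0, ∫ z, ρ₀ ε z ^ p ≤ a ^ p := fun p hp ε hε => by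
    have e : ∀ x : ℝ, 0 ≤ x → x ^ p = x ^ (p - 1) * x := fun x hx => by
      rw [← Real.rpow_add_one' hx (by linarith), sub_add_cancel]
    calc ∫ z, ρ₀ ε z ^ p ≤ ∫ z, a ^ (p - 1) * ρ₀ ε z := by
          refine integral_mono_ae (ip₀ p hp ε hε) ((i₀ ε hε).const_mul _) ?_
          filter_upwards [hρ₀_nonneg ε hε, hsup ε hε] with z h1 h2
          rw [e _ h1]
          exact mul_le_mul_of_nonneg_right (Real.rpow_le_rpow h1 h2 (by linarith)) h1
      _ = a ^ (p - 1) * ∫ z, ρ₀ ε z := integral_const_mul _ _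
      _ ≤ a ^ (p - 1) * a := mul_le_mul_of_nonneg_left (hint ε hε) (Real.rpow_nonneg ha0 _)
      _ = a ^ p := (e a ha0).symm
  have hLp : ∀ p : ℝ, 1 ≤ p → p * gnsConst p * M₀ < D → ∀ ε > 0, ∀ t : ℝ, 0 ≤ t →
      eLpNorm (ρ ε t : ℝ × ℝ → ℝ) (ENNReal.ofReal p) volume ≤
        eLpNorm (ρ₀ ε) (ENNReal.ofReal p) volume := fun p hp h ε hε t ht => by
    rw [eLpNorm_ofReal_eq (Lp.aestronglyMeasurable _) (pos ε hε t ht) hp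
        ((hρ ε hε).integrable_rpow hD.le hε (hρ₀_nonneg ε hε) (hsup ε hε) hp ht),
      eLpNorm_ofReal_eq (i₀ ε hε).aestronglyMeasurable (hρ₀_nonneg ε hε) hp (ip₀ p hp ε hε)]
    refine ENNReal.ofReal_le_ofReal (Real.rpow_le_rpow (integral_nonneg_of_ae ?_)
      (hpow p hp h ε hε t ht) (inv_nonneg.2 (by linarith)))
    exact (pos ε hε t ht).mono fun z hz => Real.rpow_nonneg hz p
  have hLp₀ : ∀ p : ℝ, 1 ≤ p → ∀ ε > 0,
      eLpNorm (ρ₀ ε) (ENNReal.ofReal p) volume ≤ (a.toNNReal : ℝ≥0∞) := fun p hp ε hε => by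
    rw [eLpNorm_ofReal_eq (i₀ ε hε).aestronglyMeasurable (hρ₀_nonneg ε hε) hp (ip₀ p hp ε hε)]
    refine ENNReal.ofReal_le_ofReal ?_
    have h1 := Real.rpow_le_rpow (integral_nonneg_of_ae
      ((hρ₀_nonneg ε hε).mono fun z hz => Real.rpow_nonneg hz p)) (hpow₀ p hp ε hε)
      (inv_nonneg.2 (by linarith : 0 ≤ p))
    rwa [Real.rpow_rpow_inv ha0 (by linarith)] at h1
  refine ⟨fun ε hε t ht => ⟨(hρ ε hε).integrable ht, hmass ε hε t ht⟩, fun p hp h =>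
    ⟨⟨a.toNNReal, fun ε hε t ht => (hLp p hp h ε hε t ht).trans (hLp₀ p hp ε hε)⟩, hLp p hp h⟩,
    fun h => ?_, fun ⟨K, hK⟩ T hT => ?_⟩
  -- `Γ` absorbs the constants `C₁`, `C₂` and `D` of the dyadic iteration; it depends on the initial
  -- data only through the common bound `a`.
  · set Γ : ℝ := max 1 (a ^ 2 * gnsConst 1 * gnsConst 2 / D ^ 2)
    have hΓ1 : 1 ≤ Γ := le_max_left _ _
    have hΓ : a ^ 2 * gnsConst 1 * gnsConst 2 ≤ D ^ 2 * Γ := by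
      rw [← div_le_iff₀' (by positivity)]
      exact le_max_right _ _
    have h2 : ∀ ε > 0, ∀ t, 0 ≤ t → ∫ z, ρ ε t z ^ 2 ≤ a ^ 2 := fun ε hε t ht => by
      have := (hpow 2 one_le_two h ε hε t ht).trans (hpow₀ 2 one_le_two ε hε)
      simpa only [Real.rpow_two] using this
    refine ⟨max a.toNNReal (128 * a * Γ).toNNReal, fun ε hε t ht => ⟨?_, ?_⟩⟩
    · have h3 := (hLp 2 one_le_two h ε hε t ht).trans (hLp₀ 2 one_le_two ε hε)
      rw [ENNReal.ofReal_ofNat] at h3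
      exact h3.trans (ENNReal.coe_le_coe.2 (le_max_left _ _))
    · rw [eLpNorm_exponent_top]
      refine (eLpNormEssSup_le_of_ae_bound (C := 128 * a * Γ) ?_).trans
        (ENNReal.coe_le_coe.2 (le_max_right _ _))
      filter_upwards [pos ε hε t ht, (hρ ε hε).ae_le hD hε (hρ₀_nonneg ε hε) ha1 (hsup ε hε)
        (hint ε hε) (h2 ε hε) hΓ1 hΓ ht] with z h3 h4
      rwa [Real.norm_of_nonneg h3]
  · refine ⟨(K + 4 * D * a * T).toNNReal, fun ε hε t ht => ?_⟩
    have hnn : ∀ᵐ z : ℝ × ℝ, 0 ≤ (z.1 ^ 2 + z.2 ^ 2) * ρ₀ ε z :=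
      (hρ₀_nonneg ε hε).mono fun z hz => mul_nonneg (by positivity) hz
    have hm : Integrable (fun z : ℝ × ℝ => (z.1 ^ 2 + z.2 ^ 2) * ρ₀ ε z) := by
      refine memLp_one_iff_integrable.1 ⟨?_, (hK ε hε).trans_lt ENNReal.coe_lt_top⟩
      have hc : Continuous fun z : ℝ × ℝ => z.1 ^ 2 + z.2 ^ 2 := by fun_prop
      exact hc.aestronglyMeasurable.mul (i₀ ε hε).aestronglyMeasurable
    have h1 := hK ε hε
    rw [eLpNorm_one_eq_ofReal hm hnn, ← ENNReal.ofReal_coe_nnreal,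
      ENNReal.ofReal_le_ofReal_iff (NNReal.coe_nonneg K)] at h1
    have h2 := (hρ ε hε).lintegral_sq_mul_le hD.le hε (hρ₀_nonneg ε hε) hm ht.1
    have h3 : eLpNorm (fun z : ℝ × ℝ => (z.1 ^ 2 + z.2 ^ 2) * ρ ε t z) 1 volume =
        ∫⁻ z, ENNReal.ofReal ((z.1 ^ 2 + z.2 ^ 2) * ρ ε t z) := by
      rw [eLpNorm_one_eq_lintegral_enorm]
      refine lintegral_congr_ae ((pos ε hε t ht.1).mono fun z hz => ?_)
      exact Real.enorm_of_nonneg (mul_nonneg (by positivity) hz)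
    rw [h3]
    refine h2.trans (ENNReal.ofReal_le_ofReal (add_le_add h1 ?_))
    have h4 := hint ε hε
    have h5 : 0 ≤ ∫ z, ρ₀ ε z := integral_nonneg_of_ae (hρ₀_nonneg ε hε)
    exact mul_le_mul (mul_le_mul_of_nonneg_left h4 (by positivity)) ht.2 ht.1 (by positivity)
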